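/- Let $\mathbb F_q$ be a finite field with a fixed total order such that $0<1\le\mu$ for all $\mu\in\mathbb F_q^*$, let $k,m\ge 0$, and let $\Gamma L_k(q)=GL_k(q)\rtimes \mathrm{Aut}(\mathbb F_q)$ act on subspaces of $\mathbb F_q^k$ by $(A,\tau)\mathcal U=A\,\tau(\mathcal U)$, hence on sequences $\mathcal C=(\mathcal C_1,\dots,\mathcal C_m)$ of finite multisets of subspaces. **Setting.** *Preprocessing.* Give each subspace occurring in $\mathcal C$ as colour its dimension together with its multiplicities in $\mathcal C_1,\dots,\mathcal C_m$. In this way replace $\mathcal C$ by a sequence of disjoint sets (one for each occurring colour, in lexicographic order). The profile of a hyperplane is the function giving the number of subspaces of each colour contained in it. Append to the sequence a list of blocks of hyperplanes of equal profile. The list of chosen profiles is duplicate-free and is the same for $\mathcal C$ and $g\mathcal C$ for all $g\in\Gamma L_k(q)$, and the normal vectors of the chosen hyperplanes span $\mathbb F_q^k$. Let $n$ and $h$ be the numbers of subspaces and of chosen hyperplanes. Represent $\mathcal C$ by any sequence $x_0=(U,V)$, $U_i\in\mathbb F_q^{k\times s(i)}$ of rank $s(i)$ with columns generating the $i$-th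 subspace, $v_j\in\mathbb F_q^k$ a normal vector of the $j$-th hyperplane; every subspace and chosen hyperplane is listed once, in its cell. The cells define an initial partition $\mathfrak P_0$ of the $n+h$ positions. The Young subgroup $S_{\mathfrak P}$ consists of the permutations fixing every cell of $\mathfrak P$ setwise. The group $S_{\mathfrak P_0}$ permutes the entries of $x_0$, and $G=(GL_k(q)\times\prod_i GL_{s(i)}(q)\times(\mathbb F_q^*)^h)\rtimes\mathrm{Aut}(\mathbb F_q)$ acts by $(A,B,b,\tau)(U,V)=((A\tau(U_i)B_i^T)_i,((A^{-1})^T\tau(v_j)b_j)_j)$. *Nodes.* A node consists of a partition $\mathfrak P$ refining $\mathfrak P_0$, $\pi\in S_{\mathfrak P_0}$, a sequence $x\in G\pi x_0$, a subgroup $\mathrm{Inn}\le G$ (inner stabilizer), the $\Gamma L_k(q)$-component of the element of $G$ that led from $\pi x_0$ to $x$, and the list of values computed on the path. The root is $(\mathfrak P_0,\mathrm{id},x_0,G)$. *Inner minimization*, applied whenever new singletons appear. (1) Each newly fixed normal vector, in order, is replaced by the colexicographically least one in its $\mathrm{Inn}$-orbit, acting by an element of $\mathrm{Inn}$ on $x$;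 $\mathrm{Inn}$ becomes the stabilizer of the result. Let $t$ be the rank of the fixed normal vectors. (2) If $t$ has increased, the cells of subspaces are sorted and split by the canonical forms, up to nonzero scaling of rows and columns and field automorphisms, of the reduced column echelon forms of the first $t$ rows of the $U_i$; an element of $\mathrm{Inn}$ is applied that brings these rows to reduced column echelon form up to column scalars; and $\mathrm{Inn}$ is restricted to the elements with $B_i=\left(\begin{smallmatrix}E_i&F_i\\0&G_i\end{smallmatrix}\right)$, $E_i$ diagonal of size $t_i$, the rank of the first $t$ rows of $U_i$. (3) For every fixed subspace position in turn, the first $t$ rows of $U_i$ are replaced by the least ones in the $\mathrm{Inn}$-orbit (columns compared in order, each colexicographically), and $\mathrm{Inn}$ becomes the stabilizer of the result. *Refinement.* A refinement applies the Homomorphism Principle to a map $f$ that is $\mathrm{Inn}$-invariant and $S_{\mathfrak P}$-equivariant on the semicanonical sequences for $(\mathfrak P,\mathrm{Inn})$, with values in a totally ordered set carrying an action of $S_{\mathfrak P}$ and a canonization whose canonical forms have standard Young subgroups as stabilizers. Here $x$ is semicanonical if all $U_i$ have full column rank, all $v_j\neq0$, and, with $t$ the rank of the fixed normal vectors, for all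 $g\in\mathrm{Inn}$ the fixed normal vectors and the first $t$ rows of the fixed $U_i$ agree in $gx$ and $x$, and the first $t$ rows of every $U_i$ of $gx$ are in reduced column echelon form up to column scalars. The transporter of $f(x)$ is applied, $\mathfrak P$ is replaced by the partition belonging to the stabilizer, and the inner minimization is applied if there are new singletons. *Search.* The tree is traversed depth first. The root is first minimized and refined. At a node with non-discrete $\mathfrak P$ a target cell $P\in\mathfrak P$, $|P|>1$, is chosen; with $\mu=\min P$ and for each $j\in P$ the transposition $(\mu,j)$ is applied, $\mu$ is separated from $P\setminus\{\mu\}$, the inner minimization and then boundedly many refinements are performed, and the child is treated recursively. All newly computed values are compared, lexicographically along the path, with those of the current candidate leaf: if they are smaller the candidate is discarded, if they are larger the child is pruned. Before each refinement the child is pruned if $T\cap S_{\mathfrak P}\pi=\emptyset$, where $T$ is a left transversal of the group $A\le S_{\mathfrak P_0}$ of known automorphisms. A leaf ($\mathfrak P$ discrete) becomes the candidate if there is none. Otherwise $\pi^{-1}\pi^{\mathrm{Can}}$ is added to the generators of $A$ ($\pi^{\mathrm{Can}}$ being the permutation of the candidate), and $T$ is replaced by a left transversal of the new $A$ contained in the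 old $T$. The target cell, $f$ and the end of the refinement process are chosen by arbitrary fixed rules depending only on the colours, profiles and cell sizes, on $\mathfrak P$, on $\mathrm{Inn}$, and on the values computed on the path; the new transversals are chosen by an arbitrary fixed rule that may depend on the colours, profiles, cell sizes, the old $T$ and the new $A$. *Output.* Let $(\pi^{\mathrm{Can}},(U^{\mathrm{Can}},V^{\mathrm{Can}}),\mathrm{Inn}^{\mathrm{Can}},a^{\mathrm{Can}})$ be the final candidate, $a^{\mathrm{Can}}$ its $\Gamma L_k(q)$-component, and $\sigma_1,\dots,\sigma_z$ the generators found for $A$. Put $CF(\mathcal C)$ = the sequence of multisets of the column spaces of the $U_i^{\mathrm{Can}}$, with the multiplicities recorded by the colours; $TR(\mathcal C)=a^{\mathrm{Can}}$; and $\mathrm{Aut}(\mathcal C)$ = the subgroup generated by $(a^{\mathrm{Can}})^{-1}\,\Pi_{\Gamma L_k}(\mathrm{Inn}^{\mathrm{Can}})\,a^{\mathrm{Can}}$ and the elements $(a^{\mathrm{Can}})^{-1}a_i$, where $\Pi_{\Gamma L_k}$ is the projection onto the $\Gamma L_k(q)$-component and $a_i$ is the $\Gamma L_k(q)$-component of an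 element of $G$ mapping $\pi^{\mathrm{Can}}\sigma_i x_0$ to $(U^{\mathrm{Can}},V^{\mathrm{Can}})$. **Theorem.** Every $\mathcal C$ has a matrix representation $x_0$, and for every choice of the rules above and of one representation for every sequence, the map $\mathcal C\mapsto(CF(\mathcal C),TR(\mathcal C),\mathrm{Aut}(\mathcal C))$ computed by the algorithm solves the canonization problem: for all $\mathcal C$ and all $g\in\Gamma L_k(q)$, $$CF(g\,\mathcal C)=CF(\mathcal C),\qquad CF(\mathcal C)=TR(\mathcal C)\,\mathcal C,\qquad \mathrm{Aut}(\mathcal C)=\{g\in\Gamma L_k(q)\mid g\,\mathcal C=\mathcal C\}.$$ -/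

import Mathlib

open scoped Matrix

noncomputable section

namespace SubspaceCanon

/-! ### The canonization problem -/

/-- `Can x = (CF x, TR x, Stab x)` solves the canonization problem for the action of `G` on `X`. -/
def IsCanonization {G X : Type*} [Group G] [MulAction G X] (Can : X → X × G × Subgroup G) : Prop :=
  (∀ (x : X) (g : G), (Can x).1 = (Can (g • x)).1) ∧
  (∀ x : X, (Can x).1 = (Can x).2.1 • x) ∧
  (∀ x : X, (Can x).2.2 = MulAction.stabilizer G x)

/-! ### The general semilinear group and its action on sequences of multisets of subspaces -/

section Semilinear

variable (F : Type*) [Field F]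

/-- Entrywise action of field automorphisms on `GL_s(q)`. -/
def galGL (s : ℕ) : RingAut F →* MulAut (GL (Fin s) F) where
  toFun τ :=
    { toFun := Matrix.GeneralLinearGroup.map (τ : F →+* F)
      invFun := Matrix.GeneralLinearGroup.map ((τ⁻¹ : RingAut F) : F →+* F)
      left_inv := fun A => by
        ext i j
        exact τ.symm_apply_apply _
      right_inv := fun A => by
        ext i j
        exact τ.apply_symm_apply _
      map_mul' := fun A B => map_mul _ A B }
  map_one' := by ext A i j; rfl
  map_mul' σ τ := by ext A i j; rfl

/-- The general semilinear group `ΓL_k(q) = GL_k(q) ⋊ Aut(F_q)`. -/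
abbrev GammaL (k : ℕ) := SemidirectProduct (GL (Fin k) F) (RingAut F) (galGL F k)

/-- The projective space: all subspaces of `F_q^k`. -/
abbrev Sub (k : ℕ) := Submodule F (Fin k → F)

/-- Sequences of `m` multisets of subspaces of `F_q^k`. -/
abbrev Config (k m : ℕ) := Fin m → Multiset (Sub F k)

variable {F}

/-- The semilinear map `v ↦ A τ(v)`. -/
def semilin {k : ℕ} (g : GammaL F k) (v : Fin k → F) : Fin k → F :=
  (g.left : Matrix (Fin k) (Fin k) F) *ᵥ (fun a => g.right (v a))

theorem semilin_one {k : ℕ} (v : Fin k → F) : semilin (1 : GammaL F k) v = v := by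
  simp [semilin]

theorem semilin_mul {k : ℕ} (g h : GammaL F k) (v : Fin k → F) :
    semilin (g * h) v = semilin g (semilin h v) := by
  ext a
  simp only [semilin, SemidirectProduct.mul_left, SemidirectProduct.mul_right, Units.val_mul,
    ← Matrix.mulVec_mulVec]
  congr 2
  ext b
  simp [Matrix.mulVec, dotProduct, galGL, map_sum]

instance instActSub {k : ℕ} : MulAction (GammaL F k) (Sub F k) where
  smul g W :=
    { carrier := semilin g '' W
      zero_mem' := ⟨0, W.zero_mem, by ext; simp [semilin, Matrix.mulVec, dotProduct]⟩
      add_mem' := by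
        rintro _ _ ⟨u, hu, rfl⟩ ⟨v, hv, rfl⟩
        refine ⟨u + v, W.add_mem hu hv, ?_⟩
        simp only [semilin, ← Matrix.mulVec_add]
        congr 1
        ext a
        simp
      smul_mem' := by
        rintro c _ ⟨u, hu, rfl⟩
        refine ⟨g.right.symm c • u, W.smul_mem _ hu, ?_⟩
        simp only [semilin, ← Matrix.mulVec_smul]
        congr 1
        ext a
        simp }
  one_smul W := by
    refine SetLike.coe_injective ?_
    change semilin 1 '' (W : Set (Fin k → F)) = W
    simp [Set.image, semilin_one]
  mul_smul g h W := by
    refine SetLike.coe_injective ?_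
    change semilin (g * h) '' (W : Set (Fin k → F)) = semilin g '' (semilin h '' W)
    simp [Set.image_image, semilin_mul]

/-- Action on multisets of subspaces; sequences of multisets carry the componentwise action. -/
instance instActMultiset {k : ℕ} : MulAction (GammaL F k) (Multiset (Sub F k)) where
  smul g M := M.map (g • ·)
  one_smul M := by change M.map _ = M; simp
  mul_smul g h M := by change M.map _ = (M.map _).map _; simp [mul_smul]

end Semilinear

/-! ### Shapes, matrix representations, and the acting groups -/

/-- Subspaces occurring in a sequence of `m` multisets are distinguished by their dimension and
their sequence of multiplicities. -/
abbrev Color (m : ℕ) := Lex (ℕ × Lex (Fin m → ℕ))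

/-- The combinatorial data of a preprocessed input: `nC` disjoint sets of subspaces, the `c`-th of
colour `col c` and with `n c` elements, and `nH` sets of hyperplanes, the `d`-th of profile `prof d`
and with `h d` elements. -/
structure Shape (m : ℕ) where
  nC : ℕ
  col : Fin nC → Color m
  n : Fin nC → ℕ
  nH : ℕ
  prof : Fin nH → (Color m → ℕ)
  h : Fin nH → ℕ

namespace Shape

variable {m : ℕ} (Sh : Shape m)

/-- The common dimension of the subspaces in the `c`-th set. -/
def s (c : Fin Sh.nC) : ℕ := (ofLex (Sh.col c)).1

/-- The multiplicity, in the `i`-th multiset, of each of the subspaces in the `c`-th set. -/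
def mult (c : Fin Sh.nC) (i : Fin m) : ℕ := (ofLex (Sh.col c)).2 i

/-- The positions of the sequence, i.e. the set `{1, …, n + h}`; its order is the one in which the
subspaces precede the hyperplanes and every initial cell is an interval. -/
inductive Pos (Sh : Shape m) : Type
  | sub (c : Fin Sh.nC) (i : Fin (Sh.n c)) : Pos Sh
  | hyp (d : Fin Sh.nH) (j : Fin (Sh.h d)) : Pos Sh

/-- Numerical key that defines the order of the positions. -/
def key : Pos Sh → Lex (ℕ × Lex (ℕ × ℕ))
  | .sub c i => toLex (0, toLex ((c : ℕ), (i : ℕ)))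
  | .hyp d j => toLex (1, toLex ((d : ℕ), (j : ℕ)))

theorem key_injective : Function.Injective Sh.key := by
  rintro (⟨c, i⟩ | ⟨d, j⟩) (⟨c', i'⟩ | ⟨d', j'⟩) h
  · simp only [key, EmbeddingLike.apply_eq_iff_eq, Prod.mk.injEq, true_and] at h
    obtain ⟨h1, h2⟩ := h
    obtain rfl := Fin.ext h1
    obtain rfl := Fin.ext h2
    rfl
  · simp [key] at h
  · simp [key] at h
  · simp only [key, EmbeddingLike.apply_eq_iff_eq, Prod.mk.injEq, true_and] at h
    obtain ⟨h1, h2⟩ := h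
    obtain rfl := Fin.ext h1
    obtain rfl := Fin.ext h2
    rfl

instance instLinearOrderPos : LinearOrder (Pos Sh) := LinearOrder.lift' Sh.key Sh.key_injective

/-- The positions of the subspaces, in increasing order. -/
def subPos : List (Pos Sh) :=
  (List.finRange Sh.nC).flatMap fun c => (List.finRange (Sh.n c)).map (Pos.sub c)

/-- The positions of the hyperplanes, in increasing order. -/
def hypPos : List (Pos Sh) :=
  (List.finRange Sh.nH).flatMap fun d => (List.finRange (Sh.h d)).map (Pos.hyp d)

/-- The Young subgroup of the initial partition, written as a product of symmetric groups. -/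
abbrev Sym :=
  ((c : Fin Sh.nC) → Equiv.Perm (Fin (Sh.n c))) × ((d : Fin Sh.nH) → Equiv.Perm (Fin (Sh.h d)))

instance instActPos : MulAction Sh.Sym (Pos Sh) where
  smul σ p := match p with
    | .sub c i => .sub c (σ.1 c i)
    | .hyp d j => .hyp d (σ.2 d j)
  one_smul p := by cases p <;> rfl
  mul_smul σ τ p := by cases p <;> rfl

/-- The transposition of two positions of the same initial cell. -/
def swap : Pos Sh → Pos Sh → Sh.Sym
  | .sub c i, .sub c' i' =>
    if e : c' = c then (Pi.mulSingle c (Equiv.swap i (e ▸ i')), 1) else 1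
  | .hyp d j, .hyp d' j' =>
    if e : d' = d then (1, Pi.mulSingle d (Equiv.swap j (e ▸ j'))) else 1
  | _, _ => 1

/-- The initial partition of the set of positions; partitions are given by equivalence relations. -/
def initialPartition : Setoid (Pos Sh) where
  r p q := match p, q with
    | .sub c _, .sub c' _ => c = c'
    | .hyp d _, .hyp d' _ => d = d'
    | _, _ => False
  iseqv :=
    { refl := fun p => by cases p <;> rfl
      symm := fun {p q} h => by cases p <;> cases q <;> first | exact h.symm | exact h
      trans := fun {p q r} h h' => by
        cases p <;> cases q <;> cases r <;>
          first | exact h.trans h' | exact h.elim | exact h'.elim }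

variable {Sh}

/-- All cells are intervals. -/
def IsStandard (P : Setoid (Pos Sh)) : Prop := ∀ p q r, p ≤ q → q ≤ r → P p r → P p q

/-- The Young subgroup `S_P`: the permutations that map every cell of `P` onto itself. -/
def young (P : Setoid (Pos Sh)) : Subgroup Sh.Sym where
  carrier := {σ | ∀ p, P (σ • p) p}
  one_mem' p := by rw [one_smul]
  mul_mem' {σ τ} hσ hτ p := by rw [mul_smul]; exact P.trans (hσ _) (hτ p)
  inv_mem' {σ} hσ p := by
    have := hσ (σ⁻¹ • p)
    rw [smul_inv_smul] at this
    exact P.symm this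

/-- The positions which form singletons of `P`. -/
def fixed (P : Setoid (Pos Sh)) : Set (Pos Sh) := {p | ∀ q, P p q → q = p}

/-- Replace the cell of `p` by `{p}` and the remainder of the cell. -/
def separate (P : Setoid (Pos Sh)) (p : Pos Sh) : Setoid (Pos Sh) where
  r q q' := P q q' ∧ (q = p ↔ q' = p)
  iseqv :=
    { refl := fun q => ⟨P.refl q, Iff.rfl⟩
      symm := fun h => ⟨P.symm h.1, h.2.symm⟩
      trans := fun h h' => ⟨P.trans h.1 h'.1, h.2.trans h'.2⟩ }

/-- Split every cell of `P` according to the values of `l`. -/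
def splitBy {α : Type*} (P : Setoid (Pos Sh)) (l : Pos Sh → α) : Setoid (Pos Sh) where
  r q q' := P q q' ∧ l q = l q'
  iseqv :=
    { refl := fun q => ⟨P.refl q, rfl⟩
      symm := fun h => ⟨P.symm h.1, h.2.symm⟩
      trans := fun h h' => ⟨P.trans h.1 h'.1, h.2.trans h'.2⟩ }

end Shape

open Shape

section Objects

variable (F : Type*) [Field F] (k : ℕ) {m : ℕ} (Sh : Shape m)

/-- Sequences of generator matrices `U` (columns generate the subspaces) and of normal
vectors `V`. -/
@[ext] structure Obj where
  U : (c : Fin Sh.nC) → Fin (Sh.n c) → Matrix (Fin k) (Fin (Sh.s c)) F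
  V : (d : Fin Sh.nH) → Fin (Sh.h d) → (Fin k → F)

/-- `GL_k(q) × ∏ GL_{s_i}(q)^{n_i} × (F_q^*)^h`. -/
abbrev LinPart :=
  GL (Fin k) F × ((c : Fin Sh.nC) → Fin (Sh.n c) → GL (Fin (Sh.s c)) F) ×
    ((d : Fin Sh.nH) → Fin (Sh.h d) → Fˣ)

/-- Componentwise action of the field automorphisms. -/
def galLin : RingAut F →* MulAut (LinPart F k Sh) where
  toFun τ :=
    { toFun := fun N => (galGL F k τ N.1, fun c i => galGL F (Sh.s c) τ (N.2.1 c i),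
        fun d j => Units.map (τ : F →* F) (N.2.2 d j))
      invFun := fun N => (galGL F k τ⁻¹ N.1, fun c i => galGL F (Sh.s c) τ⁻¹ (N.2.1 c i),
        fun d j => Units.map ((τ⁻¹ : RingAut F) : F →* F) (N.2.2 d j))
      left_inv := fun N => by
        ext
        · exact τ.symm_apply_apply _
        · exact τ.symm_apply_apply _
        · exact τ.symm_apply_apply _
      right_inv := fun N => by
        ext
        · exact τ.apply_symm_apply _
        · exact τ.apply_symm_apply _
        · exact τ.apply_symm_apply _
      map_mul' := fun M N => by
        ext
        · simp
        · simp
        · simp }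
  map_one' := by ext <;> rfl
  map_mul' σ τ := by ext <;> rfl

/-- The group `(GL_k(q) × ∏ GL_{s_i}(q)^{n_i} × (F_q^*)^h) ⋊ Aut(F_q)`. -/
abbrev Gsl := SemidirectProduct (LinPart F k Sh) (RingAut F) (galLin F k Sh)

variable {F k Sh}

/-- The projection onto `ΓL_k(q)`. -/
def toGammaL (g : Gsl F k Sh) : GammaL F k := ⟨g.left.1, g.right⟩

/-- `(A, B, b, τ) (U, V) = (A τ(U_i) B_iᵀ, (A⁻¹)ᵀ τ(v_j) b_j)`. -/
instance instActObj : MulAction (Gsl F k Sh) (Obj F k Sh) where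
  smul g x :=
    { U := fun c i => (g.left.1 : Matrix (Fin k) (Fin k) F) * (x.U c i).map g.right *
        ((g.left.2.1 c i : Matrix (Fin (Sh.s c)) (Fin (Sh.s c)) F))ᵀ
      V := fun d j => (g.left.2.2 d j : F) •
        (((g.left.1⁻¹ : GL (Fin k) F) : Matrix (Fin k) (Fin k) F)ᵀ *ᵥ
          fun a => g.right (x.V d j a)) }
  one_smul x := by
    ext c i a l
    · change ((1 : Matrix (Fin k) (Fin k) F) * (x.U c i).map (1 : RingAut F) *
        (1 : Matrix (Fin (Sh.s c)) (Fin (Sh.s c)) F)ᵀ) a l = _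
      simp
    · change ((1 : F) • (((1⁻¹ : GL (Fin k) F) : Matrix (Fin k) (Fin k) F)ᵀ *ᵥ
        fun a => (1 : RingAut F) (x.V c i a))) a = _
      simp
  mul_smul g g' x := by
    ext c i a l
    · change ((((g * g').left.1 : GL (Fin k) F) : Matrix (Fin k) (Fin k) F) *
          (x.U c i).map (g * g').right *
          (((g * g').left.2.1 c i : Matrix (Fin (Sh.s c)) (Fin (Sh.s c)) F))ᵀ) a l =
        ((g.left.1 : Matrix (Fin k) (Fin k) F) *
          ((g'.left.1 : Matrix (Fin k) (Fin k) F) * (x.U c i).map g'.right *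
            ((g'.left.2.1 c i : Matrix (Fin (Sh.s c)) (Fin (Sh.s c)) F))ᵀ).map g.right *
          ((g.left.2.1 c i : Matrix (Fin (Sh.s c)) (Fin (Sh.s c)) F))ᵀ) a l
      have h1 : (((g * g').left.1 : GL (Fin k) F) : Matrix (Fin k) (Fin k) F) =
          (g.left.1 : Matrix (Fin k) (Fin k) F) *
            (g'.left.1 : Matrix (Fin k) (Fin k) F).map g.right := rfl
      have h2 : (((g * g').left.2.1 c i : GL (Fin (Sh.s c)) F) : Matrix _ _ F) =
          (g.left.2.1 c i : Matrix (Fin (Sh.s c)) (Fin (Sh.s c)) F) *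
            (g'.left.2.1 c i : Matrix (Fin (Sh.s c)) (Fin (Sh.s c)) F).map g.right := rfl
      have h3 : (x.U c i).map (g * g').right = ((x.U c i).map g'.right).map g.right := rfl
      rw [h1, h2, h3, Matrix.map_mul, Matrix.map_mul, Matrix.transpose_mul, Matrix.transpose_map]
      simp only [Matrix.mul_assoc]
    · change (((g * g').left.2.2 c i : F) •
          ((((g * g').left.1⁻¹ : GL (Fin k) F) : Matrix (Fin k) (Fin k) F)ᵀ *ᵥ
            fun a => (g * g').right (x.V c i a))) a =
        ((g.left.2.2 c i : F) • (((g.left.1⁻¹ : GL (Fin k) F) : Matrix (Fin k) (Fin k) F)ᵀ *ᵥ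
          fun a => g.right (((g'.left.2.2 c i : F) •
            (((g'.left.1⁻¹ : GL (Fin k) F) : Matrix (Fin k) (Fin k) F)ᵀ *ᵥ
              fun a => g'.right (x.V c i a))) a))) a
      have h0 : (g * g').left.1 = g.left.1 * galGL F k g.right g'.left.1 := rfl
      have h1 : (((g * g').left.1⁻¹ : GL (Fin k) F) : Matrix (Fin k) (Fin k) F) =
          ((g'.left.1⁻¹ : GL (Fin k) F) : Matrix (Fin k) (Fin k) F).map g.right *
          ((g.left.1⁻¹ : GL (Fin k) F) : Matrix (Fin k) (Fin k) F) := by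
        rw [h0, mul_inv_rev, ← map_inv]
        rfl
      have h2 : ((g * g').left.2.2 c i : F) =
          (g.left.2.2 c i : F) * g.right (g'.left.2.2 c i : F) := rfl
      have h3 : (fun a => g.right (((g'.left.2.2 c i : F) •
            (((g'.left.1⁻¹ : GL (Fin k) F) : Matrix (Fin k) (Fin k) F)ᵀ *ᵥ
              fun a => g'.right (x.V c i a))) a)) = g.right (g'.left.2.2 c i : F) •
          ((((g'.left.1⁻¹ : GL (Fin k) F) : Matrix (Fin k) (Fin k) F).map g.right)ᵀ *ᵥ
            fun a => (g * g').right (x.V c i a)) := by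
        ext b
        simp [Matrix.mulVec, dotProduct, map_sum]
      rw [h3, h1, h2, Matrix.transpose_mul, Matrix.mulVec_smul, smul_smul, Matrix.mulVec_mulVec]

/-- `σ (x_1, …) = (x_{σ⁻¹(1)}, …)`. -/
instance instActSym : MulAction Sh.Sym (Obj F k Sh) where
  smul σ x :=
    { U := fun c i => x.U c ((σ.1 c)⁻¹ i)
      V := fun d j => x.V d ((σ.2 d)⁻¹ j) }
  one_smul x := rfl
  mul_smul σ τ x := by
    ext
    · change x.U _ (((σ * τ).1 _)⁻¹ _) _ _ = x.U _ ((τ.1 _)⁻¹ ((σ.1 _)⁻¹ _)) _ _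
      simp
    · change x.V _ (((σ * τ).2 _)⁻¹ _) _ = x.V _ ((τ.2 _)⁻¹ ((σ.2 _)⁻¹ _)) _
      simp

end Objects

/-! ### Preprocessing -/

section Preprocessing

variable {F : Type*} [Field F] {k m : ℕ}

/-- The column space. -/
def colSpace {s : ℕ} (U : Matrix (Fin k) (Fin s) F) : Sub F k := Submodule.span F (Set.range U.col)

/-- The dual of the point generated by `v`; a hyperplane if `v ≠ 0`. -/
def perp (v : Fin k → F) : Sub F k where
  carrier := {u | v ⬝ᵥ u = 0}
  zero_mem' := dotProduct_zero v
  add_mem' {u w} hu hw := by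
    change v ⬝ᵥ (u + w) = 0
    rw [dotProduct_add, hu, hw, add_zero]
  smul_mem' c u hu := by
    change v ⬝ᵥ (c • u) = 0
    rw [dotProduct_smul, hu, smul_zero]

open Classical in
/-- The finite set of all subspaces which occur in `C`. -/
def supp (C : Config F k m) : Finset (Sub F k) := Finset.univ.biUnion fun i => (C i).toFinset

open Classical in
/-- The dimension and the sequence of multiplicities. -/
def color (C : Config F k m) (W : Sub F k) : Color m :=
  toLex (Module.finrank F W, toLex fun i => (C i).count W)

/-- The occurring colours, in increasing order. -/
def colors (C : Config F k m) : List (Color m) := ((supp C).image (color C)).sort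

open Classical in
/-- The number of elements of each colour which are contained in the subspace `W`. -/
def profile (C : Config F k m) (W : Sub F k) : Color m → ℕ :=
  fun c => ((supp C).filter fun W' => color C W' = c ∧ W' ≤ W).card

variable (F k m)

/-- The choice of the set of hyperplanes in the preprocessing: the hyperplanes are partitioned by
their profiles, and a sequence of blocks of this partition is selected. The selection is well
defined, i.e. invariant under `ΓL_k(q)`, and contains `k` linearly independent normal vectors. -/
structure Preprocessing where
  sel : Config F k m → List (Color m → ℕ)
  nodup : ∀ C, (sel C).Nodup
  invariant : ∀ (g : GammaL F k) (C : Config F k m), sel (g • C) = sel C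
  spanning : ∀ C, Submodule.span F {v : Fin k → F | v ≠ 0 ∧ profile C (perp v) ∈ sel C} = ⊤

variable {F k m}

open Classical in
/-- The shape of the sequence of disjoint sets obtained from `C`, followed by the selected sets of
hyperplanes. -/
def shapeOf (pre : Preprocessing F k m) (C : Config F k m) : Shape m where
  nC := (colors C).length
  col := (colors C).get
  n c := ((supp C).filter fun W => color C W = (colors C).get c).card
  nH := (pre.sel C).length
  prof := (pre.sel C).get
  h d := {W : Sub F k | ∃ v ≠ 0, W = perp v ∧ profile C W = (pre.sel C).get d}.ncard

/-- `x` is a sequence of generator matrices and normal vectors for the preprocessed input: every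
subspace and every selected hyperplane is listed exactly once, in the cell where it belongs. -/
structure Represents (pre : Preprocessing F k m) (C : Config F k m)
    (x : Obj F k (shapeOf pre C)) : Prop where
  indep : ∀ c i, LinearIndependent F (x.U c i).col
  sub_inj : ∀ c, Function.Injective fun i => colSpace (x.U c i)
  sub_range : ∀ c, Set.range (fun i => colSpace (x.U c i)) =
    {W | W ∈ supp C ∧ color C W = (shapeOf pre C).col c}
  ne_zero : ∀ d j, x.V d j ≠ 0
  hyp_inj : ∀ d, Function.Injective fun j => perp (x.V d j)
  hyp_range : ∀ d, Set.range (fun j => perp (x.V d j)) =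
    {W | ∃ v ≠ 0, W = perp v ∧ profile C W = (shapeOf pre C).prof d}

/-- The sequence of multisets given by the column spaces of the generator matrices. -/
def decode {Sh : Shape m} (x : Obj F k Sh) : Config F k m :=
  fun i => ∑ c, ∑ j, Multiset.replicate (Sh.mult c i) (colSpace (x.U c j))

end Preprocessing

/-! ### Canonical forms of the components -/

section Components

variable {F : Type*} [Field F] {k : ℕ}

/-- The first `t` rows; the remaining rows are replaced by zero. -/
def topRows (t : ℕ) {s : ℕ} (U : Matrix (Fin k) (Fin s) F) : Matrix (Fin k) (Fin s) F :=
  Matrix.of fun a l => if (a : ℕ) < t then U a l else 0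

/-- Reduced column echelon form, up to multiplication of the columns by nonzero scalars. -/
def IsRCEF {s : ℕ} (M : Matrix (Fin k) (Fin s) F) : Prop :=
  ∃ (r : ℕ) (piv : Fin s → Fin k),
    (∀ l l' : Fin s, l < l' → (l' : ℕ) < r → piv l < piv l') ∧
    (∀ l : Fin s, (l : ℕ) < r → M (piv l) l ≠ 0 ∧ (∀ a < piv l, M a l = 0) ∧
      ∀ l', l' ≠ l → M (piv l) l' = 0) ∧
    ∀ l : Fin s, r ≤ (l : ℕ) → ∀ a, M a l = 0

/-- The group `GL_s^{(t)}(q)` of all invertible matrices with upper left block a diagonal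
`t × t` matrix and lower left block zero. -/
def diagGL (F : Type*) [Field F] (s t : ℕ) : Subgroup (GL (Fin s) F) where
  carrier := {B | ∀ i j : Fin s, (j : ℕ) < t → i ≠ j → (B : Matrix (Fin s) (Fin s) F) i j = 0}
  one_mem' i j _ hij := by simp [hij]
  mul_mem' {A B} hA hB i j hj hij := by
    rw [Units.val_mul, Matrix.mul_apply]
    refine Finset.sum_eq_zero fun l _ => ?_
    by_cases hl : l = j
    · rw [hl, hA i j hj hij, zero_mul]
    · rw [hB l j hj hl, mul_zero]
  inv_mem' {A} hA i j hj hij := by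
    have key : ∀ i, (1 : Matrix (Fin s) (Fin s) F) i j =
        ((A⁻¹ : GL (Fin s) F) : Matrix (Fin s) (Fin s) F) i j *
          (A : Matrix (Fin s) (Fin s) F) j j := by
      intro i
      have h : ((A⁻¹ : GL (Fin s) F) : Matrix (Fin s) (Fin s) F) *
          (A : Matrix (Fin s) (Fin s) F) = 1 := by
        rw [← Units.val_mul, inv_mul_cancel, Units.val_one]
      rw [← h, Matrix.mul_apply, Finset.sum_eq_single j]
      · intro l _ hl
        rw [hA l j hj hl, mul_zero]
      · simp
    have h1 := key j
    have h2 := key i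
    rw [Matrix.one_apply_eq] at h1
    rw [Matrix.one_apply_ne hij] at h2
    exact (mul_eq_zero.mp h2.symm).resolve_right (right_ne_zero_of_mul (h1 ▸ one_ne_zero))

/-- A column vector, listed such that the lexicographic order of lists is the colexicographic order
of vectors. -/
def vecList (v : Fin k → F) : List F := (List.finRange k).reverse.map v

/-- A matrix as the sequence of its columns. -/
def matList {s : ℕ} (M : Matrix (Fin k) (Fin s) F) : List F :=
  (List.finRange s).flatMap fun l => vecList (M.col l)

variable {m : ℕ} {Sh : Shape m}

/-- The part of the sequence at position `p` which is minimized by the inner minimization: the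
normal vector, or the first `t` rows of the generator matrix. -/
def entry (t : ℕ) (x : Obj F k Sh) : Pos Sh → List F
  | .sub c i => matList (topRows t (x.U c i))
  | .hyp d j => vecList (x.V d j)

/-- The rank of the normal vectors at the positions in `A`. -/
def rankOf (A : Set (Pos Sh)) (x : Obj F k Sh) : ℕ :=
  Module.finrank F (Submodule.span F {v | ∃ d j, Pos.hyp d j ∈ A ∧ v = x.V d j})

open Classical in
/-- The least element of a set, if there is one. -/
def leastOf {α : Type*} [Preorder α] [Inhabited α] (S : Set α) : α :=
  if h : ∃ a, IsLeast S a then h.choose else default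

/-- The canonical form of the orbit of the reduced column echelon form of the first `t` rows of the
generator matrix at position `p` under multiplication of rows and columns by nonzero scalars and
under field automorphisms. -/
def label [LinearOrder F] (t : ℕ) (x : Obj F k Sh) : Pos Sh → List F
  | .sub c i => leastOf {l | ∃ (D : Fin k → Fˣ) (τ : RingAut F) (B : GL (Fin (Sh.s c)) F)
      (M : Matrix (Fin k) (Fin (Sh.s c)) F),
      M = Matrix.diagonal (fun a => (D a : F)) * (topRows t (x.U c i)).map τ *
        (B : Matrix (Fin (Sh.s c)) (Fin (Sh.s c)) F)ᵀ ∧ IsRCEF M ∧ l = matList M}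
  | .hyp _ _ => []

/-- The stabilizer of the value `φ x` in the group `K`, where `φ` is part of a homomorphism of
actions of `K`, so that `φ (g • x) = φ x` implies `φ (h • g • x) = φ (h • x)` for all `h ∈ K`. -/
def stabOf {G X Z : Type*} [Group G] [MulAction G X] (K : Subgroup G) (φ : X → Z) (x : X) :
    Subgroup G where
  carrier := {g | g ∈ K ∧ ∀ h ∈ K, φ (h • g • x) = φ (h • x)}
  one_mem' := ⟨K.one_mem, fun h _ => by rw [one_smul]⟩
  mul_mem' {a b} ha hb := ⟨K.mul_mem ha.1 hb.1, fun h hh => by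
    rw [mul_smul, ← mul_smul h a, hb.2 _ (K.mul_mem hh ha.1), mul_smul, ha.2 h hh]⟩
  inv_mem' {a} ha := ⟨K.inv_mem ha.1, fun h hh => by
    have := ha.2 (h * a⁻¹) (K.mul_mem hh (K.inv_mem ha.1))
    rw [← mul_smul, inv_mul_cancel_right] at this
    rw [this, mul_smul]⟩

open Classical in
/-- An element of `K` which maps `x` to an element of the orbit `K x` with minimal value of `φ`. -/
def minimizer {G X Z : Type*} [Group G] [MulAction G X] [LE Z] (K : Subgroup G) (φ : X → Z)
    (x : X) : G :=
  if h : ∃ g ∈ K, ∀ g' ∈ K, φ (g • x) ≤ φ (g' • x) then h.choose else 1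

end Components

/-! ### The heuristics of the algorithm -/

section Heuristics

variable (F : Type*) [Field F] (k : ℕ) {m : ℕ} (Sh : Shape m)

variable {F k Sh} in
/-- The sequences which can occur at a node with partition `P` and inner stabilizer `K`: up to `K`,
the fixed normal vectors and the first `t` rows of the fixed generator matrices do not change, and
the first `t` rows of all generator matrices are in reduced column echelon form up to scalars, `t`
being the rank of the fixed normal vectors. -/
def IsSemicanonical (P : Setoid (Pos Sh)) (K : Subgroup (Gsl F k Sh)) (x : Obj F k Sh) : Prop :=
  (∀ c i, LinearIndependent F (x.U c i).col) ∧ (∀ d j, x.V d j ≠ 0) ∧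
  ∀ g ∈ K, (∀ p ∈ fixed P, entry (rankOf (fixed P) x) (g • x) p = entry (rankOf (fixed P) x) x p) ∧
    ∀ c i, IsRCEF (topRows (rankOf (fixed P) x) ((g • x).U c i))

/-- An `S_P`-homomorphism `f` for the nodes with partition `P` and inner stabilizer `K`, with values
in a set `Y` on which `S_P` acts, and a canonization for this action, such that the stabilizers
of the canonical forms are standard Young subgroups. -/
structure Refiner (Y : Type*) (P : Setoid (Pos Sh)) (K : Subgroup (Gsl F k Sh)) where
  act : young P →* Equiv.Perm Y
  f : Obj F k Sh → Y
  f_inner : ∀ x, IsSemicanonical P K x → ∀ g ∈ K, f (g • x) = f x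
  f_perm : ∀ x, IsSemicanonical P K x → ∀ σ : young P, f ((σ : Sh.Sym) • x) = act σ (f x)
  cf : Y → Y
  tr : Y → young P
  cf_act : ∀ σ y, cf (act σ y) = cf y
  act_tr : ∀ y, cf y = act (tr y) y
  part : Y → Setoid (Pos Sh)
  part_le : ∀ y, part y ≤ P
  part_standard : ∀ y, IsStandard (part y)
  stab : ∀ y (σ : young P), act σ (cf y) = cf y ↔ (σ : Sh.Sym) ∈ young (part y)

/-- The values which are compared during the search: minimized components, and canonical forms
of the images under the `S_P`-homomorphisms. -/
abbrev Value (F Y : Type*) := Lex (List F ⊕ Y)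

/-- The choices left open by the algorithm. They may depend on the partition, the inner stabilizer
and all values computed on the path from the root to the actual node. -/
structure Strategy where
  /-- The common codomain of the `S_P`-homomorphisms, with some total order. -/
  Y : Type*
  ord : LinearOrder Y
  /-- Target cell selection: a cell which is not a singleton. -/
  targetCell : Setoid (Pos Sh) → Subgroup (Gsl F k Sh) → List (Value F Y) → Set (Pos Sh)
  targetCell_mem : ∀ P K v, P ≠ ⊥ → targetCell P K v ∈ P.classes
  targetCell_nontrivial : ∀ P K v, P ≠ ⊥ → (targetCell P K v).Nontrivial
  /-- Choice of the next `S_P`-homomorphism; `none` ends the refinement process. -/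
  refinementFunc : (P : Setoid (Pos Sh)) → (K : Subgroup (Gsl F k Sh)) → List (Value F Y) →
    Option (Refiner F k Sh Y P K)
  /-- The refinement process ends at the latest after this number of refinements. -/
  rounds : ℕ
  /-- Choice of a left transversal of a larger group of known automorphisms, contained in the
  previous transversal. -/
  shrink : Set Sh.Sym → Subgroup Sh.Sym → Set Sh.Sym
  shrink_subset : ∀ T (A B : Subgroup Sh.Sym), A ≤ B →
    Subgroup.IsComplement T (A : Set Sh.Sym) → shrink T B ⊆ T
  shrink_transversal : ∀ T (A B : Subgroup Sh.Sym), A ≤ B →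
    Subgroup.IsComplement T (A : Set Sh.Sym) →
    Subgroup.IsComplement (shrink T B) (B : Set Sh.Sym)

end Heuristics

/-! ### The backtrack algorithm -/

section Algorithm

variable {F : Type*} [Field F] {k m : ℕ} {Sh : Shape m}

/-- A node of the backtrack tree: the partition, the permutation, the semicanonical representative,
the inner stabilizer, the `ΓL_k(q)`-component of the group element which leads to the semicanonical
representative, and the sequence of all values computed on the path to the node. -/
structure Node (F : Type*) [Field F] (k : ℕ) {m : ℕ} (Sh : Shape m) (Y : Type*) where
  P : Setoid (Pos Sh)
  perm : Sh.Sym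
  x : Obj F k Sh
  inn : Subgroup (Gsl F k Sh)
  acc : GammaL F k
  trace : List (Value F Y)

/-- The global variables: the candidate for the canonical form (with the permutation and the values
of the path leading to it), generators of the group of known automorphisms, and a left transversal
of this group. -/
structure Global (F : Type*) [Field F] (k : ℕ) {m : ℕ} (Sh : Shape m) (Y : Type*) where
  cand : Option (Node F k Sh Y)
  gens : List Sh.Sym
  T : Set Sh.Sym

namespace Global

variable {Y : Type*}

/-- The group of known automorphisms. -/
def aut (st : Global F k Sh Y) : Subgroup Sh.Sym := Subgroup.closure {σ | σ ∈ st.gens}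

/-- Compare newly computed values with those of the candidate, where the first `pos` values have
been compared before. A larger candidate is discarded; the flag is `false` if the candidate is
smaller. -/
def compare [LinearOrder F] [LinearOrder Y] (st : Global F k Sh Y) (pos : ℕ)
    (new : List (Value F Y)) : Bool × Global F k Sh Y :=
  match st.cand with
  | none => (true, st)
  | some c =>
    if new < (c.trace.drop pos).take new.length then (true, { st with cand := none })
    else (decide (new = (c.trace.drop pos).take new.length), st)

end Global

namespace Node

variable {Y : Type*}

/-- Application of a permutation. -/
def permute (nd : Node F k Sh Y) (σ : Sh.Sym) : Node F k Sh Y :=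
  { nd with perm := σ * nd.perm, x := σ • nd.x }

/-- Application of an element of the inner stabilizer. -/
def applyInner (nd : Node F k Sh Y) (g : Gsl F k Sh) : Node F k Sh Y :=
  { nd with x := g • nd.x, acc := toGammaL g * nd.acc }

/-- Record a value. -/
def record (nd : Node F k Sh Y) (v : Value F Y) : Node F k Sh Y :=
  { nd with trace := nd.trace ++ [v] }

/-- Minimize the component at position `p` under the inner group action and replace the inner
stabilizer by the stabilizer of the result. -/
def minimizeAt [LinearOrder F] (t : ℕ) (nd : Node F k Sh Y) (p : Pos Sh) : Node F k Sh Y :=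
  let φ := fun x : Obj F k Sh => entry t x p
  let nd' := nd.applyInner (minimizer nd.inn φ nd.x)
  { nd' with inn := stabOf nd.inn φ nd'.x }.record (toLex (.inl (φ nd'.x)))

open Classical in
/-- A permutation in `S_P` which moves only subspaces and sorts their labels within each cell. -/
def sortPerm [LinearOrder F] (P : Setoid (Pos Sh)) (l : Pos Sh → List F) : Sh.Sym :=
  if h : ∃ σ ∈ young P, σ.2 = 1 ∧ ∀ p q, P p q → p ≤ q → l (σ⁻¹ • p) ≤ l (σ⁻¹ • q) then h.choose
  else 1

/-- Refine the partition by the labels of the generator matrices. -/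
def refineByLabel [LinearOrder F] (t : ℕ) (nd : Node F k Sh Y) : Node F k Sh Y :=
  let nd' := nd.permute (sortPerm nd.P (label t nd.x))
  Sh.subPos.foldl (fun nd p => nd.record (toLex (.inl (label t nd'.x p))))
    { nd' with P := splitBy nd'.P (label t nd'.x) }

open Classical in
/-- An element of `K` which brings the first `t` rows of all generator matrices to reduced column
echelon form up to scalars. -/
def echelonizer (t : ℕ) (K : Subgroup (Gsl F k Sh)) (x : Obj F k Sh) : Gsl F k Sh :=
  if h : ∃ g ∈ K, ∀ c i, IsRCEF (topRows t ((g • x).U c i)) then h.choose else 1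

/-- The subgroup of all elements with components `B_i ∈ GL_{s(i)}^{(t_i)}(q)`, where `t_i` is the
rank of the first `t` rows of the `i`-th generator matrix. -/
def echelonStab (t : ℕ) (x : Obj F k Sh) : Subgroup (Gsl F k Sh) where
  carrier := {g | ∀ c i, g.left.2.1 c i ∈ diagGL F (Sh.s c) (topRows t (x.U c i)).rank}
  one_mem' c i := Subgroup.one_mem _
  mul_mem' {g g'} hg hg' c i := by
    refine Subgroup.mul_mem _ (hg c i) ?_
    intro a b hb hab
    change g.right ((g'.left.2.1 c i : Matrix (Fin (Sh.s c)) (Fin (Sh.s c)) F) a b) = 0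
    rw [hg' c i a b hb hab, map_zero]
  inv_mem' {g} hg c i := by
    intro a b hb hab
    change (g.right⁻¹ : RingAut F) ((((g.left.2.1 c i)⁻¹ : GL (Fin (Sh.s c)) F) :
      Matrix (Fin (Sh.s c)) (Fin (Sh.s c)) F) a b) = 0
    rw [Subgroup.inv_mem _ (hg c i) a b hb hab, map_zero]

/-- Reduced column echelon forms of the first `t` rows of all generator matrices. -/
def echelonize (t : ℕ) (nd : Node F k Sh Y) : Node F k Sh Y :=
  let nd' := nd.applyInner (echelonizer t nd.inn nd.x)
  { nd' with inn := nd.inn ⊓ echelonStab t nd'.x }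

open Classical in
/-- The inner minimization; `old` is the set of singletons of the preceding partition. First the
newly fixed normal vectors are minimized. If this increases the rank `t`, then the cells of
subspaces are refined by the canonical forms of the first `t` rows of the generator matrices up to
scalars, and these rows are brought to reduced column echelon form up to scalars. Finally, the first
`t` rows of the generator matrices at all singletons are minimized. -/
def innerMinimization [LinearOrder F] [LinearOrder Y] (old : Set (Pos Sh)) (nd : Node F k Sh Y)
    (st : Global F k Sh Y) : Bool × Node F k Sh Y × Global F k Sh Y :=
  if fixed nd.P = old then (true, nd, st)
  else
    let nd₁ := (Sh.hypPos.filter (fun p => p ∈ fixed nd.P ∧ p ∉ old)).foldl (minimizeAt k) nd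
    let t := rankOf (fixed nd₁.P) nd₁.x
    let nd₂ := if rankOf old nd₁.x < t then echelonize t (refineByLabel t nd₁) else nd₁
    let nd₃ := (Sh.subPos.filter (fun p => p ∈ fixed nd₂.P)).foldl (minimizeAt t) nd₂
    let r := st.compare nd.trace.length (nd₃.trace.drop nd.trace.length)
    (r.1, nd₃, r.2)

/-- The Homomorphism Principle for the `S_P`-homomorphism `f`, followed by the inner minimization
if there are new singletons. -/
def refinement [LinearOrder F] [LinearOrder Y] (nd : Node F k Sh Y)
    (f : Refiner F k Sh Y nd.P nd.inn) (st : Global F k Sh Y) :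
    Bool × Node F k Sh Y × Global F k Sh Y :=
  let y := f.f nd.x
  let v : Value F Y := toLex (.inr (f.cf y))
  let nd' := ({ nd.permute (f.tr y : Sh.Sym) with P := f.part y } : Node F k Sh Y).record v
  let r := st.compare nd.trace.length [v]
  if r.1 then nd'.innerMinimization (fixed nd.P) r.2 else (false, nd', r.2)

open Classical in
/-- The refinement process. The flag is `false` if the subtree below the node is pruned, because of
a smaller candidate or because of the group of known automorphisms. The first argument bounds the
number of refinements. -/
def refinementLoop [LinearOrder F] (strat : Strategy F k Sh) :
    ℕ → Node F k Sh strat.Y → Global F k Sh strat.Y →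
      Bool × Node F k Sh strat.Y × Global F k Sh strat.Y
  | 0, nd, st => (true, nd, st)
  | r + 1, nd, st =>
    letI := strat.ord
    match strat.refinementFunc nd.P nd.inn nd.trace with
    | none => (true, nd, st)
    | some f =>
      if st.T ∩ {σ | ∃ ρ ∈ young nd.P, σ = ρ * nd.perm} = ∅ then (false, nd, st)
      else
        let res := nd.refinement f st
        if res.1 then refinementLoop strat r res.2.1 res.2.2 else res

/-- A leaf becomes the candidate, or yields an automorphism. -/
def leaf (strat : Strategy F k Sh) (nd : Node F k Sh strat.Y) (st : Global F k Sh strat.Y) :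
    Global F k Sh strat.Y :=
  match st.cand with
  | none => { st with cand := some nd }
  | some c =>
    let gens := nd.perm⁻¹ * c.perm :: st.gens
    { st with gens := gens, T := strat.shrink st.T (Subgroup.closure {σ | σ ∈ gens}) }

open Classical in
/-- The recursive backtrack procedure. The first argument bounds the depth of the recursion. -/
def backtrack [LinearOrder F] (strat : Strategy F k Sh) :
    ℕ → Node F k Sh strat.Y → Global F k Sh strat.Y → Global F k Sh strat.Y
  | 0, _, st => st
  | depth + 1, nd, st =>
    letI := strat.ord
    if nd.P = ⊥ then nd.leaf strat st
    else
      let cell := strat.targetCell nd.P nd.inn nd.trace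
      ((Sh.subPos ++ Sh.hypPos).filter (fun p => p ∈ cell)).foldl (init := st) fun st j =>
        let min := ((Sh.subPos ++ Sh.hypPos).find? (fun p => p ∈ cell)).getD j
        let child := { nd.permute (Sh.swap min j) with P := separate nd.P min }
        let res := child.innerMinimization (fixed nd.P) st
        if res.1 then
          let res' := refinementLoop strat strat.rounds res.2.1 res.2.2
          if res'.1 then backtrack strat depth res'.2.1 res'.2.2 else res'.2.2
        else res.2.2

/-- The root node. -/
def root (x : Obj F k Sh) : Node F k Sh Y where
  P := Sh.initialPartition
  perm := 1
  x := x
  inn := ⊤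
  acc := 1
  trace := []

end Node

/-- The final values of the global variables: the root node is refined, then the tree is traversed.
The depth of the recursion is at most the number of positions. -/
def run [LinearOrder F] (strat : Strategy F k Sh) (x : Obj F k Sh) : Global F k Sh strat.Y :=
  letI := strat.ord
  let res := (Node.root x).innerMinimization ∅ ({ cand := none, gens := [], T := Set.univ })
  let res' := Node.refinementLoop strat strat.rounds res.2.1 res.2.2
  Node.backtrack strat ((Sh.subPos ++ Sh.hypPos).length + 1) res'.2.1 res'.2.2

open Classical in
/-- The `ΓL_k(q)`-component of an element of the inner group which maps `x` to `y`. -/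
def transporter (x y : Obj F k Sh) : GammaL F k :=
  if h : ∃ g : Gsl F k Sh, g • x = y then toGammaL h.choose else 1

/-- Canonical form, transporter element and automorphism group obtained from the result of the
backtrack algorithm for the sequence `x` of generator matrices and normal vectors. -/
def output [LinearOrder F] (strat : Strategy F k Sh) (x : Obj F k Sh) :
    Config F k m × GammaL F k × Subgroup (GammaL F k) :=
  let st := run strat x
  let c := st.cand.getD (Node.root x)
  (decode c.x, c.acc, Subgroup.closure
    ({γ | ∃ g ∈ c.inn, γ = c.acc⁻¹ * toGammaL g * c.acc} ∪
      {γ | ∃ σ ∈ st.gens, γ = c.acc⁻¹ * transporter ((c.perm * σ) • x) c.x}))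

end Algorithm

end SubspaceCanon

end

open SubspaceCanon

set_option linter.unusedSectionVars false

noncomputable section

namespace SubspaceCanon

open Shape

variable {F : Type*} [Field F] {k m : ℕ} {Sh : Shape m}

/-! ### The actions on positions, objects and the inner group -/

/-! The search is compared with the tree in which nothing is pruned. Two facts about that tree carry
the theorem: it depends only on the orbit of the input, and a leaf is determined by the values
recorded on its path.

Orbit invariance. If `x' = g • α • x`, the nodes of the two trees correspond (`Equivalent`): they
share partition, inner stabilizer and trace, and their sequences differ by an inner element and a
permutation `σ` in the Young subgroup. Every operation preserves this. The minimum at a fixed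
position is taken over matching orbits, sorted labels agree, echelon forms are unique up to scalars,
a refiner has equal canonical forms on one orbit, and the child `j` matches the child `σ • j`. The
arguments need the inner stabilizer to be normalized by the Young subgroup. At a leaf `σ` is
trivial, so a leaf with permutation `π` corresponds to one with permutation `π α⁻¹` and the same
trace (`IsLeaf.exists_of_smul`).

Faithfulness. The trace contains the minimized entries themselves, so nodes with equal traces agree
at all fixed positions (`SameData`). The invariant `Inv` makes this suffice at a leaf. A fixed
normal vector that is independent of the earlier ones minimizes to the next unit vector; hence the
inner stabilizer acts on the first `t` rows through diagonal matrices, field automorphisms and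
column operations, and it contains every element that fixes the normalized data. At a leaf all
normal vectors are fixed and span the space, so `t = k`: equal traces give equal sequences
(`IsLeaf.x_eq`), and the inner stabilizer is the full stabilizer of the sequence
(`IsLeaf.mem_inn_iff`).

Pruning. Let `M` be the least trace of a leaf. No leaf with trace `M` is lost by comparison, and a
leaf whose permutation lies in the final transversal `T` is never cut off by the transversal test,
because `T` only shrinks. If `l` is any leaf with trace `M`, write `l.perm = τ a` with `τ ∈ T` and
`a` a known automorphism; by orbit invariance some leaf with trace `M` has permutation `τ`, and the
search has accounted for it. So the final candidate `c` has trace `M`, and `l.perm⁻¹ * c.perm` is a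
known automorphism for every such `l`. Applied to the leaves that correspond to `c` under
automorphisms of `x`, this shows that all of them have been found (`run_spec`).

Output. Two sequences that represent `C` and `γ • C` differ by an inner element over `γ` and a
permutation (`Realizes.exists_smul_eq`), so the statements about sequences become the three
canonization properties of configurations. -/

@[simp] theorem smul_pos_sub (σ : Sh.Sym) (c : Fin Sh.nC) (i : Fin (Sh.n c)) :
    σ • (Pos.sub c i : Pos Sh) = Pos.sub c (σ.1 c i) := rfl

@[simp] theorem smul_pos_hyp (σ : Sh.Sym) (d : Fin Sh.nH) (j : Fin (Sh.h d)) :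
    σ • (Pos.hyp d j : Pos Sh) = Pos.hyp d (σ.2 d j) := rfl

theorem perm_smul_U (σ : Sh.Sym) (x : Obj F k Sh) (c : Fin Sh.nC) (i : Fin (Sh.n c)) :
    (σ • x).U c i = x.U c ((σ.1 c)⁻¹ i) := rfl

theorem perm_smul_V (σ : Sh.Sym) (x : Obj F k Sh) (d : Fin Sh.nH) (j : Fin (Sh.h d)) :
    (σ • x).V d j = x.V d ((σ.2 d)⁻¹ j) := rfl

theorem inner_smul_U (g : Gsl F k Sh) (x : Obj F k Sh) (c : Fin Sh.nC) (i : Fin (Sh.n c)) :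
    (g • x).U c i = (g.left.1 : Matrix (Fin k) (Fin k) F) * (x.U c i).map g.right *
      ((g.left.2.1 c i : Matrix (Fin (Sh.s c)) (Fin (Sh.s c)) F))ᵀ := rfl

theorem inner_smul_V (g : Gsl F k Sh) (x : Obj F k Sh) (d : Fin Sh.nH) (j : Fin (Sh.h d)) :
    (g • x).V d j = (g.left.2.2 d j : F) •
      (((g.left.1⁻¹ : GL (Fin k) F) : Matrix (Fin k) (Fin k) F)ᵀ *ᵥ
        fun a => g.right (x.V d j a)) := rfl

/-- Permutation of the components of an element of the inner group. -/
def conj (σ : Sh.Sym) (g : Gsl F k Sh) : Gsl F k Sh :=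
  ⟨(g.left.1, fun c i => g.left.2.1 c ((σ.1 c)⁻¹ i), fun d j => g.left.2.2 d ((σ.2 d)⁻¹ j)),
    g.right⟩

@[simp] theorem toGammaL_conj (σ : Sh.Sym) (g : Gsl F k Sh) : toGammaL (conj σ g) = toGammaL g := rfl

theorem toGammaL_mul (g h : Gsl F k Sh) : toGammaL (g * h) = toGammaL g * toGammaL h := rfl

theorem toGammaL_one : toGammaL (1 : Gsl F k Sh) = 1 := rfl

theorem toGammaL_inv (g : Gsl F k Sh) : toGammaL g⁻¹ = (toGammaL g)⁻¹ := by
  rw [eq_inv_iff_mul_eq_one, ← toGammaL_mul, inv_mul_cancel, toGammaL_one]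

theorem one_conj (g : Gsl F k Sh) : conj 1 g = g := rfl

theorem conj_conj (σ τ : Sh.Sym) (g : Gsl F k Sh) : conj σ (conj τ g) = conj (σ * τ) g := by
  simp [conj, mul_inv_rev]

/-- Permuting positions only relabels the local factors of an inner element. So permutations
normalize the inner group, and any product of both kinds can be sorted. -/
theorem perm_inner (σ : Sh.Sym) (g : Gsl F k Sh) (x : Obj F k Sh) :
    σ • g • x = conj σ g • σ • x := rfl

theorem inner_perm (σ : Sh.Sym) (g : Gsl F k Sh) (x : Obj F k Sh) :
    g • σ • x = σ • conj σ⁻¹ g • x := by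
  rw [perm_inner, conj_conj, mul_inv_cancel, one_conj]

/-! ### Partitions and Young subgroups -/

theorem smul_fixed {P : Setoid (Pos Sh)} {σ : Sh.Sym} (hσ : σ ∈ young P) {p : Pos Sh}
    (hp : p ∈ fixed P) : σ • p = p := hp _ (P.symm (hσ p))

theorem young_mono {P Q : Setoid (Pos Sh)} (h : P ≤ Q) : young P ≤ young Q :=
  fun _ hσ p => h (hσ p)

theorem fixed_anti {P Q : Setoid (Pos Sh)} (h : P ≤ Q) : fixed Q ⊆ fixed P :=
  fun _ hp q hq => hp q (h hq)

theorem perm_smul_V_of_fixed {σ : Sh.Sym} {x : Obj F k Sh} {d : Fin Sh.nH} {j : Fin (Sh.h d)}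
    (h : σ • (Pos.hyp d j : Pos Sh) = Pos.hyp d j) : (σ • x).V d j = x.V d j := by
  have h' : σ.2 d j = j := by simpa using h
  rw [perm_smul_V, Equiv.Perm.inv_eq_iff_eq.2 h'.symm]

theorem entry_perm_smul (t : ℕ) (σ : Sh.Sym) (x : Obj F k Sh) (p : Pos Sh) :
    entry t (σ • x) p = entry t x (σ⁻¹ • p) := by
  cases p <;> rfl

theorem young_bot : young (⊥ : Setoid (Pos Sh)) = ⊥ := by
  rw [eq_bot_iff]
  intro σ hσ
  rw [Subgroup.mem_bot]
  ext c i
  · have := hσ (Pos.sub c i)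
    have : Pos.sub c (σ.1 c i) = (Pos.sub c i : Pos Sh) := this
    simpa using congrArg Fin.val (by simpa using this)
  · have := hσ (Pos.hyp c i)
    have : Pos.hyp c (σ.2 c i) = (Pos.hyp c i : Pos Sh) := this
    simpa using congrArg Fin.val (by simpa using this)

theorem fixed_bot : fixed (⊥ : Setoid (Pos Sh)) = Set.univ :=
  Set.eq_univ_of_forall fun _ _ h => h.symm

theorem separate_le (P : Setoid (Pos Sh)) (p : Pos Sh) : separate P p ≤ P := fun _ _ h => h.1

theorem splitBy_le {α : Type*} (P : Setoid (Pos Sh)) (l : Pos Sh → α) : splitBy P l ≤ P :=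
  fun _ _ h => h.1

open Classical in
theorem swap_smul {p q : Pos Sh} (h : Sh.initialPartition p q) (r : Pos Sh) :
    Sh.swap p q • r = if r = p then q else if r = q then p else r := by
  cases p with
  | sub c i =>
    cases q with
    | sub c' i' =>
      obtain rfl : c = c' := h
      cases r with
      | sub c₂ i₂ =>
        by_cases hc : c₂ = c
        · subst hc
          simp only [swap, dite_true, smul_pos_sub, Pi.mulSingle_eq_same, Pos.sub.injEq, heq_eq_eq,
            true_and, Equiv.swap_apply_def]
          split_ifs <;> rfl
        · simp [swap, hc]
      | hyp d j => simp [swap]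
    | hyp d j => exact h.elim
  | hyp c i =>
    cases q with
    | hyp c' i' =>
      obtain rfl : c = c' := h
      cases r with
      | hyp c₂ i₂ =>
        by_cases hc : c₂ = c
        · subst hc
          simp only [swap, dite_true, smul_pos_hyp, Pi.mulSingle_eq_same, Pos.hyp.injEq, heq_eq_eq,
            true_and, Equiv.swap_apply_def]
          split_ifs <;> rfl
        · simp [swap, hc]
      | sub d j => simp [swap]
    | sub d j => exact h.elim

theorem swap_mem_young {P : Setoid (Pos Sh)} (hP : P ≤ Sh.initialPartition) {p q : Pos Sh}
    (h : P p q) : Sh.swap p q ∈ young P := by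
  intro r
  rw [swap_smul (hP h)]
  split_ifs with h1 h2
  · subst h1; exact P.symm h
  · subst h2; exact h
  · exact P.refl _

theorem sym_ext {σ τ : Sh.Sym} (h : ∀ p : Pos Sh, σ • p = τ • p) : σ = τ := by
  have : τ⁻¹ * σ ∈ young (⊥ : Setoid (Pos Sh)) := fun p => by
    change (τ⁻¹ * σ) • p = p
    rw [mul_smul, h, inv_smul_smul]
  rw [young_bot, Subgroup.mem_bot, inv_mul_eq_one] at this
  exact this.symm

theorem swap_mul_self {p q : Pos Sh} (h : Sh.initialPartition p q) :
    Sh.swap p q * Sh.swap p q = 1 := by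
  classical
  refine sym_ext fun r => ?_
  rw [mul_smul, swap_smul h, swap_smul h, one_smul]
  split_ifs <;> simp_all

/-- Transpositions recover the partition: within an initial cell, `swap p q` lies in the Young
subgroup exactly if `p` and `q` share a cell. -/
theorem young_injective {P Q : Setoid (Pos Sh)} (hP : P ≤ Sh.initialPartition)
    (hQ : Q ≤ Sh.initialPartition) (h : young P = young Q) : P = Q := by
  have key : ∀ {P Q : Setoid (Pos Sh)}, P ≤ Sh.initialPartition → young P ≤ young Q → P ≤ Q := by
    intro P Q hP h p q hpq
    have := h (swap_mem_young hP hpq) p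
    rw [swap_smul (hP hpq), if_pos rfl] at this
    exact Q.symm this
  exact le_antisymm (key hP h.le) (key hQ h.ge)

theorem mem_young_separate {P : Setoid (Pos Sh)} {p : Pos Sh} {σ : Sh.Sym} (hσ : σ ∈ young P)
    (hp : σ • p = p) : σ ∈ young (separate P p) := by
  intro q
  refine ⟨hσ q, ?_⟩
  conv_lhs => rw [← hp]
  exact smul_left_cancel_iff σ

theorem mem_young_splitBy {α : Type*} {P : Setoid (Pos Sh)} {l : Pos Sh → α} {σ : Sh.Sym} :
    σ ∈ young (splitBy P l) ↔ σ ∈ young P ∧ ∀ p, l (σ • p) = l p :=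
  ⟨fun h => ⟨fun p => (h p).1, fun p => (h p).2⟩, fun h p => ⟨h.1 p, h.2 p⟩⟩

theorem mem_subPos {p : Pos Sh} : p ∈ Sh.subPos ↔ ∃ c i, p = Pos.sub c i := by
  simp [subPos, eq_comm]

theorem mem_hypPos {p : Pos Sh} : p ∈ Sh.hypPos ↔ ∃ d j, p = Pos.hyp d j := by
  simp [hypPos, eq_comm]

theorem mem_allPos (p : Pos Sh) : p ∈ Sh.subPos ++ Sh.hypPos := by
  rw [List.mem_append, mem_subPos, mem_hypPos]
  cases p
  · exact Or.inl ⟨_, _, rfl⟩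
  · exact Or.inr ⟨_, _, rfl⟩

instance : Finite (Pos Sh) :=
  Set.finite_univ_iff.1 ((List.finite_toSet (Sh.subPos ++ Sh.hypPos)).subset fun p _ => mem_allPos p)

theorem card_pos_le : Nat.card (Pos Sh) ≤ (Sh.subPos ++ Sh.hypPos).length := by
  classical
  have : Fintype (Pos Sh) := Fintype.ofFinite _
  rw [Nat.card_eq_fintype_card, ← Finset.card_univ]
  refine le_trans (Finset.card_le_card (t := (Sh.subPos ++ Sh.hypPos).toFinset) fun p _ => ?_)
    (List.toFinset_card_le _)
  exact List.mem_toFinset.2 (mem_allPos p)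

instance [Finite F] : Finite (Gsl F k Sh) := by
  have : Finite (RingAut F) := DFunLike.finite _
  exact Finite.of_injective (fun g : Gsl F k Sh => (g.left, g.right)) fun x y h => by
    exact SemidirectProduct.ext (congrArg Prod.fst h) (congrArg Prod.snd h)

/-! ### Reduced column echelon forms -/

/-- The first `r` columns are in reduced column echelon form up to scalars with pivot rows `piv`,
and the remaining columns vanish. -/
structure HasPivots {s : ℕ} (M : Matrix (Fin k) (Fin s) F) (r : ℕ) (piv : Fin s → Fin k) : Prop where
  lt : ∀ l l' : Fin s, l < l' → (l' : ℕ) < r → piv l < piv l'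
  ne : ∀ l : Fin s, (l : ℕ) < r → M (piv l) l ≠ 0
  above : ∀ l : Fin s, (l : ℕ) < r → ∀ a < piv l, M a l = 0
  row : ∀ l : Fin s, (l : ℕ) < r → ∀ l', l' ≠ l → M (piv l) l' = 0
  zero : ∀ l : Fin s, r ≤ (l : ℕ) → ∀ a, M a l = 0

section

variable {s : ℕ} {M M' : Matrix (Fin k) (Fin s) F} {r : ℕ} {piv piv' : Fin s → Fin k}

theorem HasPivots.isRCEF (h : HasPivots M r piv) : IsRCEF M :=
  ⟨r, piv, h.lt, fun l hl => ⟨h.ne l hl, h.above l hl, h.row l hl⟩, h.zero⟩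

/-- Restricted to the pivot rows, the first `r` columns form a diagonal matrix without zeros on the
diagonal, and the other columns vanish. -/
theorem HasPivots.rank (h : HasPivots M r piv) (hr : r ≤ s) : M.rank = r := by
  have hli : LinearIndependent F (fun l : Fin r => M.col (Fin.castLE hr l)) := by
    rw [Fintype.linearIndependent_iff]
    intro c hc l
    have h0 := congrFun hc (piv (Fin.castLE hr l))
    rw [Finset.sum_apply, Finset.sum_eq_single l] at h0
    · simpa [h.ne (Fin.castLE hr l) l.2] using h0
    · intro l' _ hl'
      have : M (piv (Fin.castLE hr l)) (Fin.castLE hr l') = 0 :=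
        h.row _ l.2 _ (fun e => hl' (Fin.castLE_injective hr e))
      simp [this]
    · simp
  have hsp : Submodule.span F (Set.range M.col) =
      Submodule.span F (Set.range fun l : Fin r => M.col (Fin.castLE hr l)) := by
    apply le_antisymm
    · rw [Submodule.span_le]
      rintro _ ⟨l, rfl⟩
      by_cases hl : (l : ℕ) < r
      · exact Submodule.subset_span ⟨⟨l, hl⟩, rfl⟩
      · have : M.col l = 0 := funext fun a => h.zero l (not_lt.1 hl) a
        rw [this]
        exact Submodule.zero_mem _
    · apply Submodule.span_mono
      rintro _ ⟨l, rfl⟩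
      exact ⟨_, rfl⟩
  rw [Matrix.rank_eq_finrank_span_cols, hsp, finrank_span_eq_card hli, Fintype.card_fin]

theorem IsRCEF.hasPivots (h : IsRCEF M) : ∃ piv, HasPivots M M.rank piv := by
  obtain ⟨r, piv, h1, h2, h3⟩ := h
  -- The number in `IsRCEF` may exceed the number of columns; capping it at `s` changes no condition
  -- and yields the rank.
  have hp : HasPivots M (min r s) piv :=
    { lt := fun l l' hl hr => h1 l l' hl (lt_of_lt_of_le hr (min_le_left _ _))
      ne := fun l hl => (h2 l (lt_of_lt_of_le hl (min_le_left _ _))).1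
      above := fun l hl => (h2 l (lt_of_lt_of_le hl (min_le_left _ _))).2.1
      row := fun l hl => (h2 l (lt_of_lt_of_le hl (min_le_left _ _))).2.2
      zero := fun l hl => h3 l ((min_le_iff.1 hl).resolve_right (not_le.2 l.2)) }
  exact ⟨piv, by rwa [hp.rank (min_le_right _ _)]⟩

theorem mul_transpose_apply (M : Matrix (Fin k) (Fin s) F) (B : Matrix (Fin s) (Fin s) F) (a l) :
    (M * Bᵀ) a l = ∑ j, M a j * B l j := by
  simp [Matrix.mul_apply]

theorem HasPivots.diag_ne_zero {B : GL (Fin s) F} (hB : B ∈ diagGL F s r) (l : Fin s)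
    (hl : (l : ℕ) < r) : (B : Matrix (Fin s) (Fin s) F) l l ≠ 0 := by
  intro h0
  have h : ((B⁻¹ : GL (Fin s) F) : Matrix (Fin s) (Fin s) F) *
      (B : Matrix (Fin s) (Fin s) F) = 1 := by
    rw [← Units.val_mul, inv_mul_cancel, Units.val_one]
  have h1 := congrFun (congrFun h l) l
  rw [Matrix.mul_apply, Finset.sum_eq_zero, Matrix.one_apply_eq] at h1
  · exact zero_ne_one h1
  · intro j _
    by_cases hj : j = l
    · rw [hj, h0, mul_zero]
    · rw [hB j l hl hj, mul_zero]

/-- The columns of `M` from index `r` on vanish and the first `r` columns of `B` are diagonal, so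
the multiplication only rescales the first `r` columns. -/
theorem HasPivots.mul_diag (h : HasPivots M r piv) {B : GL (Fin s) F} (hB : B ∈ diagGL F s r) :
    HasPivots (M * (B : Matrix (Fin s) (Fin s) F)ᵀ) r piv := by
  have e1 : ∀ (a : Fin k) (l : Fin s), (l : ℕ) < r → (M * (B : Matrix (Fin s) (Fin s) F)ᵀ) a l =
      M a l * (B : Matrix (Fin s) (Fin s) F) l l := by
    intro a l hl
    rw [mul_transpose_apply]
    refine Finset.sum_eq_single l (fun j _ hj => ?_) (by simp)
    by_cases hjr : (j : ℕ) < r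
    · rw [hB l j hjr (Ne.symm hj), mul_zero]
    · rw [h.zero j (not_lt.1 hjr), zero_mul]
  have e2 : ∀ (a : Fin k) (l : Fin s), r ≤ (l : ℕ) → (M * (B : Matrix (Fin s) (Fin s) F)ᵀ) a l = 0 := by
    intro a l hl
    rw [mul_transpose_apply]
    refine Finset.sum_eq_zero fun j _ => ?_
    by_cases hjr : (j : ℕ) < r
    · rw [hB l j hjr (by rintro rfl; omega), mul_zero]
    · rw [h.zero j (not_lt.1 hjr), zero_mul]
  refine ⟨h.lt, fun l hl => ?_, fun l hl a ha => ?_, fun l hl l' hl' => ?_, fun l hl a => e2 a l hl⟩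
  · rw [e1 _ _ hl]
    exact mul_ne_zero (h.ne l hl) (HasPivots.diag_ne_zero hB l hl)
  · rw [e1 _ _ hl, h.above l hl a ha, zero_mul]
  · by_cases h' : (l' : ℕ) < r
    · rw [e1 _ _ h', h.row l hl l' hl', zero_mul]
    · exact e2 _ _ (not_lt.1 h')

theorem HasPivots.diag_mul_map (h : HasPivots M r piv) (D : Fin k → Fˣ) (τ : RingAut F) :
    HasPivots (Matrix.diagonal (fun a => (D a : F)) * M.map τ) r piv := by
  have e : ∀ a l, (Matrix.diagonal (fun a => (D a : F)) * M.map τ) a l = D a * τ (M a l) := by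
    intro a l; simp [Matrix.diagonal_mul]
  have z : ∀ a l, M a l = 0 → (Matrix.diagonal (fun a => (D a : F)) * M.map τ) a l = 0 := by
    intro a l h; rw [e, h, map_zero, mul_zero]
  refine ⟨h.lt, fun l hl => ?_, fun l hl a ha => z _ _ (h.above l hl a ha),
    fun l hl l' hl' => z _ _ (h.row l hl l' hl'), fun l hl a => z _ _ (h.zero l hl a)⟩
  rw [e]
  exact mul_ne_zero (Units.ne_zero _) ((map_ne_zero_iff τ τ.injective).2 (h.ne l hl))

/-- Uniqueness of the reduced echelon form up to column scalars. A pivot row of `M` isolates one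
column, so the entries of `M'` in that row are multiples of a column of `B`. Both matrices have the
same pivot rows, and then the zeros in the pivot rows of `M'` force the zeros of `B`. -/
theorem HasPivots.mem_diagGL (h : HasPivots M r piv) (h' : HasPivots M' r piv') (hr : r ≤ s)
    {B : GL (Fin s) F} (hM : M' = M * (B : Matrix (Fin s) (Fin s) F)ᵀ) : B ∈ diagGL F s r := by
  have e : ∀ a l, M' a l = ∑ j, M a j * (B : Matrix (Fin s) (Fin s) F) l j := by
    intro a l; rw [hM, mul_transpose_apply]
  have hpiv : ∀ (l j : Fin s), (j : ℕ) < r →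
      M' (piv j) l = M (piv j) j * (B : Matrix (Fin s) (Fin s) F) l j := by
    intro l j hj
    rw [e]
    refine Finset.sum_eq_single j (fun i _ hi => ?_) (by simp)
    rw [h.row j hj i hi, zero_mul]
  have hlead : ∀ l : Fin r, ∃ j : Fin r, piv' (Fin.castLE hr l) = piv (Fin.castLE hr j) := by
    intro l
    set l' : Fin s := Fin.castLE hr l
    have hne : ∃ j : Fin r, (B : Matrix (Fin s) (Fin s) F) l' (Fin.castLE hr j) ≠ 0 := by
      by_contra! hB
      apply h'.ne l' l.2
      rw [e]
      refine Finset.sum_eq_zero fun j _ => ?_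
      by_cases hj : (j : ℕ) < r
      · have := hB ⟨j, hj⟩
        change (B : Matrix (Fin s) (Fin s) F) l' j = 0 at this
        rw [this, mul_zero]
      · rw [h.zero j (not_lt.1 hj), zero_mul]
    classical
    -- For the least `j` in the support of row `l'` of `B`, the pivot row of `j` is the first row in
    -- which column `l'` of `M'` does not vanish.
    obtain ⟨j, hj, hmin⟩ := (Finset.univ.filter fun j : Fin r =>
      (B : Matrix (Fin s) (Fin s) F) l' (Fin.castLE hr j) ≠ 0).exists_minimal
      (hne.imp fun j hj => by simpa using hj)
    refine ⟨j, ?_⟩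
    simp only [Finset.mem_filter, Finset.mem_univ, true_and] at hj hmin
    have h1 : M' (piv (Fin.castLE hr j)) l' ≠ 0 := by
      rw [hpiv _ _ j.2]
      exact mul_ne_zero (h.ne _ j.2) hj
    have h2 : ∀ a < piv (Fin.castLE hr j), M' a l' = 0 := by
      intro a ha
      rw [e]
      refine Finset.sum_eq_zero fun i _ => ?_
      by_cases hi : (i : ℕ) < r
      · by_cases hB : (B : Matrix (Fin s) (Fin s) F) l' i = 0
        · rw [hB, mul_zero]
        · have hij : j ≤ ⟨i, hi⟩ := by
            rcases le_total j ⟨i, hi⟩ with h | h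
            · exact h
            · exact hmin (y := ⟨i, hi⟩) hB h
          have : piv (Fin.castLE hr j) ≤ piv i := by
            rcases hij.lt_or_eq with hlt | heq
            · exact (h.lt (Fin.castLE hr j) i hlt hi).le
            · rw [heq]; exact le_rfl
          rw [h.above i hi a (ha.trans_le this), zero_mul]
      · rw [h.zero i (not_lt.1 hi), zero_mul]
    rcases lt_trichotomy (piv' l') (piv (Fin.castLE hr j)) with hlt | heq | hgt
    · exact absurd (h2 _ hlt) (h'.ne l' l.2)
    · exact heq
    · exact absurd (h'.above l' l.2 _ hgt) h1
  choose f hf using hlead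
  have mono : StrictMono fun l : Fin r => piv (Fin.castLE hr l) := fun a b hab => h.lt _ _ hab b.2
  have mono' : StrictMono fun l : Fin r => piv' (Fin.castLE hr l) := fun a b hab => h'.lt _ _ hab b.2
  have hfm : StrictMono f := by
    intro a b hab
    have := mono' hab
    simp only [hf] at this
    exact mono.lt_iff_lt.1 this
  -- A strictly increasing self-map of a finite chain is the identity, so the two pivot sequences
  -- coincide.
  have hfid : f = id := by
    refine (hfm.range_inj strictMono_id).1 ?_
    rw [(Finite.injective_iff_surjective.1 hfm.injective).range_eq, Set.range_id]
  intro i j hj hij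
  have hB := hpiv i j hj
  have : M' (piv j) i = 0 := by
    have e1 := hf ⟨j, hj⟩
    rw [hfid] at e1
    change piv' j = piv j at e1
    rw [← e1]
    exact h'.row j hj i hij
  rw [this] at hB
  exact (mul_eq_zero.1 hB.symm).resolve_left (h.ne j hj)

theorem rank_mul_GL (M : Matrix (Fin k) (Fin s) F) (B : GL (Fin s) F) :
    (M * (B : Matrix (Fin s) (Fin s) F)ᵀ).rank = M.rank := by
  refine Matrix.rank_mul_eq_left_of_isUnit_det _ _ ?_
  rw [Matrix.det_transpose]
  exact (Matrix.isUnit_iff_isUnit_det _).1 B.isUnit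

theorem IsRCEF.rank_diag_mul_map (h : IsRCEF M) (D : Fin k → Fˣ) (τ : RingAut F) :
    (Matrix.diagonal (fun a => (D a : F)) * M.map τ).rank = M.rank := by
  obtain ⟨piv, hp⟩ := h.hasPivots
  exact (hp.diag_mul_map D τ).rank (by simpa using M.rank_le_card_width)

theorem IsRCEF.mem_diagGL (h : IsRCEF M) (h' : IsRCEF M') (D : Fin k → Fˣ) (τ : RingAut F)
    {B : GL (Fin s) F} (hM : M' = Matrix.diagonal (fun a => (D a : F)) * M.map τ *
      (B : Matrix (Fin s) (Fin s) F)ᵀ) : B ∈ diagGL F s M.rank := by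
  obtain ⟨piv, hp⟩ := h.hasPivots
  obtain ⟨piv', hp'⟩ := h'.hasPivots
  have hr : M'.rank = M.rank := by rw [hM, rank_mul_GL, h.rank_diag_mul_map]
  rw [hr] at hp'
  exact (hp.diag_mul_map D τ).mem_diagGL hp' (by simpa using M.rank_le_card_width) hM

theorem IsRCEF.smul (h : IsRCEF M) (D : Fin k → Fˣ) (τ : RingAut F)
    {B : GL (Fin s) F} (hB : B ∈ diagGL F s M.rank) :
    IsRCEF (Matrix.diagonal (fun a => (D a : F)) * M.map τ * (B : Matrix (Fin s) (Fin s) F)ᵀ) := by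
  obtain ⟨piv, hp⟩ := h.hasPivots
  exact ((hp.diag_mul_map D τ).mul_diag hB).isRCEF

/-! ### Truncation to the first rows and column reduction row by row -/

theorem topRows_apply (t : ℕ) (U : Matrix (Fin k) (Fin s) F) (a l) :
    topRows t U a l = if (a : ℕ) < t then U a l else 0 := rfl

theorem topRows_mul (t : ℕ) (U : Matrix (Fin k) (Fin s) F) (B : Matrix (Fin s) (Fin s) F) :
    topRows t (U * B) = topRows t U * B := by
  ext a l
  rw [topRows_apply, Matrix.mul_apply, Matrix.mul_apply]
  simp only [topRows_apply]
  split_ifs <;> simp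

theorem topRows_eq_self (U : Matrix (Fin k) (Fin s) F) : topRows k U = U := by
  ext a l
  rw [topRows_apply, if_pos a.2]

theorem topRows_eq_iff {t : ℕ} {U U' : Matrix (Fin k) (Fin s) F} :
    topRows t U = topRows t U' ↔ ∀ a : Fin k, (a : ℕ) < t → ∀ l, U a l = U' a l := by
  constructor
  · intro h a ha l
    have := congrFun (congrFun h a) l
    rwa [topRows_apply, topRows_apply, if_pos ha, if_pos ha] at this
  · intro h
    ext a l
    rw [topRows_apply, topRows_apply]
    split_ifs with ha
    · exact h a ha l
    · rfl

theorem topRows_eq_of_le {t u : ℕ} (hu : u ≤ t) {U U' : Matrix (Fin k) (Fin s) F}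
    (h : topRows t U = topRows t U') : topRows u U = topRows u U' :=
  topRows_eq_iff.2 fun a ha l => topRows_eq_iff.1 h a (ha.trans_le hu) l

theorem isRCEF_topRows_zero (U : Matrix (Fin k) (Fin s) F) (h : LinearIndependent F U.col) :
    IsRCEF (topRows 0 U) := by
  have hs : s ≤ k := by simpa using h.fintype_card_le_finrank
  exact ⟨0, Fin.castLE hs, fun _ _ _ h => absurd h (Nat.not_lt_zero _),
    fun _ h => absurd h (Nat.not_lt_zero _), fun l _ a => by
      rw [topRows_apply, if_neg (Nat.not_lt_zero _)]⟩

theorem exists_GL_swap_cols (U : Matrix (Fin k) (Fin s) F) (i j : Fin s) :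
    ∃ B : GL (Fin s) F, ∀ a l, (U * (B : Matrix (Fin s) (Fin s) F)ᵀ) a l =
      U a (Equiv.swap i j l) := by
  have h : (Equiv.swap i j).permMatrix F * (Equiv.swap i j).permMatrix F = 1 := by
    rw [← Matrix.permMatrix_mul, Equiv.swap_mul_self, Matrix.permMatrix_one]
  refine ⟨⟨_, _, h, h⟩, fun a l => ?_⟩
  rw [mul_transpose_apply]
  simp [Equiv.Perm.permMatrix, PEquiv.toMatrix_apply]

/-- Because `c i = 0`, the rank one matrix `c eᵢᵀ` squares to zero, and `1 - c eᵢᵀ` is inverted by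
`1 + c eᵢᵀ`. -/
theorem exists_GL_sub_cols (U : Matrix (Fin k) (Fin s) F) (i : Fin s) (c : Fin s → F)
    (hc : c i = 0) :
    ∃ B : GL (Fin s) F, ∀ a l, (U * (B : Matrix (Fin s) (Fin s) F)ᵀ) a l =
      U a l - U a i * c l := by
  have h : Matrix.vecMulVec c (Pi.single i 1) * Matrix.vecMulVec c (Pi.single i (1 : F)) = 0 := by
    rw [Matrix.vecMulVec_mul_vecMulVec]
    simp [hc]
  refine ⟨⟨1 - Matrix.vecMulVec c (Pi.single i 1), 1 + Matrix.vecMulVec c (Pi.single i 1), ?_, ?_⟩,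
    fun a l => ?_⟩
  · rw [sub_mul, mul_add, mul_add, h]; simp
  · rw [add_mul, mul_sub, mul_sub, h]; simp
  · rw [mul_transpose_apply]
    simp only [Matrix.sub_apply, mul_sub, Finset.sum_sub_distrib, Matrix.vecMulVec_apply]
    congr 1
    · simp [Matrix.one_apply]
    · rw [Finset.sum_eq_single i]
      · simp
      · intro b _ hb; simp [hb]
      · simp

/-- The columns without pivot vanish in the first `t` rows. Exchanging them among each other, or
subtracting multiples of one of them from other columns, therefore leaves those rows alone while row
`t` is cleared. -/
theorem exists_GL_topRows_succ {t : ℕ} (U : Matrix (Fin k) (Fin s) F) (h : IsRCEF (topRows t U)) :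
    ∃ B : GL (Fin s) F, topRows t (U * (B : Matrix (Fin s) (Fin s) F)ᵀ) = topRows t U ∧
      IsRCEF (topRows (t + 1) (U * (B : Matrix (Fin s) (Fin s) F)ᵀ)) := by
  by_cases htk : t < k
  swap
  · refine ⟨1, by simp, ?_⟩
    have : topRows (t + 1) U = topRows t U := by
      ext a l
      rw [topRows_apply, topRows_apply, if_pos (by omega), if_pos (by omega)]
    simpa [this] using h
  obtain ⟨piv, hp⟩ := h.hasPivots
  set r := (topRows t U).rank
  have hpt : ∀ l : Fin s, (l : ℕ) < r → (piv l : ℕ) < t := by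
    intro l hl
    by_contra hh
    exact hp.ne l hl (if_neg hh)
  have hzero : ∀ l : Fin s, r ≤ (l : ℕ) → ∀ a : Fin k, (a : ℕ) < t → U a l = 0 := by
    intro l hl a ha
    have := hp.zero l hl a
    rwa [topRows_apply, if_pos ha] at this
  -- If no column without pivot meets row `t`, the old pivots serve for one more row.
  by_cases hz : ∀ l : Fin s, r ≤ (l : ℕ) → U ⟨t, htk⟩ l = 0
  · refine ⟨1, by simp, ?_⟩
    rw [Units.val_one, Matrix.transpose_one, Matrix.mul_one]
    have e : ∀ a : Fin k, (a : ℕ) < t → ∀ l, topRows (t + 1) U a l = topRows t U a l := by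
      intro a ha l
      rw [topRows_apply, topRows_apply, if_pos ha, if_pos (by omega)]
    refine HasPivots.isRCEF (r := r) (piv := piv) ⟨hp.lt, fun l hl => ?_, fun l hl a ha => ?_,
      fun l hl l' hl' => ?_, fun l hl a => ?_⟩
    · rw [e _ (hpt l hl)]; exact hp.ne l hl
    · rw [e _ (lt_trans (Fin.lt_def.1 ha) (hpt l hl))]; exact hp.above l hl a ha
    · rw [e _ (hpt l hl)]; exact hp.row l hl l' hl'
    · rcases lt_trichotomy (a : ℕ) t with h1 | h1 | h1
      · rw [e _ h1]; exact hp.zero l hl a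
      · obtain rfl : a = ⟨t, htk⟩ := Fin.ext h1
        rw [topRows_apply, if_pos (Nat.lt_succ_self t)]
        exact hz l hl
      · exact if_neg (by omega)
  push Not at hz
  obtain ⟨l₀, hl₀, hne⟩ := hz
  have hrs : r < s := hl₀.trans_lt l₀.2
  set i : Fin s := ⟨r, hrs⟩
  -- The new pivot column is moved to index `r`, directly after the old pivot columns.
  obtain ⟨B₁, hB₁⟩ := exists_GL_swap_cols U i l₀
  set N := U * (B₁ : Matrix (Fin s) (Fin s) F)ᵀ
  have hNi : N ⟨t, htk⟩ i ≠ 0 := by rwa [hB₁, Equiv.swap_apply_left]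
  have hNU : topRows t N = topRows t U := by
    rw [topRows_eq_iff]
    intro a ha l
    rw [hB₁]
    by_cases h1 : l = i
    · rw [h1, Equiv.swap_apply_left, hzero _ hl₀ a ha, hzero _ le_rfl a ha]
    by_cases h2 : l = l₀
    · rw [h2, Equiv.swap_apply_right, hzero _ hl₀ a ha, hzero _ le_rfl a ha]
    rw [Equiv.swap_apply_of_ne_of_ne h1 h2]
  obtain ⟨B₂, hB₂⟩ := exists_GL_sub_cols N i
    (fun l => if l = i then 0 else N ⟨t, htk⟩ l / N ⟨t, htk⟩ i) (if_pos rfl)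
  set N₂ := N * (B₂ : Matrix (Fin s) (Fin s) F)ᵀ
  have hN₂U : topRows t N₂ = topRows t U := by
    rw [← hNU, topRows_eq_iff]
    intro a ha l
    rw [hB₂, topRows_eq_iff.1 hNU a ha i, hzero i le_rfl a ha, zero_mul, sub_zero]
  have hrow : ∀ l, l ≠ i → N₂ ⟨t, htk⟩ l = 0 := by
    intro l hl
    rw [hB₂, if_neg hl, mul_div_cancel₀ _ hNi, sub_self]
  have hrowi : N₂ ⟨t, htk⟩ i ≠ 0 := by
    rwa [hB₂, if_pos rfl, mul_zero, sub_zero]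
  have e : ∀ a : Fin k, (a : ℕ) < t → ∀ l, topRows (t + 1) N₂ a l = topRows t U a l := by
    intro a ha l
    rw [← hN₂U, topRows_apply, topRows_apply, if_pos ha, if_pos (by omega)]
  have et : ∀ l, topRows (t + 1) N₂ ⟨t, htk⟩ l = N₂ ⟨t, htk⟩ l := fun l => if_pos (Nat.lt_succ_self t)
  have hU : U * ((B₂ * B₁ : GL (Fin s) F) : Matrix (Fin s) (Fin s) F)ᵀ = N₂ := by
    rw [Units.val_mul, Matrix.transpose_mul, ← Matrix.mul_assoc]
  refine ⟨B₂ * B₁, by rw [hU, hN₂U], ?_⟩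
  rw [hU]
  have hcase : ∀ l : Fin s, (l : ℕ) < r + 1 → l ≠ i → (l : ℕ) < r := by
    intro l hl hli
    have : (l : ℕ) ≠ r := fun e => hli (Fin.ext e)
    omega
  refine HasPivots.isRCEF (r := r + 1) (piv := Function.update piv i ⟨t, htk⟩)
    ⟨fun l l' hl hr => ?_, fun l hl => ?_, fun l hl a ha => ?_, fun l hl l' hl' => ?_,
      fun l hl a => ?_⟩
  · have hl' : (l : ℕ) < (l' : ℕ) := hl
    have hli : l ≠ i := by
      rintro rfl
      have : (i : ℕ) = r := rfl
      omega
    rw [Function.update_of_ne hli]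
    by_cases h' : l' = i
    · rw [h', Function.update_self]
      exact hpt l (by omega)
    · rw [Function.update_of_ne h']
      exact hp.lt l l' hl (hcase l' hr h')
  · by_cases h' : l = i
    · rw [h', Function.update_self, et]; exact hrowi
    · rw [Function.update_of_ne h', e _ (hpt l (hcase l hl h'))]; exact hp.ne l (hcase l hl h')
  · by_cases h' : l = i
    · rw [h', Function.update_self] at ha
      rw [h', e a ha]
      exact hp.zero i le_rfl a
    · rw [Function.update_of_ne h'] at ha
      have hl' := hcase l hl h'
      rw [e a (lt_trans (Fin.lt_def.1 ha) (hpt l hl'))]; exact hp.above l hl' a ha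
  · by_cases h' : l = i
    · rw [h', Function.update_self, et]; exact hrow l' (h' ▸ hl')
    · have hl₁ := hcase l hl h'
      rw [Function.update_of_ne h', e _ (hpt l hl₁)]; exact hp.row l hl₁ l' hl'
  · rcases lt_trichotomy (a : ℕ) t with h1 | h1 | h1
    · rw [e _ h1]; exact hp.zero l (by omega) a
    · obtain rfl : a = ⟨t, htk⟩ := Fin.ext h1
      rw [et]
      refine hrow l ?_
      rintro rfl
      have : (i : ℕ) = r := rfl
      omega
    · exact if_neg (by omega)

/-- That the first `u` rows stay unchanged is essential: it places the column operation inside the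
inner stabilizer, see `Inv.echelonizer_spec`. -/
theorem exists_GL_topRows {t u : ℕ} (hu : u ≤ t) (U : Matrix (Fin k) (Fin s) F)
    (h : IsRCEF (topRows u U)) :
    ∃ B : GL (Fin s) F, topRows u (U * (B : Matrix (Fin s) (Fin s) F)ᵀ) = topRows u U ∧
      IsRCEF (topRows t (U * (B : Matrix (Fin s) (Fin s) F)ᵀ)) := by
  induction t, hu using Nat.le_induction with
  | base => exact ⟨1, by simpa using h⟩
  | succ t hu ih =>
    obtain ⟨B, h1, h2⟩ := ih
    obtain ⟨B', h3, h4⟩ := exists_GL_topRows_succ _ h2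
    refine ⟨B' * B, ?_, ?_⟩
    · rw [Units.val_mul, Matrix.transpose_mul, ← Matrix.mul_assoc, ← h1]
      exact topRows_eq_of_le hu h3
    · rwa [Units.val_mul, Matrix.transpose_mul, ← Matrix.mul_assoc]

end

/-! ### Elements of the inner group with diagonal first rows -/

/-- The first `t` rows of the `GL_k`-component agree with those of a diagonal matrix. -/
def LowerTo (t : ℕ) (g : Gsl F k Sh) : Prop :=
  ∀ a b : Fin k, (a : ℕ) < t → a ≠ b → (g.left.1 : Matrix (Fin k) (Fin k) F) a b = 0

theorem LowerTo.mono {t u : ℕ} {g : Gsl F k Sh} (h : LowerTo t g) (hu : u ≤ t) : LowerTo u g :=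
  fun a b ha hab => h a b (ha.trans_le hu) hab

theorem LowerTo.mul_inv_apply {t : ℕ} {g : Gsl F k Sh} (h : LowerTo t g) (a b : Fin k)
    (ha : (a : ℕ) < t) : (g.left.1 : Matrix (Fin k) (Fin k) F) a a *
      ((g.left.1⁻¹ : GL (Fin k) F) : Matrix (Fin k) (Fin k) F) a b =
        (1 : Matrix (Fin k) (Fin k) F) a b := by
  have e : (g.left.1 : Matrix (Fin k) (Fin k) F) *
      ((g.left.1⁻¹ : GL (Fin k) F) : Matrix (Fin k) (Fin k) F) = 1 := by
    rw [← Units.val_mul, mul_inv_cancel, Units.val_one]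
  rw [← e, Matrix.mul_apply, Finset.sum_eq_single a]
  · intro c _ hc
    rw [h a c ha (Ne.symm hc), zero_mul]
  · simp

theorem LowerTo.diag_ne_zero {t : ℕ} {g : Gsl F k Sh} (h : LowerTo t g) (a : Fin k)
    (ha : (a : ℕ) < t) : (g.left.1 : Matrix (Fin k) (Fin k) F) a a ≠ 0 := by
  intro h0
  have := h.mul_inv_apply a a ha
  rw [h0, zero_mul, Matrix.one_apply_eq] at this
  exact zero_ne_one this

/-- In the first `t` rows only the diagonal of the `GL_k`-component acts, so lower rows never mix
into them. This makes truncated matrices well-defined objects for the inner stabilizer. -/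
theorem LowerTo.exists_diagonal {t : ℕ} {g : Gsl F k Sh} (h : LowerTo t g) :
    ∃ D : Fin k → Fˣ, ∀ (x : Obj F k Sh) c i, topRows t ((g • x).U c i) =
      Matrix.diagonal (fun a => (D a : F)) * (topRows t (x.U c i)).map g.right *
        ((g.left.2.1 c i : Matrix (Fin (Sh.s c)) (Fin (Sh.s c)) F))ᵀ := by
  classical
  -- From row `t` on the diagonal entry may vanish; the default `1` is harmless because those rows
  -- are truncated to zero.
  refine ⟨fun a => if h : (g.left.1 : Matrix (Fin k) (Fin k) F) a a ≠ 0 then Units.mk0 _ h else 1,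
    fun x c i => ?_⟩
  rw [inner_smul_U, topRows_mul]
  congr 1
  ext a l
  rw [Matrix.diagonal_mul, Matrix.map_apply, topRows_apply, topRows_apply]
  split_ifs with ha
  · dsimp only
    rw [dif_pos (h.diag_ne_zero a ha), Units.val_mk0, Matrix.mul_apply, Finset.sum_eq_single a]
    · rfl
    · intro b _ hb
      rw [h a b ha (Ne.symm hb), zero_mul]
    · simp
  · simp

theorem LowerTo.topRows_congr {t : ℕ} {g : Gsl F k Sh} (h : LowerTo t g) {x y : Obj F k Sh}
    {c : Fin Sh.nC} {i : Fin (Sh.n c)} (e : topRows t (x.U c i) = topRows t (y.U c i)) :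
    topRows t ((g • x).U c i) = topRows t ((g • y).U c i) := by
  obtain ⟨D, hD⟩ := h.exists_diagonal
  rw [hD, hD, e]

theorem inner_smul_V_congr (g : Gsl F k Sh) {x y : Obj F k Sh} {d : Fin Sh.nH} {j : Fin (Sh.h d)}
    (e : x.V d j = y.V d j) : (g • x).V d j = (g • y).V d j := by
  rw [inner_smul_V, inner_smul_V, e]

/-- Fixing the unit vector `e_a` under the contragredient action means `Aᵀ e_a = b e_a`, so row `a`
of `A` is a multiple of `e_a`. -/
theorem lowerTo_of_fix {t : ℕ} {g : Gsl F k Sh} {x : Obj F k Sh}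
    (h : ∀ a : Fin k, (a : ℕ) < t → ∃ d j, x.V d j = Pi.single a 1 ∧ (g • x).V d j = x.V d j) :
    LowerTo t g := by
  intro a b ha hab
  obtain ⟨d, j, hx, hg⟩ := h a ha
  have e : (g.left.1 : Matrix (Fin k) (Fin k) F)ᵀ *ᵥ (g • x).V d j =
      (g.left.2.2 d j : F) • fun a => g.right (x.V d j a) := by
    rw [inner_smul_V, Matrix.mulVec_smul, Matrix.mulVec_mulVec, ← Matrix.transpose_mul,
      ← Units.val_mul, inv_mul_cancel, Units.val_one, Matrix.transpose_one, Matrix.one_mulVec]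
  rw [hg, hx] at e
  have := congrFun e b
  rw [Matrix.mulVec_single_one] at this
  simpa [Ne.symm hab] using this

/-- A normal vector outside the span of the first `t` unit vectors can be moved to the next unit
vector without disturbing what is already normalized. The matrix needed has the first `t` rows of
the identity and row `t` equal to `v`, since then its transpose maps `e_t` to `v`. -/
theorem exists_inner_map_single (t : ℕ) (ht : t < k) (v : Fin k → F)
    (hv : ∃ a : Fin k, t ≤ (a : ℕ) ∧ v a ≠ 0) :
    ∃ g : Gsl F k Sh, (∀ (x : Obj F k Sh) c i, topRows t ((g • x).U c i) = topRows t (x.U c i)) ∧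
      (∀ (x : Obj F k Sh) d j, (∀ a : Fin k, t ≤ (a : ℕ) → x.V d j a = 0) → (g • x).V d j = x.V d j) ∧
      ∀ (x : Obj F k Sh) d j, x.V d j = v → (g • x).V d j = Pi.single ⟨t, ht⟩ 1 := by
  obtain ⟨b, hb, hvb⟩ := hv
  set t' : Fin k := ⟨t, ht⟩
  set e := Equiv.swap t' b
  -- The entry `v t` may be zero. Replacing row `t` of the identity by `v` with coordinates `t` and
  -- `b` exchanged gives determinant `v b`; permuting the columns back restores `v` as row `t`.
  let E : Matrix (Fin k) (Fin k) F := ((1 : Matrix (Fin k) (Fin k) F).updateCol t' (v ∘ e))ᵀ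
  have hE : E.det ≠ 0 := by
    rw [Matrix.det_transpose, ← Matrix.cramer_apply, Matrix.cramer_one]
    simpa [e] using hvb
  let M : Matrix (Fin k) (Fin k) F := E.submatrix id e
  have hM : M.det ≠ 0 := by
    rw [Matrix.det_permute']
    refine mul_ne_zero ?_ hE
    rcases Int.units_eq_one_or (Equiv.Perm.sign e) with h | h <;> simp [h]
  have hMt : ∀ c, M t' c = v c := by
    intro c
    simp [M, E, e]
  have hMa : ∀ a : Fin k, (a : ℕ) < t → ∀ c, M a c = (1 : Matrix (Fin k) (Fin k) F) a c := by
    intro a ha c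
    have h1 : a ≠ t' := by rintro rfl; exact lt_irrefl _ ha
    have h2 : a ≠ b := by rintro rfl; omega
    simp only [M, E, Matrix.submatrix_apply, id, Matrix.transpose_apply,
      Matrix.updateCol_ne h1]
    have ea : e a = a := Equiv.swap_apply_of_ne_of_ne h1 h2
    have : e c = a ↔ c = a :=
      ⟨fun h => e.injective (h.trans ea.symm), fun h => by rw [h, ea]⟩
    simp only [Matrix.one_apply, this, eq_comm (a := a)]
  let A : GL (Fin k) F := Matrix.GeneralLinearGroup.mkOfDetNeZero M hM
  have hinv : ∀ u : Fin k → F, ((A⁻¹ : GL (Fin k) F) : Matrix (Fin k) (Fin k) F)ᵀ *ᵥ (Mᵀ *ᵥ u) = u := by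
    intro u
    have : (A : Matrix (Fin k) (Fin k) F) = M := rfl
    rw [Matrix.mulVec_mulVec, ← Matrix.transpose_mul, ← this, ← Units.val_mul, mul_inv_cancel,
      Units.val_one, Matrix.transpose_one, Matrix.one_mulVec]
  let g : Gsl F k Sh := ⟨(A, 1, 1), 1⟩
  have hgV : ∀ (x : Obj F k Sh) d j, (g • x).V d j =
      ((A⁻¹ : GL (Fin k) F) : Matrix (Fin k) (Fin k) F)ᵀ *ᵥ x.V d j := by
    intro x d j
    rw [inner_smul_V]
    exact one_smul _ _
  refine ⟨g, fun x c i => ?_, fun x d j hx => ?_, fun x d j hx => ?_⟩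
  · rw [topRows_eq_iff]
    intro a ha l
    have : (g • x).U c i = M * x.U c i := by
      rw [inner_smul_U]
      change M * (x.U c i).map (fun y => y) * (1 : Matrix _ _ F)ᵀ = _
      simp
    rw [this, Matrix.mul_apply]
    simp [hMa a ha, Matrix.one_apply]
  · rw [hgV]
    refine (congrArg _ ?_).trans (hinv _)
    ext c
    rw [Matrix.mulVec, dotProduct]
    have : ∀ a, Mᵀ c a * x.V d j a = (1 : Matrix (Fin k) (Fin k) F) a c * x.V d j a := by
      intro a
      by_cases ha : (a : ℕ) < t
      · rw [Matrix.transpose_apply, hMa a ha]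
      · rw [hx a (not_lt.1 ha), mul_zero, mul_zero]
    rw [Finset.sum_congr rfl fun a _ => this a]
    simp [Matrix.one_apply]
  · rw [hgV, hx]
    refine (congrArg _ ?_).trans (hinv _)
    ext c
    rw [Matrix.mulVec_single_one]
    exact (hMt c).symm

/-! ### Vectors and matrices as lists in colexicographic order -/

theorem vecList_injective : Function.Injective (vecList : (Fin k → F) → List F) := by
  intro v w h
  ext a
  rw [vecList, vecList, List.map_inj_left] at h
  exact h a (by simp)

/-- All columns have length `k`, so the concatenated list can be cut in only one way. -/
theorem matList_injective {s : ℕ} :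
    Function.Injective (matList : Matrix (Fin k) (Fin s) F → List F) := by
  intro M N h
  have : ∀ ls : List (Fin s), ls.flatMap (fun l => vecList (M.col l)) =
      ls.flatMap (fun l => vecList (N.col l)) → ∀ l ∈ ls, M.col l = N.col l := by
    intro ls
    induction ls with
    | nil => simp
    | cons l ls ih =>
      intro h
      rw [List.flatMap_cons, List.flatMap_cons] at h
      obtain ⟨h1, h2⟩ := List.append_inj h (by simp [vecList])
      intro l' hl'
      rcases List.mem_cons.1 hl' with rfl | hl'
      · exact vecList_injective h1
      · exact ih h2 l' hl'
  ext a l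
  exact congrFun (this _ h l (by simp)) a

/-- Comparison starts at the last coordinate. Zero is the least scalar and one the least nonzero
scalar, so nothing with a nonzero coordinate at or after `t` can lie below the unit vector. -/
theorem vecList_single_le [LinearOrder F] (hF : ∀ μ : F, μ ≠ 0 → 0 < μ ∧ 1 ≤ μ) (t : Fin k)
    (w : Fin k → F) (hw : ∃ a, t ≤ a ∧ w a ≠ 0) : vecList (Pi.single t 1) ≤ vecList w := by
  rw [← not_lt, List.lt_iff_exists]
  have hlen : (vecList w).length = (vecList (Pi.single t (1 : F))).length := by simp [vecList]
  rintro (⟨-, h⟩ | ⟨i, h₁, h₂, heq, hlt⟩)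
  · exact h.ne hlen
  have hg : ∀ (u : Fin k → F) i (h : i < (vecList u).length), (vecList u)[i] =
      u ⟨k - 1 - i, by simp [vecList] at h; omega⟩ := by
    intro u i h
    simp [vecList]
  have hik : i < k := by simpa [vecList] using h₁
  rw [hg, hg] at hlt
  have habove : ∀ a : Fin k, k - 1 - i < (a : ℕ) → w a = (Pi.single t (1 : F) : Fin k → F) a := by
    intro a ha
    have := heq (k - 1 - a) (by omega)
    rw [hg, hg] at this
    convert this using 2 <;> (apply Fin.ext; simp; omega)
  set b : Fin k := ⟨k - 1 - i, by omega⟩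
  have hpos : ∀ μ : F, 0 ≤ μ := fun μ => by
    by_cases h : μ = 0
    · exact h.ge
    · exact (hF μ h).1.le
  obtain ⟨a, ha, hwa⟩ := hw
  by_cases hbt : b = t
  · rw [hbt, Pi.single_eq_same] at hlt
    have h0 : w t = 0 := by
      by_contra h
      exact absurd (hF _ h).2 (not_le.2 hlt)
    rcases ha.eq_or_lt with rfl | ha
    · exact hwa h0
    · rw [habove a (by rw [← hbt] at ha; exact ha), Pi.single_eq_of_ne ha.ne'] at hwa
      exact hwa rfl
  · rw [Pi.single_eq_of_ne hbt] at hlt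
    exact absurd (hpos _) (not_le.2 hlt)

/-! ### Minimization of a local function -/

/-- The values of `φ` on translates under `K` depend only on the value of `φ`. -/
def IsLocal {G X Z : Type*} [Group G] [MulAction G X] (K : Subgroup G) (φ : X → Z) : Prop :=
  ∀ g ∈ K, ∀ x y, φ x = φ y → φ (g • x) = φ (g • y)

/-- For a local function the condition for all `h ∈ K` in `stabOf` already follows from the case `h
= 1`. -/
theorem IsLocal.mem_stabOf {G X Z : Type*} [Group G] [MulAction G X] {K : Subgroup G} {φ : X → Z}
    (h : IsLocal K φ) {x : X} {g : G} : g ∈ stabOf K φ x ↔ g ∈ K ∧ φ (g • x) = φ x := by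
  constructor
  · rintro ⟨h1, h2⟩
    exact ⟨h1, by simpa using h2 1 K.one_mem⟩
  · rintro ⟨h1, h2⟩
    exact ⟨h1, fun g' hg' => h g' hg' _ _ h2⟩

theorem IsLocal.stabOf_congr {G X Z : Type*} [Group G] [MulAction G X] {K : Subgroup G} {φ : X → Z}
    (h : IsLocal K φ) {x y : X} (e : φ x = φ y) : stabOf K φ x = stabOf K φ y := by
  ext g
  rw [h.mem_stabOf, h.mem_stabOf]
  refine and_congr_right fun hg => ?_
  rw [h g hg _ _ e, e]

theorem minimizer_spec {G X Z : Type*} [Group G] [Finite G] [MulAction G X] [LinearOrder Z]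
    (K : Subgroup G) (φ : X → Z) (x : X) :
    minimizer K φ x ∈ K ∧ ∀ g ∈ K, φ (minimizer K φ x • x) ≤ φ (g • x) := by
  have h : ∃ g ∈ K, ∀ g' ∈ K, φ (g • x) ≤ φ (g' • x) := by
    obtain ⟨g, hg, hmin⟩ := Set.exists_min_image (K : Set G) (fun g => φ (g • x))
      (Set.toFinite _) ⟨1, K.one_mem⟩
    exact ⟨g, hg, hmin⟩
  rw [minimizer, dif_pos h]
  exact h.choose_spec

theorem isLocal_entry_hyp (K : Subgroup (Gsl F k Sh)) (t : ℕ) (d : Fin Sh.nH) (j : Fin (Sh.h d)) :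
    IsLocal K (fun x : Obj F k Sh => entry t x (.hyp d j)) := fun g _ _ _ h =>
  congrArg vecList (inner_smul_V_congr g (vecList_injective h))

/-- `LowerTo` is indispensable: without it the rows beyond `t` would contribute to the first `t`
rows of a translate. -/
theorem isLocal_entry_sub {K : Subgroup (Gsl F k Sh)} {t : ℕ} (hK : ∀ g ∈ K, LowerTo t g)
    (c : Fin Sh.nC) (i : Fin (Sh.n c)) :
    IsLocal K (fun x : Obj F k Sh => entry t x (.sub c i)) := fun g hg _ _ h =>
  congrArg matList ((hK g hg).topRows_congr (matList_injective h))

/-- `K` is normalized by the Young subgroup of `P`. -/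
def YoungNormal (P : Setoid (Pos Sh)) (K : Subgroup (Gsl F k Sh)) : Prop :=
  ∀ σ ∈ young P, ∀ g ∈ K, conj σ g ∈ K

theorem entry_smul_of_fixed {P : Setoid (Pos Sh)} {p : Pos Sh} (hp : p ∈ fixed P) {σ : Sh.Sym}
    (hσ : σ ∈ young P) (t : ℕ) (x : Obj F k Sh) : entry t (σ • x) p = entry t x p := by
  rw [entry_perm_smul, smul_fixed ((young P).inv_mem hσ) hp]

/-- A function that ignores the permutations in `S_P` takes the same value on `g • x` and on `conj σ
g • σ • x`, so the stabilizer inherits the normality of `K`. -/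
theorem YoungNormal.stabOf {P : Setoid (Pos Sh)} {K : Subgroup (Gsl F k Sh)} (hK : YoungNormal P K)
    {Z : Type*} {φ : Obj F k Sh → Z} (h : IsLocal K φ) (hφ : ∀ σ ∈ young P, ∀ x, φ (σ • x) = φ x)
    (x : Obj F k Sh) : YoungNormal P (stabOf K φ x) := by
  intro σ hσ g hg
  rw [h.mem_stabOf] at hg ⊢
  refine ⟨hK σ hσ g hg.1, ?_⟩
  rw [h _ (hK σ hσ g hg.1) x (σ • x) (hφ σ hσ x).symm, ← perm_inner, hφ σ hσ, hg.2]

/-! ### The invariants of the inner minimization -/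

/-- The fixed normal vectors, those at positions in `A`, span the space generated by the first `t`
unit vectors, which are among them, the first `u` rows of the generator matrices are in echelon
form, and `K` is up to these data the full stabilizer. -/
structure Inv (P : Setoid (Pos Sh)) (A : Set (Pos Sh)) (t u : ℕ) (K : Subgroup (Gsl F k Sh))
    (x : Obj F k Sh) : Prop where
  le_initial : P ≤ Sh.initialPartition
  fixed_sub : A ⊆ fixed P
  u_le : u ≤ t
  t_le : t ≤ k
  indep : ∀ c i, LinearIndependent F (x.U c i).col
  ne_zero : ∀ d j, x.V d j ≠ 0
  supported : ∀ d j, Pos.hyp d j ∈ A → ∀ a : Fin k, t ≤ (a : ℕ) → x.V d j a = 0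
  unit_mem : ∀ a : Fin k, (a : ℕ) < t → ∃ d j, Pos.hyp d j ∈ A ∧ x.V d j = Pi.single a 1
  fixV : ∀ g ∈ K, ∀ d j, Pos.hyp d j ∈ A → (g • x).V d j = x.V d j
  rcef : ∀ g ∈ K, ∀ c i, IsRCEF (topRows u ((g • x).U c i))
  mem_of_fix : ∀ g : Gsl F k Sh, (∀ d j, Pos.hyp d j ∈ A → (g • x).V d j = x.V d j) →
    (∀ c i, topRows u ((g • x).U c i) = topRows u (x.U c i)) → g ∈ K
  normal : YoungNormal P K

/-- `K` does not change the entries at the positions in `A`. -/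
def FixEntries (t : ℕ) (K : Subgroup (Gsl F k Sh)) (x : Obj F k Sh) (A : Set (Pos Sh)) : Prop :=
  ∀ g ∈ K, ∀ p ∈ A, entry t (g • x) p = entry t x p

section

variable {P : Setoid (Pos Sh)} {A : Set (Pos Sh)} {t u : ℕ} {K : Subgroup (Gsl F k Sh)}
  {x : Obj F k Sh}

theorem rankOf_congr {y : Obj F k Sh} (h : ∀ d j, Pos.hyp d j ∈ A → x.V d j = y.V d j) :
    rankOf A x = rankOf A y := by
  have : {v | ∃ d j, Pos.hyp d j ∈ A ∧ v = x.V d j} = {v | ∃ d j, Pos.hyp d j ∈ A ∧ v = y.V d j} := by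
    ext v
    exact ⟨fun ⟨d, j, h1, h2⟩ => ⟨d, j, h1, h2.trans (h d j h1)⟩,
      fun ⟨d, j, h1, h2⟩ => ⟨d, j, h1, h2.trans (h d j h1).symm⟩⟩
  rw [rankOf, this, rankOf]

theorem rankOf_eq (ht : t ≤ k)
    (h1 : ∀ d j, Pos.hyp d j ∈ A → ∀ a : Fin k, t ≤ (a : ℕ) → x.V d j a = 0)
    (h2 : ∀ a : Fin k, (a : ℕ) < t → ∃ d j, Pos.hyp d j ∈ A ∧ x.V d j = Pi.single a 1) :
    rankOf A x = t := by
  have hli : LinearIndependent F fun a : Fin t => (Pi.single (Fin.castLE ht a) 1 : Fin k → F) :=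
    (Pi.linearIndependent_single_one (Fin k) F).comp _ (Fin.castLE_injective ht)
  have : Submodule.span F {v | ∃ d j, Pos.hyp d j ∈ A ∧ v = x.V d j} =
      Submodule.span F (Set.range fun a : Fin t => (Pi.single (Fin.castLE ht a) 1 : Fin k → F)) := by
    apply le_antisymm
    · rw [Submodule.span_le]
      rintro _ ⟨d, j, hA, rfl⟩
      rw [SetLike.mem_coe, pi_eq_sum_univ' (x.V d j)]
      refine Submodule.sum_mem _ fun a _ => ?_
      by_cases ha : (a : ℕ) < t
      · refine Submodule.smul_mem _ _ (Submodule.subset_span ⟨⟨a, ha⟩, ?_⟩)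
        ext b
        simp [Pi.single_apply, eq_comm]
      · rw [h1 d j hA a (not_lt.1 ha), zero_smul]
        exact Submodule.zero_mem _
    · rw [Submodule.span_le]
      rintro _ ⟨a, rfl⟩
      obtain ⟨d, j, hA, h⟩ := h2 (Fin.castLE ht a) a.2
      exact Submodule.subset_span ⟨d, j, hA, h.symm⟩
  rw [rankOf, this, finrank_span_eq_card hli, Fintype.card_fin]

theorem Inv.rankOf (h : Inv P A t u K x) : rankOf A x = t := rankOf_eq h.t_le h.supported h.unit_mem

theorem Inv.lowerTo (h : Inv P A t u K x) : ∀ g ∈ K, LowerTo t g := fun g hg =>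
  lowerTo_of_fix fun a ha =>
    let ⟨d, j, hA, hx⟩ := h.unit_mem a ha
    ⟨d, j, hx, h.fixV g hg d j hA⟩

theorem isIndep_inner (h : ∀ c i, LinearIndependent F (x.U c i).col) (g : Gsl F k Sh) (c i) :
    LinearIndependent F ((g • x).U c i).col := by
  have key : ∀ {s : ℕ} (M : Matrix (Fin k) (Fin s) F), LinearIndependent F M.col ↔
      ∀ v, M *ᵥ v = 0 → v = 0 := by
    intro s M
    rw [← Matrix.mulVec_injective_iff]
    exact injective_iff_map_eq_zero M.mulVecLin
  rw [key, inner_smul_U]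
  intro v hv
  rw [← Matrix.mulVec_mulVec, ← Matrix.mulVec_mulVec] at hv
  have h1 := congrArg (fun w => ((g.left.1⁻¹ : GL (Fin k) F) : Matrix (Fin k) (Fin k) F) *ᵥ w) hv
  simp only [Matrix.mulVec_mulVec, ← Matrix.mul_assoc, ← Units.val_mul, inv_mul_cancel,
    Units.val_one, Matrix.one_mul, Matrix.mulVec_zero] at h1
  rw [← Matrix.mulVec_mulVec] at h1
  have h2 := (key _).1 (h c i)
    (fun l => g.right.symm (((g.left.2.1 c i : Matrix (Fin (Sh.s c)) (Fin (Sh.s c)) F)ᵀ *ᵥ v) l)) (by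
      ext a
      apply g.right.injective
      rw [Pi.zero_apply, map_zero, ← Pi.zero_apply (M := fun _ => F) a, ← h1]
      simp only [Matrix.mulVec, dotProduct, map_sum, map_mul, Matrix.map_apply,
        RingEquiv.apply_symm_apply])
  have h3 : (g.left.2.1 c i : Matrix (Fin (Sh.s c)) (Fin (Sh.s c)) F)ᵀ *ᵥ v = 0 := by
    ext l
    have := congrFun h2 l
    simpa using this
  have h4 := congrArg (fun w =>
    (((g.left.2.1 c i)⁻¹ : GL (Fin (Sh.s c)) F) : Matrix (Fin (Sh.s c)) (Fin (Sh.s c)) F)ᵀ *ᵥ w) h3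
  simpa only [Matrix.mulVec_mulVec, ← Matrix.transpose_mul, ← Units.val_mul, mul_inv_cancel,
    Units.val_one, Matrix.transpose_one, Matrix.one_mulVec, Matrix.mulVec_zero] using h4

theorem inner_V_ne_zero (h : ∀ d j, x.V d j ≠ 0) (g : Gsl F k Sh) (d j) : (g • x).V d j ≠ 0 := by
  intro h0
  apply h d j
  have : x.V d j = (g⁻¹ • g • x).V d j := by rw [inv_smul_smul]
  rw [this, inner_smul_V, h0]
  ext a
  simp [Matrix.mulVec, dotProduct]

theorem FixEntries.smul (h : FixEntries t K x A) {g : Gsl F k Sh} (hg : g ∈ K) :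
    FixEntries t K (g • x) A := by
  intro g' hg' p hp
  rw [← mul_smul, h _ (K.mul_mem hg' hg) p hp, h _ hg p hp]

theorem Inv.fixEntries_hyp (h : Inv P A t u K x) (t' : ℕ) :
    FixEntries t' K x {p | p ∈ A ∧ p ∈ Sh.hypPos} := by
  rintro g hg p ⟨hp, hp'⟩
  obtain ⟨d, j, rfl⟩ := mem_hypPos.1 hp'
  exact congrArg vecList (h.fixV g hg d j hp)

theorem Inv.smul (h : Inv P A t u K x) {g : Gsl F k Sh} (hg : g ∈ K) : Inv P A t u K (g • x) where
  le_initial := h.le_initial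
  fixed_sub := h.fixed_sub
  u_le := h.u_le
  t_le := h.t_le
  indep := isIndep_inner h.indep g
  ne_zero := inner_V_ne_zero h.ne_zero g
  supported d j hA := by rw [h.fixV g hg d j hA]; exact h.supported d j hA
  unit_mem a ha := by
    obtain ⟨d, j, hA, e⟩ := h.unit_mem a ha
    exact ⟨d, j, hA, (h.fixV g hg d j hA).trans e⟩
  fixV g' hg' d j hA := by
    rw [← mul_smul, h.fixV _ (K.mul_mem hg' hg) d j hA, h.fixV _ hg d j hA]
  rcef g' hg' := by rw [← mul_smul]; exact h.rcef _ (K.mul_mem hg' hg)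
  mem_of_fix g' h1 h2 := by
    -- If `g'` fixes the data of `g • x`, its conjugate fixes those of `x`; locality of the data
    -- allows cancelling `g'` under `g⁻¹`.
    have key : g⁻¹ * (g' * g) ∈ K := by
      refine h.mem_of_fix _ (fun d j hA => ?_) (fun c i => ?_)
      · rw [mul_smul, mul_smul, inner_smul_V_congr g⁻¹ (h1 d j hA), inv_smul_smul]
      · have hl := (h.lowerTo _ (K.inv_mem hg)).mono h.u_le
        rw [mul_smul, mul_smul, hl.topRows_congr (h2 c i), inv_smul_smul]
    rwa [K.mul_mem_cancel_left (K.inv_mem hg), K.mul_mem_cancel_right hg] at key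
  normal := h.normal

theorem Inv.mono_partition (h : Inv P A t u K x) {Q : Setoid (Pos Sh)} (hQ : Q ≤ P) :
    Inv Q A t u K x :=
  { h with
    le_initial := hQ.trans h.le_initial
    fixed_sub := h.fixed_sub.trans (fixed_anti hQ)
    normal := fun σ hσ => h.normal σ (young_mono hQ hσ) }

theorem Inv.fixed_hyp (h : Inv P A t u K x) {σ : Sh.Sym} (hσ : σ ∈ young P) {d j}
    (hA : Pos.hyp d j ∈ A) (y : Obj F k Sh) : (σ • y).V d j = y.V d j :=
  perm_smul_V_of_fixed (smul_fixed hσ (h.fixed_sub hA))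

/-- Commuting the permutation past an inner element conjugates the latter, which stays in `K` by
normality; the positions in `A` are not moved at all. -/
theorem Inv.perm (h : Inv P A t u K x) {σ : Sh.Sym} (hσ : σ ∈ young P) :
    Inv P A t u K (σ • x) where
  le_initial := h.le_initial
  fixed_sub := h.fixed_sub
  u_le := h.u_le
  t_le := h.t_le
  indep c i := h.indep _ _
  ne_zero d j := h.ne_zero _ _
  supported d j hA := by rw [h.fixed_hyp hσ hA]; exact h.supported d j hA
  unit_mem a ha := by
    obtain ⟨d, j, hA, e⟩ := h.unit_mem a ha
    exact ⟨d, j, hA, (h.fixed_hyp hσ hA x).trans e⟩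
  fixV g hg d j hA := by
    rw [inner_perm, h.fixed_hyp hσ hA, h.fixed_hyp hσ hA,
      h.fixV _ (h.normal _ ((young P).inv_mem hσ) g hg) d j hA]
  rcef g hg c i := by
    rw [inner_perm]
    exact h.rcef _ (h.normal _ ((young P).inv_mem hσ) g hg) _ _
  mem_of_fix g h1 h2 := by
    have key : conj σ⁻¹ g ∈ K := by
      refine h.mem_of_fix _ (fun d j hA => ?_) (fun c i => ?_)
      · have := h1 d j hA
        rwa [inner_perm, h.fixed_hyp hσ hA, h.fixed_hyp hσ hA] at this
      · have := h2 c (σ.1 c i)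
        rw [inner_perm, perm_smul_U, perm_smul_U] at this
        simpa using this
    have := h.normal σ hσ _ key
    rwa [conj_conj, mul_inv_cancel, one_conj] at this
  normal := h.normal

theorem FixEntries.perm (h : FixEntries t K x A) (hK : YoungNormal P K) (hA : A ⊆ fixed P)
    {σ : Sh.Sym} (hσ : σ ∈ young P) : FixEntries t K (σ • x) A := by
  intro g hg p hp
  rw [inner_perm, entry_smul_of_fixed (hA hp) hσ, entry_smul_of_fixed (hA hp) hσ,
    h _ (hK _ ((young P).inv_mem hσ) g hg) p hp]

variable [Finite F] [LinearOrder F]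

/-- Each minimized normal vector either lies in the span of the first `t` unit vectors or becomes
exactly the next unit vector. So the span of the fixed vectors stays a coordinate subspace, with `t'
= t` or `t' = t + 1`. -/
theorem Inv.minimize_hyp (hF : ∀ μ : F, μ ≠ 0 → 0 < μ ∧ 1 ≤ μ) (h : Inv P A t u K x) {d j}
    (hp : Pos.hyp d j ∈ fixed P) (t₀ : ℕ) {y : Obj F k Sh}
    (hy : y = minimizer K (fun x => entry t₀ x (.hyp d j)) x • x) :
    ∃ t', Inv P (insert (.hyp d j) A) t' u (stabOf K (fun x => entry t₀ x (.hyp d j)) y) y := by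
  obtain ⟨hg, hmin⟩ := minimizer_spec K (fun x : Obj F k Sh => entry t₀ x (.hyp d j)) x
  have hI : Inv P A t u K y := hy ▸ h.smul hg
  have hloc := isLocal_entry_hyp K t₀ d j
  have hmem : ∀ g, g ∈ stabOf K (fun x : Obj F k Sh => entry t₀ x (.hyp d j)) y ↔
      g ∈ K ∧ (g • y).V d j = y.V d j := by
    intro g
    rw [hloc.mem_stabOf]
    exact and_congr_right fun _ => ⟨fun e => vecList_injective e, fun e => congrArg vecList e⟩
  have main : ∃ t', t ≤ t' ∧ t' ≤ k ∧ (∀ a : Fin k, t' ≤ (a : ℕ) → y.V d j a = 0) ∧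
      ∀ a : Fin k, (a : ℕ) < t' → ¬ (a : ℕ) < t → y.V d j = Pi.single a 1 := by
    -- In the dependent case the minimal form is irrelevant; only its support matters.
    by_cases hs : ∀ a : Fin k, t ≤ (a : ℕ) → y.V d j a = 0
    · exact ⟨t, le_rfl, h.t_le, hs, fun a h1 h2 => absurd h1 h2⟩
    push Not at hs
    have htk : t < k := by
      obtain ⟨a, ha, -⟩ := hs
      exact ha.trans_lt a.2
    -- The element that moves the vector to `e_t` fixes all normalized data, hence belongs to `K` by
    -- `mem_of_fix`; so the minimum is at most `e_t`. Conversely `e_t` is the least vector that is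
    -- not supported below `t`.
    have hyV : y.V d j = Pi.single ⟨t, htk⟩ 1 := by
      apply vecList_injective
      apply le_antisymm _ (vecList_single_le hF _ _ hs)
      obtain ⟨g, hg1, hg2, hg3⟩ := exists_inner_map_single (Sh := Sh) t htk (y.V d j) hs
      have hgK : g ∈ K := hI.mem_of_fix g (fun d j hA => hg2 _ _ _ (hI.supported d j hA))
        (fun c i => topRows_eq_of_le h.u_le (hg1 y c i))
      rw [← hg3 y d j rfl, hy]
      have := hmin _ (K.mul_mem hgK hg)
      rw [mul_smul] at this
      exact this
    refine ⟨t + 1, Nat.le_succ _, htk, fun a ha => ?_, fun a h1 h2 => ?_⟩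
    · rw [hyV, Pi.single_eq_of_ne]
      rintro rfl
      exact absurd ha (by simp)
    · rw [hyV]
      congr 1
      exact Fin.ext (by simp; omega)
  obtain ⟨t', htt', ht'k, hs', hu'⟩ := main
  refine ⟨t', h.le_initial, Set.insert_subset hp h.fixed_sub, h.u_le.trans htt', ht'k, hI.indep,
    hI.ne_zero, ?_, fun a ha => ?_, ?_, fun g hg => hI.rcef g ((hmem g).1 hg).1, ?_, ?_⟩
  · rintro d' j' (e | hA) a ha
    · cases e; exact hs' a ha
    · exact hI.supported d' j' hA a (htt'.trans ha)
  · by_cases hat : (a : ℕ) < t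
    · obtain ⟨d', j', hA, e⟩ := hI.unit_mem a hat
      exact ⟨d', j', Or.inr hA, e⟩
    · exact ⟨d, j, Or.inl rfl, hu' a ha hat⟩
  · rintro g hg d' j' (e | hA)
    · cases e; exact ((hmem g).1 hg).2
    · exact hI.fixV g ((hmem g).1 hg).1 d' j' hA
  · intro g h1 h2
    exact (hmem g).2 ⟨hI.mem_of_fix g (fun d j hA => h1 d j (Or.inr hA)) h2, h1 d j (Or.inl rfl)⟩
  · exact hI.normal.stabOf hloc (fun σ hσ x => entry_smul_of_fixed hp hσ _ x) y

/-- The two row counts must agree: an element fixing the first `t` rows fixes the minimized entry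
because this entry consists of exactly these rows, and so it remains in the smaller stabilizer. -/
theorem Inv.minimize_sub (h : Inv P A t t K x) {S : Set (Pos Sh)} (hS : FixEntries t K x S) {c i}
    (hp : Pos.sub c i ∈ fixed P) {y : Obj F k Sh}
    (hy : y = minimizer K (fun x => entry t x (.sub c i)) x • x) :
    Inv P A t t (stabOf K (fun x => entry t x (.sub c i)) y) y ∧
      FixEntries t (stabOf K (fun x => entry t x (.sub c i)) y) y (insert (.sub c i) S) := by
  obtain ⟨hg, -⟩ := minimizer_spec K (fun x : Obj F k Sh => entry t x (.sub c i)) x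
  have hI : Inv P A t t K y := hy ▸ h.smul hg
  have hSy : FixEntries t K y S := hy ▸ hS.smul hg
  have hloc := isLocal_entry_sub h.lowerTo c i
  refine ⟨{ hI with
    fixV := fun g hg => hI.fixV g hg.1
    rcef := fun g hg => hI.rcef g hg.1
    mem_of_fix := fun g h1 h2 => hloc.mem_stabOf.2 ⟨hI.mem_of_fix g h1 h2,
      congrArg matList (h2 c i)⟩
    normal := hI.normal.stabOf hloc (fun σ hσ x => entry_smul_of_fixed hp hσ _ x) y }, ?_⟩
  rintro g hg p (rfl | hp)
  · exact (hloc.mem_stabOf.1 hg).2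
  · exact hSy g hg.1 p hp

end

/-! ### Labels and sorting -/

section Labels

variable {t : ℕ} {x y : Obj F k Sh} [Finite F] [LinearOrder F]

theorem leastOf_mem {α : Type*} [LinearOrder α] [Inhabited α] {S : Set α} (hf : S.Finite)
    (hS : S.Nonempty) : leastOf S ∈ S := by
  have h : ∃ a, IsLeast S a := by
    obtain ⟨a, ha, hmin⟩ := Set.exists_min_image S id hf hS
    exact ⟨a, ha, fun b hb => hmin b hb⟩
  rw [leastOf, dif_pos h]
  exact h.choose_spec.1

theorem label_perm (σ : Sh.Sym) (x : Obj F k Sh) (p : Pos Sh) :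
    label t (σ • x) p = label t x (σ⁻¹ • p) := by
  cases p <;> rfl

/-- The diagonal matrix, field automorphism and column operation by which `g` changes the first `t`
rows are absorbed into `D`, `τ` and `B`. So the set of competitors for the minimum does not change.
-/
theorem label_inner {K : Subgroup (Gsl F k Sh)} (hK : ∀ g ∈ K, LowerTo t g) {g : Gsl F k Sh}
    (hg : g ∈ K) (x : Obj F k Sh) (p : Pos Sh) : label t (g • x) p = label t x p := by
  cases p with
  | hyp d j => rfl
  | sub c i =>
    have key : ∀ g ∈ K, ∀ x : Obj F k Sh,
        {l | ∃ (D : Fin k → Fˣ) (τ : RingAut F) (B : GL (Fin (Sh.s c)) F)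
          (M : Matrix (Fin k) (Fin (Sh.s c)) F),
          M = Matrix.diagonal (fun a => (D a : F)) * (topRows t ((g • x).U c i)).map τ *
            (B : Matrix (Fin (Sh.s c)) (Fin (Sh.s c)) F)ᵀ ∧ IsRCEF M ∧ l = matList M} ⊆
        {l | ∃ (D : Fin k → Fˣ) (τ : RingAut F) (B : GL (Fin (Sh.s c)) F)
          (M : Matrix (Fin k) (Fin (Sh.s c)) F),
          M = Matrix.diagonal (fun a => (D a : F)) * (topRows t (x.U c i)).map τ *
            (B : Matrix (Fin (Sh.s c)) (Fin (Sh.s c)) F)ᵀ ∧ IsRCEF M ∧ l = matList M} := by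
      rintro g hg x l ⟨D, τ, B, M, hM, hR, rfl⟩
      obtain ⟨D', hD'⟩ := (hK g hg).exists_diagonal
      refine ⟨D * fun a => Units.map (τ : F →* F) (D' a), τ * g.right,
        B * galGL F _ τ (g.left.2.1 c i), M, ?_, hR, rfl⟩
      rw [hM, hD' x c i]
      have e1 : Matrix.diagonal (fun a => ((D * fun a => Units.map (τ : F →* F) (D' a)) a : F)) =
          Matrix.diagonal (fun a => (D a : F)) *
            (Matrix.diagonal (fun a => (D' a : F))).map τ := by
        rw [Matrix.diagonal_map (map_zero τ), Matrix.diagonal_mul_diagonal]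
        rfl
      have e2 : ((B * galGL F _ τ (g.left.2.1 c i) : GL (Fin (Sh.s c)) F) :
          Matrix (Fin (Sh.s c)) (Fin (Sh.s c)) F)ᵀ =
          ((g.left.2.1 c i : Matrix (Fin (Sh.s c)) (Fin (Sh.s c)) F)ᵀ).map τ *
            (B : Matrix (Fin (Sh.s c)) (Fin (Sh.s c)) F)ᵀ := by
        rw [Units.val_mul, Matrix.transpose_mul]
        rfl
      have e3 : (topRows t (x.U c i)).map (τ * g.right : RingAut F) =
          ((topRows t (x.U c i)).map g.right).map τ := rfl
      rw [e1, e2, e3, Matrix.map_mul, Matrix.map_mul]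
      simp only [Matrix.mul_assoc]
    refine congrArg leastOf (Set.Subset.antisymm (key g hg x) ?_)
    have := key g⁻¹ (K.inv_mem hg) (g • x)
    rwa [inv_smul_smul] at this

/-- The minimum in `label` is attained: over a finite field there are finitely many competitors, and
column reduction starting from zero rows produces one. -/
theorem label_spec (hx : ∀ c i, LinearIndependent F (x.U c i).col) (c : Fin Sh.nC)
    (i : Fin (Sh.n c)) : ∃ (D : Fin k → Fˣ) (τ : RingAut F) (B : GL (Fin (Sh.s c)) F)
      (M : Matrix (Fin k) (Fin (Sh.s c)) F),
      M = Matrix.diagonal (fun a => (D a : F)) * (topRows t (x.U c i)).map τ *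
        (B : Matrix (Fin (Sh.s c)) (Fin (Sh.s c)) F)ᵀ ∧ IsRCEF M ∧
      label t x (.sub c i) = matList M := by
  refine leastOf_mem (S := {l | ∃ (D : Fin k → Fˣ) (τ : RingAut F) (B : GL (Fin (Sh.s c)) F)
      (M : Matrix (Fin k) (Fin (Sh.s c)) F),
      M = Matrix.diagonal (fun a => (D a : F)) * (topRows t (x.U c i)).map τ *
        (B : Matrix (Fin (Sh.s c)) (Fin (Sh.s c)) F)ᵀ ∧ IsRCEF M ∧ l = matList M}) ?_ ?_
  · refine (Set.finite_range (matList : Matrix (Fin k) (Fin (Sh.s c)) F → List F)).subset ?_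
    rintro l ⟨D, τ, B, M, -, -, rfl⟩
    exact ⟨M, rfl⟩
  · obtain ⟨B, -, hB⟩ := exists_GL_topRows (Nat.zero_le t) _ (isRCEF_topRows_zero _ (hx c i))
    refine ⟨_, 1, 1, B, _, rfl, ?_, rfl⟩
    rw [topRows_mul] at hB
    have : Matrix.diagonal (fun a => (((1 : Fin k → Fˣ) a : Fˣ) : F)) *
        (topRows t (x.U c i)).map (1 : RingAut F) = topRows t (x.U c i) := by
      have e : (topRows t (x.U c i)).map (1 : RingAut F) = topRows t (x.U c i) := by ext; rfl
      rw [e]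
      simp
    rwa [this]

/-- A label encodes a member of the class it represents, and the rank is constant on the class. For
matrices in echelon form this constancy is read off from the number of pivots. -/
theorem rank_eq_of_label_eq (hx : ∀ c i, LinearIndependent F (x.U c i).col)
    (hy : ∀ c i, LinearIndependent F (y.U c i).col) {c : Fin Sh.nC} {i i' : Fin (Sh.n c)}
    (hxR : IsRCEF (topRows t (x.U c i))) (hyR : IsRCEF (topRows t (y.U c i')))
    (h : label t x (.sub c i) = label t y (.sub c i')) :
    (topRows t (x.U c i)).rank = (topRows t (y.U c i')).rank := by
  obtain ⟨D, τ, B, M, hM, -, e⟩ := label_spec (t := t) hx c i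
  obtain ⟨D', τ', B', M', hM', -, e'⟩ := label_spec (t := t) hy c i'
  have : M = M' := matList_injective (by rw [← e, ← e', h])
  rw [← hxR.rank_diag_mul_map D τ, ← rank_mul_GL _ B, ← hM, this, hM', rank_mul_GL,
    hyR.rank_diag_mul_map]

/-- Among the admissible permutations choose one whose rearranged label sequence is
lexicographically least; an inversion inside a cell could be removed by a transposition, with a
smaller result. Hyperplanes all carry the empty label, so the transposition never moves them. -/
theorem sortPerm_spec {P : Setoid (Pos Sh)} (hP : P ≤ Sh.initialPartition) (l : Pos Sh → List F)
    (hl : ∀ d j, l (.hyp d j) = []) : Node.sortPerm P l ∈ young P ∧ (Node.sortPerm P l).2 = 1 ∧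
      ∀ p q, P p q → p ≤ q → l ((Node.sortPerm P l)⁻¹ • p) ≤ l ((Node.sortPerm P l)⁻¹ • q) := by
  have h : ∃ σ ∈ young P, σ.2 = 1 ∧ ∀ p q, P p q → p ≤ q → l (σ⁻¹ • p) ≤ l (σ⁻¹ • q) := by
    obtain ⟨σ, ⟨hσ, hσ2⟩, hmin⟩ := Set.exists_min_image {σ | σ ∈ young P ∧ σ.2 = 1}
      (fun σ : Sh.Sym => toLex fun p => l (σ⁻¹ • p)) (Set.toFinite _) ⟨1, one_mem _, rfl⟩
    refine ⟨σ, hσ, hσ2, fun p q hpq hle => ?_⟩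
    by_contra hlt
    rw [not_le] at hlt
    have hne : p ≠ q := by rintro rfl; exact lt_irrefl _ hlt
    have hlt' : p < q := lt_of_le_of_ne hle hne
    have hsw2 : (Sh.swap p q).2 = 1 := by
      cases p with
      | sub c i =>
        cases q with
        | sub c' i' =>
          obtain rfl : c = c' := hP hpq
          simp [swap]
        | hyp d j => rfl
      | hyp d j =>
        cases q with
        | sub c' i' => rfl
        | hyp d' j' =>
          rw [smul_pos_hyp, smul_pos_hyp, hl, hl] at hlt
          exact absurd hlt (lt_irrefl _)
    have := hmin (Sh.swap p q * σ) ⟨mul_mem (swap_mem_young hP hpq) hσ, by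
      rw [Prod.snd_mul, hsw2, hσ2, one_mul]⟩
    refine absurd this (not_le.2 ?_)
    have hinv : (Sh.swap p q)⁻¹ = Sh.swap p q := inv_eq_of_mul_eq_one_left (swap_mul_self (hP hpq))
    refine ⟨p, fun r hr => ?_, ?_⟩
    · change l ((Sh.swap p q * σ)⁻¹ • r) = l (σ⁻¹ • r)
      rw [mul_inv_rev, hinv, mul_smul, swap_smul (hP hpq), if_neg hr.ne,
        if_neg (hr.trans hlt').ne]
    · change l ((Sh.swap p q * σ)⁻¹ • p) < l (σ⁻¹ • p)
      rw [mul_inv_rev, hinv, mul_smul, swap_smul (hP hpq), if_pos rfl]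
      exact hlt
  rw [Node.sortPerm, dif_pos h]
  exact h.choose_spec

/-- Sorting is unique. At the first position `p` of disagreement, say `l p < l' p`, count the
positions in the cell of `p` with value at most `l p`: `ρ` matches the two sets bijectively, but the
one for `l'` is properly contained in the one for `l`. -/
theorem eq_of_sorted {α : Type*} [LinearOrder α] {P : Setoid (Pos Sh)} {l l' : Pos Sh → α}
    (hl : ∀ p q, P p q → p ≤ q → l p ≤ l q) (hl' : ∀ p q, P p q → p ≤ q → l' p ≤ l' q)
    {ρ : Sh.Sym} (hρ : ρ ∈ young P) (h : ∀ p, l' (ρ • p) = l p) : l = l' := by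
  by_contra hne
  obtain ⟨p, hp, hmin⟩ := Set.exists_min_image {p | l p ≠ l' p} id (Set.toFinite _)
    (Function.ne_iff.1 hne)
  have hlt : ∀ q < p, l q = l' q := by
    intro q hq
    by_contra h'
    exact absurd (hmin q h') (not_le.2 hq)
  have key : ∀ {l l' : Pos Sh → α} {ρ : Sh.Sym}, (∀ p q, P p q → p ≤ q → l' p ≤ l' q) →
      ρ ∈ young P → (∀ p, l' (ρ • p) = l p) → (∀ q < p, l q = l' q) → ¬ l p < l' p := by
    intro l l' ρ hl' hρ h hlt hp
    have hsub : {q | P q p ∧ l' q ≤ l p} ⊂ {q | P q p ∧ l q ≤ l p} := by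
      refine ⟨fun q hq => ⟨hq.1, ?_⟩, fun hs => ?_⟩
      · have : q < p := by
          by_contra hqp
          exact absurd (hq.2.trans_lt hp) (not_lt.2 (hl' p q (P.symm hq.1) (not_lt.1 hqp)))
        rw [hlt q this]
        exact hq.2
      · exact absurd (hs ⟨P.refl p, le_rfl⟩).2 (not_le.2 hp)
    have himg : {q | P q p ∧ l' q ≤ l p} = (ρ • ·) '' {q | P q p ∧ l q ≤ l p} := by
      ext q
      constructor
      · rintro ⟨h1, h2⟩
        refine ⟨ρ⁻¹ • q, ⟨P.trans ((young P).inv_mem hρ q) h1, ?_⟩, smul_inv_smul _ _⟩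
        rwa [← h, smul_inv_smul]
      · rintro ⟨q, ⟨h1, h2⟩, rfl⟩
        exact ⟨P.trans (hρ q) h1, (h q).trans_le h2⟩
    have := Set.ncard_lt_ncard hsub (Set.toFinite _)
    rw [himg, Set.ncard_image_of_injective _ (MulAction.injective ρ)] at this
    exact lt_irrefl _ this
  rcases lt_or_gt_of_ne hp with h1 | h1
  · exact key hl' hρ h hlt h1
  · refine key (ρ := ρ⁻¹) hl ((young P).inv_mem hρ) (fun q => ?_) (fun q hq => (hlt q hq).symm) h1
    rw [← h, smul_inv_smul]

end Labels

/-! ### Echelon forms -/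

section Echelon

variable {P : Setoid (Pos Sh)} {A : Set (Pos Sh)} {t u : ℕ} {K : Subgroup (Gsl F k Sh)}
  {x y : Obj F k Sh}

/-- A pure column operation fixes every normal vector. If it also keeps the first `u` rows,
`mem_of_fix` puts it into `K`. -/
theorem Inv.echelonizer_spec (h : Inv P A t u K x) : Node.echelonizer t K x ∈ K ∧
    ∀ c i, IsRCEF (topRows t ((Node.echelonizer t K x • x).U c i)) := by
  have hex : ∃ g ∈ K, ∀ c i, IsRCEF (topRows t ((g • x).U c i)) := by
    have h0 := h.rcef 1 K.one_mem
    rw [one_smul] at h0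
    choose B hB1 hB2 using fun c i => exists_GL_topRows h.u_le _ (h0 c i)
    let g : Gsl F k Sh := ⟨(1, B, 1), 1⟩
    have hU : ∀ c i, (g • x).U c i =
        x.U c i * (B c i : Matrix (Fin (Sh.s c)) (Fin (Sh.s c)) F)ᵀ := by
      intro c i
      rw [inner_smul_U]
      change (1 : Matrix (Fin k) (Fin k) F) * (x.U c i).map (fun y => y) * _ = _
      simp [g]
    refine ⟨g, h.mem_of_fix g (fun d j _ => ?_) (fun c i => ?_), fun c i => ?_⟩
    · rw [inner_smul_V]
      change (1 : F) • (((1⁻¹ : GL (Fin k) F) : Matrix (Fin k) (Fin k) F)ᵀ *ᵥ x.V d j) = _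
      simp
    · rw [hU]; exact hB1 c i
    · rw [hU]; exact hB2 c i
  rw [Node.echelonizer, dif_pos hex]
  exact hex.choose_spec

theorem mem_echelonStab {g : Gsl F k Sh} : g ∈ Node.echelonStab t x ↔
    ∀ c i, g.left.2.1 c i ∈ diagGL F (Sh.s c) (topRows t (x.U c i)).rank := Iff.rfl

theorem LowerTo.mem_diagGL {g : Gsl F k Sh} (hg : LowerTo t g) {c i}
    (h : IsRCEF (topRows t (x.U c i))) (h' : IsRCEF (topRows t ((g • x).U c i))) :
    g.left.2.1 c i ∈ diagGL F (Sh.s c) (topRows t (x.U c i)).rank := by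
  obtain ⟨D, hD⟩ := hg.exists_diagonal
  exact h.mem_diagGL h' D g.right (hD x c i)

variable [Finite F] [LinearOrder F]

/-- `echelonStab` depends on the sequence only through ranks, and these are determined by the
labels. -/
theorem echelonStab_congr (hx : ∀ c i, LinearIndependent F (x.U c i).col)
    (hy : ∀ c i, LinearIndependent F (y.U c i).col)
    (hxR : ∀ c i, IsRCEF (topRows t (x.U c i))) (hyR : ∀ c i, IsRCEF (topRows t (y.U c i)))
    (h : label t x = label t y) : Node.echelonStab t x = Node.echelonStab t y := by
  ext g
  rw [mem_echelonStab, mem_echelonStab]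
  simp only [rank_eq_of_label_eq hx hy (hxR _ _) (hyR _ _) (congrFun h _)]

/-- The prior splitting by labels makes the rank constant on cells, so the restriction on the column
factors is invariant under `S_P`. No element fixing the first `t` rows is lost, because uniqueness
of the echelon form already forces its column factors to be diagonal there. -/
theorem Inv.echelonize (h : Inv P A t u K x) (hP : ∀ p q, P p q → label t x p = label t x q)
    (hy : y = Node.echelonizer t K x • x) : Inv P A t t (K ⊓ Node.echelonStab t y) y := by
  obtain ⟨hg, hR⟩ := h.echelonizer_spec
  rw [← hy] at hR
  have hI : Inv P A t u K y := hy ▸ h.smul hg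
  have hPy : ∀ p q, P p q → label t y p = label t y q := by
    intro p q hpq
    rw [hy, label_inner h.lowerTo hg, label_inner h.lowerTo hg, hP p q hpq]
  refine { hI with
    u_le := le_rfl
    fixV := fun g hg => hI.fixV g hg.1
    rcef := fun g hg c i => ?_
    mem_of_fix := fun g h1 h2 => ?_
    normal := fun σ hσ g hg => ⟨hI.normal σ hσ g hg.1, fun c i => ?_⟩ }
  · obtain ⟨D, hD⟩ := (hI.lowerTo g hg.1).exists_diagonal
    rw [hD]
    exact (hR c i).smul D g.right (hg.2 c i)
  · have hgK := hI.mem_of_fix g h1 fun c i => topRows_eq_of_le h.u_le (h2 c i)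
    refine ⟨hgK, fun c i => (hI.lowerTo g hgK).mem_diagGL (hR c i) ?_⟩
    rw [h2]
    exact hR c i
  · have := hg.2 c ((σ.1 c)⁻¹ i)
    rwa [rank_eq_of_label_eq hI.indep hI.indep (hR _ _) (hR c i)] at this
    exact hPy _ _ ((young P).inv_mem hσ (Pos.sub c i))

end Echelon

variable {Y : Type*}

/-! ### Comparison of nodes -/

/-- The nodes correspond to each other under the permutation `σ` and the inner group. The root of
the tree of `nd'` is obtained from the one of `nd` by the permutation `α`. -/
structure Equivalent (α σ : Sh.Sym) (nd nd' : Node F k Sh Y) : Prop where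
  P_eq : nd'.P = nd.P
  inn_eq : nd'.inn = nd.inn
  trace_eq : nd'.trace = nd.trace
  mem : σ ∈ young nd.P
  x_eq : ∃ g ∈ nd.inn, nd'.x = g • σ • nd.x
  perm_eq : nd'.perm * α = σ * nd.perm

/-- The nodes have the same partition, inner stabilizer and values, and coincide at the positions in
`A`. -/
structure SameData (t : ℕ) (A : Set (Pos Sh)) (nd nd' : Node F k Sh Y) : Prop where
  P_eq : nd'.P = nd.P
  inn_eq : nd'.inn = nd.inn
  trace_eq : nd'.trace = nd.trace
  entry_eq : ∀ p ∈ A, entry t nd'.x p = entry t nd.x p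

/-- The invariant of a node; `A` is the set of positions which have been minimized. -/
def WellFormed (A : Set (Pos Sh)) (nd : Node F k Sh Y) : Prop :=
  ∃ t, Inv nd.P A t t nd.inn nd.x ∧ FixEntries t nd.inn nd.x A

theorem append_singleton_prefix_inj {β : Type*} {l L : List β} {a b : β} (ha : l ++ [a] <+: L)
    (hb : l ++ [b] <+: L) : a = b := by
  have := List.prefix_of_prefix_length_le ha hb (by simp)
  simpa using this

theorem append_prefix_inj {β : Type*} {l L a b : List β} (ha : l ++ a <+: L)
    (hb : l ++ b <+: L) (h : a.length = b.length) : a = b := by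
  have := List.prefix_of_prefix_length_le ha hb (by simp [h])
  rw [List.prefix_append_right_inj] at this
  exact this.eq_of_length h

theorem SameData.mono {t : ℕ} {A B : Set (Pos Sh)} {nd nd' : Node F k Sh Y}
    (h : SameData t A nd nd') (hB : B ⊆ A) : SameData t B nd nd' :=
  { h with entry_eq := fun p hp => h.entry_eq p (hB hp) }

/-- Apart from `fixed_sub`, the invariant refers to `A` only through hyperplane positions. -/
theorem Inv.congr {P : Setoid (Pos Sh)} {A B : Set (Pos Sh)} {t u : ℕ} {K : Subgroup (Gsl F k Sh)}
    {x : Obj F k Sh} (h : Inv P A t u K x) (hB : B ⊆ fixed P)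
    (hAB : ∀ d j, Pos.hyp d j ∈ A ↔ Pos.hyp d j ∈ B) : Inv P B t u K x :=
  { h with
    fixed_sub := hB
    supported := fun d j hd => h.supported d j ((hAB d j).2 hd)
    unit_mem := fun a ha =>
      let ⟨d, j, h1, h2⟩ := h.unit_mem a ha
      ⟨d, j, (hAB d j).1 h1, h2⟩
    fixV := fun g hg d j hd => h.fixV g hg d j ((hAB d j).2 hd)
    mem_of_fix := fun g h1 h2 => h.mem_of_fix g (fun d j hd => h1 d j ((hAB d j).1 hd)) h2 }

namespace Node

section Trace

variable [LinearOrder F]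

/-- Stabilizer, minimizer and result are variables with defining equations, so that two nodes with
equal stabilizers can be brought to the same form. -/
theorem minimizeAt_eq (t : ℕ) (nd : Node F k Sh Y) (p : Pos Sh) {K : Subgroup (Gsl F k Sh)}
    {g : Gsl F k Sh} {y : Obj F k Sh} (hK : nd.inn = K)
    (hg : g = minimizer K (fun x : Obj F k Sh => entry t x p) nd.x) (hy : y = g • nd.x) :
    nd.minimizeAt t p =
      { P := nd.P
        perm := nd.perm
        x := y
        inn := stabOf K (fun x : Obj F k Sh => entry t x p) y
        acc := toGammaL g * nd.acc
        trace := nd.trace ++ [toLex (.inl (entry t y p))] } := by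
  subst hK hg hy
  rfl

theorem minimizeAt_trace_prefix (t : ℕ) (nd : Node F k Sh Y) (p : Pos Sh) :
    nd.trace <+: (nd.minimizeAt t p).trace := List.prefix_append _ _

theorem foldl_minimizeAt_trace_prefix (t : ℕ) (ps : List (Pos Sh)) (nd : Node F k Sh Y) :
    nd.trace <+: (ps.foldl (minimizeAt t) nd).trace := by
  induction ps generalizing nd with
  | nil => exact List.prefix_rfl
  | cons p ps ih => exact (minimizeAt_trace_prefix t nd p).trans (ih _)

theorem foldl_minimizeAt_P (t : ℕ) (ps : List (Pos Sh)) (nd : Node F k Sh Y) :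
    (ps.foldl (minimizeAt t) nd).P = nd.P := by
  induction ps generalizing nd with
  | nil => rfl
  | cons p ps ih => exact (ih _).trans rfl

theorem foldl_record (ls : List (Pos Sh)) (v : Pos Sh → Value F Y) (nd : Node F k Sh Y) :
    ls.foldl (fun nd p => nd.record (v p)) nd = { nd with trace := nd.trace ++ ls.map v } := by
  induction ls generalizing nd with
  | nil => simp
  | cons p ls ih => rw [List.foldl_cons, ih]; simp [record]

theorem refineByLabel_eq (t : ℕ) (nd : Node F k Sh Y) : nd.refineByLabel t =
    { P := splitBy nd.P (label t (sortPerm nd.P (label t nd.x) • nd.x))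
      perm := sortPerm nd.P (label t nd.x) * nd.perm
      x := sortPerm nd.P (label t nd.x) • nd.x
      inn := nd.inn
      acc := nd.acc
      trace := nd.trace ++ Sh.subPos.map fun p =>
        toLex (.inl (label t (sortPerm nd.P (label t nd.x) • nd.x) p)) } := by
  rw [refineByLabel, foldl_record]
  rfl

end Trace

variable [Finite F] [LinearOrder F] {nd nd' : Node F k Sh Y} {α σ : Sh.Sym}

/-! #### Minimization at a position -/

/-- The entry at a fixed position does not see `σ`, so both orbits offer the same values and have
the same minimum. The element connecting the minimized sequences then preserves this minimum and
lies in the new stabilizer, whichever minimizers were chosen. -/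
theorem _root_.SubspaceCanon.Equivalent.minimizeAt (h : Equivalent α σ nd nd')
    (hK : YoungNormal nd.P nd.inn) {t : ℕ} {p : Pos Sh} (hp : p ∈ fixed nd.P)
    (hloc : IsLocal nd.inn fun x : Obj F k Sh => entry t x p) :
    Equivalent α σ (nd.minimizeAt t p) (nd'.minimizeAt t p) := by
  obtain ⟨h1, h2, h3, hσ, ⟨g, hg, hx⟩, hπ⟩ := h
  have hφσ : ∀ σ ∈ young nd.P, ∀ x : Obj F k Sh, entry t (σ • x) p = entry t x p :=
    fun σ hσ x => entry_smul_of_fixed hp hσ t x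
  obtain ⟨hm, hmin⟩ := minimizer_spec nd.inn (fun x : Obj F k Sh => entry t x p) nd.x
  obtain ⟨hm', hmin'⟩ := minimizer_spec nd.inn (fun x : Obj F k Sh => entry t x p) nd'.x
  obtain ⟨g₀, hg₀⟩ : ∃ g, g = minimizer nd.inn (fun x : Obj F k Sh => entry t x p) nd.x := ⟨_, rfl⟩
  obtain ⟨g₀', hg₀'⟩ : ∃ g, g = minimizer nd.inn (fun x : Obj F k Sh => entry t x p) nd'.x :=
    ⟨_, rfl⟩
  obtain ⟨y, hy⟩ : ∃ y, y = g₀ • nd.x := ⟨_, rfl⟩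
  obtain ⟨y', hy'⟩ : ∃ y, y = g₀' • nd'.x := ⟨_, rfl⟩
  rw [minimizeAt_eq t nd p rfl hg₀ hy, minimizeAt_eq t nd' p h2 hg₀' hy']
  rw [← hg₀, ← hy] at hmin
  rw [← hg₀', ← hy'] at hmin'
  rw [← hg₀] at hm
  rw [← hg₀'] at hm'
  have hmem : g₀' * g * conj σ g₀⁻¹ ∈ nd.inn :=
    mul_mem (mul_mem hm' hg) (hK σ hσ _ (inv_mem hm))
  have hx₁ : y' = (g₀' * g * conj σ g₀⁻¹) • σ • y := by
    rw [hy, mul_smul, ← perm_inner, inv_smul_smul, mul_smul, ← hx, hy']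
  -- Each minimum also occurs as a value on the other orbit.
  have hval : entry t y' p = entry t y p := by
    apply le_antisymm
    · have := hmin' (conj σ g₀ * g⁻¹) (mul_mem (hK σ hσ _ hm) (inv_mem hg))
      rwa [hx, mul_smul, inv_smul_smul, ← perm_inner, hφσ σ hσ, ← hy] at this
    · have hg' : g₀' * g ∈ nd.inn := mul_mem hm' hg
      have := hmin (conj σ⁻¹ (g₀' * g)) (hK _ (inv_mem hσ) _ hg')
      rwa [← hφσ σ hσ (conj σ⁻¹ (g₀' * g) • nd.x), ← inner_perm, mul_smul, ← hx, ← hy'] at this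
  exact ⟨h1, hloc.stabOf_congr hval, by rw [h3, hval], hσ, ⟨_, hloc.mem_stabOf.2
    ⟨hmem, (hloc _ hmem _ _ (hφσ σ hσ y).symm).trans (by rw [← hx₁]; exact hval)⟩, hx₁⟩, hπ⟩

/-- The value recorded is the minimized entry itself, so equal traces give equal entries at `p`. At
the positions already treated, the minimizers change nothing. -/
theorem _root_.SubspaceCanon.SameData.minimizeAt {t t' : ℕ} {A : Set (Pos Sh)}
    (h : SameData t A nd nd') (hf : FixEntries t nd.inn nd.x A) (hf' : FixEntries t nd'.inn nd'.x A)
    {p : Pos Sh} (hloc : IsLocal nd.inn fun x : Obj F k Sh => entry t' x p)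
    {L : List (Value F Y)} (hL : (nd.minimizeAt t' p).trace <+: L)
    (hL' : (nd'.minimizeAt t' p).trace <+: L) :
    SameData t A (nd.minimizeAt t' p) (nd'.minimizeAt t' p) ∧
      entry t' (nd'.minimizeAt t' p).x p = entry t' (nd.minimizeAt t' p).x p := by
  obtain ⟨h1, h2, h3, he⟩ := h
  obtain ⟨hm, -⟩ := minimizer_spec nd.inn (fun x : Obj F k Sh => entry t' x p) nd.x
  obtain ⟨hm', -⟩ := minimizer_spec nd.inn (fun x : Obj F k Sh => entry t' x p) nd'.x
  rw [minimizeAt_eq t' nd p rfl rfl rfl] at hL ⊢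
  rw [minimizeAt_eq t' nd' p h2 rfl rfl] at hL' ⊢
  dsimp only at hL hL' ⊢
  rw [h3] at hL'
  have hval := append_singleton_prefix_inj hL' hL
  have hval' := Sum.inl.inj (toLex.injective hval)
  refine ⟨⟨h1, hloc.stabOf_congr hval', ?_, fun q hq => ?_⟩, hval'⟩
  · dsimp only
    rw [h3, hval]
  · dsimp only
    rw [h2] at hf'
    rw [hf _ hm q hq, hf' _ hm' q hq, he q hq]

/-! #### Minimization of normal vectors -/

/-- Only `t` grows during this phase. The old fixed vectors stay literally unchanged, which is why
the preceding rank can still be read off afterwards. -/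
theorem inv_foldl_hyp (hF : ∀ μ : F, μ ≠ 0 → 0 < μ ∧ 1 ≤ μ) {ps : List (Pos Sh)}
    {A : Set (Pos Sh)} {t u : ℕ} (h : Inv nd.P A t u nd.inn nd.x)
    (hps : ∀ p ∈ ps, p ∈ fixed nd.P ∧ p ∈ Sh.hypPos) (t₀ : ℕ) :
    (∃ t', Inv nd.P (A ∪ {p | p ∈ ps}) t' u (ps.foldl (Node.minimizeAt t₀) nd).inn
      (ps.foldl (Node.minimizeAt t₀) nd).x) ∧
    ∀ d j, Pos.hyp d j ∈ A → (ps.foldl (Node.minimizeAt t₀) nd).x.V d j = nd.x.V d j := by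
  induction ps generalizing nd A t with
  | nil => exact ⟨⟨t, by simpa using h⟩, fun _ _ _ => rfl⟩
  | cons p ps ih =>
    obtain ⟨hp, hp'⟩ := hps p (by simp)
    obtain ⟨d, j, rfl⟩ := mem_hypPos.1 hp'
    obtain ⟨t', h'⟩ := h.minimize_hyp hF hp t₀ rfl
    obtain ⟨⟨t₂, h₂⟩, hV⟩ := ih (nd := nd.minimizeAt t₀ (.hyp d j)) h'
      fun q hq => hps q (List.mem_cons_of_mem _ hq)
    refine ⟨⟨t₂, ?_⟩, fun d' j' hA => ?_⟩
    · have e : A ∪ {q | q ∈ Pos.hyp d j :: ps} = insert (Pos.hyp d j) A ∪ {q | q ∈ ps} := by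
        ext q
        simp only [Set.mem_union, Set.mem_ofPred_eq, List.mem_cons, Set.mem_insert_iff]
        tauto
      rw [e]
      exact h₂
    · rw [List.foldl_cons, hV d' j' (Or.inr hA)]
      exact h.fixV _ (minimizer_spec _ _ _).1 d' j' hA

theorem _root_.SubspaceCanon.Equivalent.foldl_hyp (hF : ∀ μ : F, μ ≠ 0 → 0 < μ ∧ 1 ≤ μ)
    {ps : List (Pos Sh)} {A : Set (Pos Sh)} {t u : ℕ} (hI : Inv nd.P A t u nd.inn nd.x)
    (hps : ∀ p ∈ ps, p ∈ fixed nd.P ∧ p ∈ Sh.hypPos) (t₀ : ℕ) (h : Equivalent α σ nd nd') :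
    Equivalent α σ (ps.foldl (Node.minimizeAt t₀) nd) (ps.foldl (Node.minimizeAt t₀) nd') := by
  induction ps generalizing nd nd' A t with
  | nil => exact h
  | cons p ps ih =>
    obtain ⟨hp, hp'⟩ := hps p (by simp)
    obtain ⟨d, j, rfl⟩ := mem_hypPos.1 hp'
    obtain ⟨t', h'⟩ := hI.minimize_hyp hF hp t₀ rfl
    exact ih (nd := nd.minimizeAt t₀ (.hyp d j)) h'
      (fun q hq => hps q (List.mem_cons_of_mem _ hq))
      (h.minimizeAt hI.normal hp (isLocal_entry_hyp _ _ _ _))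

theorem _root_.SubspaceCanon.SameData.foldl_hyp (hF : ∀ μ : F, μ ≠ 0 → 0 < μ ∧ 1 ≤ μ)
    {ps : List (Pos Sh)} {A : Set (Pos Sh)} {t u t' u' : ℕ} (hI : Inv nd.P A t u nd.inn nd.x)
    (hI' : Inv nd'.P A t' u' nd'.inn nd'.x)
    (hps : ∀ p ∈ ps, p ∈ fixed nd.P ∧ p ∈ Sh.hypPos) (t₀ : ℕ)
    (h : SameData t₀ {p | p ∈ A ∧ p ∈ Sh.hypPos} nd nd') {L : List (Value F Y)}
    (hL : (ps.foldl (Node.minimizeAt t₀) nd).trace <+: L)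
    (hL' : (ps.foldl (Node.minimizeAt t₀) nd').trace <+: L) :
    SameData t₀ {p | p ∈ A ∪ {p | p ∈ ps} ∧ p ∈ Sh.hypPos}
      (ps.foldl (Node.minimizeAt t₀) nd) (ps.foldl (Node.minimizeAt t₀) nd') := by
  induction ps generalizing nd nd' A t t' with
  | nil => simpa using h
  | cons p ps ih =>
    obtain ⟨hp, hp'⟩ := hps p (by simp)
    obtain ⟨d, j, rfl⟩ := mem_hypPos.1 hp'
    obtain ⟨t₁, h₁⟩ := hI.minimize_hyp hF hp t₀ rfl
    have hp₂ : Pos.hyp d j ∈ fixed nd'.P := by rw [h.P_eq]; exact hp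
    obtain ⟨t₁', h₁'⟩ := hI'.minimize_hyp hF hp₂ t₀ rfl
    obtain ⟨hs, he⟩ := h.minimizeAt (hI.fixEntries_hyp t₀) (hI'.fixEntries_hyp t₀)
      (isLocal_entry_hyp _ _ d j) ((foldl_minimizeAt_trace_prefix _ _ _).trans hL)
      ((foldl_minimizeAt_trace_prefix _ _ _).trans hL')
    have := ih (nd := nd.minimizeAt t₀ (.hyp d j)) (nd' := nd'.minimizeAt t₀ (.hyp d j)) h₁ h₁'
      (fun q hq => hps q (List.mem_cons_of_mem _ hq)) ?_ hL hL'
    · refine this.mono ?_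
      rintro q ⟨hq, hq'⟩
      refine ⟨?_, hq'⟩
      rcases hq with hq | hq
      · exact Or.inl (Or.inr hq)
      · rcases List.mem_cons.1 hq with rfl | hq
        · exact Or.inl (Or.inl rfl)
        · exact Or.inr hq
    · refine { hs with entry_eq := ?_ }
      rintro q ⟨rfl | hq, hq'⟩
      · exact he
      · exact hs.entry_eq q ⟨hq, hq'⟩

/-! #### Minimization of generator matrices -/

theorem inv_foldl_sub {ps : List (Pos Sh)} {A S : Set (Pos Sh)} {t : ℕ}
    (h : Inv nd.P A t t nd.inn nd.x) (hS : FixEntries t nd.inn nd.x S)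
    (hps : ∀ p ∈ ps, p ∈ fixed nd.P ∧ p ∈ Sh.subPos) :
    Inv nd.P A t t (ps.foldl (Node.minimizeAt t) nd).inn (ps.foldl (Node.minimizeAt t) nd).x ∧
    FixEntries t (ps.foldl (Node.minimizeAt t) nd).inn (ps.foldl (Node.minimizeAt t) nd).x
      (S ∪ {p | p ∈ ps}) := by
  induction ps generalizing nd S with
  | nil => exact ⟨h, by simpa using hS⟩
  | cons p ps ih =>
    obtain ⟨hp, hp'⟩ := hps p (by simp)
    obtain ⟨d, j, rfl⟩ := mem_subPos.1 hp'
    obtain ⟨h', hS'⟩ := h.minimize_sub hS hp rfl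
    obtain ⟨h₂, h₃⟩ := ih (nd := nd.minimizeAt t (.sub d j)) h' hS'
      fun q hq => hps q (List.mem_cons_of_mem _ hq)
    refine ⟨h₂, ?_⟩
    have e : S ∪ {q | q ∈ Pos.sub d j :: ps} = insert (Pos.sub d j) S ∪ {q | q ∈ ps} := by
      ext q
      simp only [Set.mem_union, Set.mem_ofPred_eq, List.mem_cons, Set.mem_insert_iff]
      tauto
    rw [e]
    exact h₃

theorem _root_.SubspaceCanon.Equivalent.foldl_sub
    {ps : List (Pos Sh)} {A : Set (Pos Sh)} {t : ℕ} (hI : Inv nd.P A t t nd.inn nd.x)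
    (hps : ∀ p ∈ ps, p ∈ fixed nd.P ∧ p ∈ Sh.subPos) (h : Equivalent α σ nd nd') :
    Equivalent α σ (ps.foldl (Node.minimizeAt t) nd) (ps.foldl (Node.minimizeAt t) nd') := by
  induction ps generalizing nd nd' with
  | nil => exact h
  | cons p ps ih =>
    obtain ⟨hp, hp'⟩ := hps p (by simp)
    obtain ⟨d, j, rfl⟩ := mem_subPos.1 hp'
    obtain ⟨h', -⟩ := hI.minimize_sub (hI.fixEntries_hyp t) hp rfl
    exact ih (nd := nd.minimizeAt t (.sub d j)) h'
      (fun q hq => hps q (List.mem_cons_of_mem _ hq))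
      (h.minimizeAt hI.normal hp (isLocal_entry_sub hI.lowerTo _ _))

theorem _root_.SubspaceCanon.SameData.foldl_sub
    {ps : List (Pos Sh)} {A S : Set (Pos Sh)} {t : ℕ} (hI : Inv nd.P A t t nd.inn nd.x)
    (hI' : Inv nd'.P A t t nd'.inn nd'.x) (hS : FixEntries t nd.inn nd.x S)
    (hS' : FixEntries t nd'.inn nd'.x S)
    (hps : ∀ p ∈ ps, p ∈ fixed nd.P ∧ p ∈ Sh.subPos)
    (h : SameData t S nd nd') {L : List (Value F Y)}
    (hL : (ps.foldl (Node.minimizeAt t) nd).trace <+: L)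
    (hL' : (ps.foldl (Node.minimizeAt t) nd').trace <+: L) :
    SameData t (S ∪ {p | p ∈ ps})
      (ps.foldl (Node.minimizeAt t) nd) (ps.foldl (Node.minimizeAt t) nd') := by
  induction ps generalizing nd nd' S with
  | nil => simpa using h
  | cons p ps ih =>
    obtain ⟨hp, hp'⟩ := hps p (by simp)
    obtain ⟨d, j, rfl⟩ := mem_subPos.1 hp'
    obtain ⟨h₁, hS₁⟩ := hI.minimize_sub hS hp rfl
    have hp₂ : Pos.sub d j ∈ fixed nd'.P := by rw [h.P_eq]; exact hp
    obtain ⟨h₁', hS₁'⟩ := hI'.minimize_sub hS' hp₂ rfl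
    obtain ⟨hs, he⟩ := h.minimizeAt hS hS' (isLocal_entry_sub hI.lowerTo d j)
      ((foldl_minimizeAt_trace_prefix _ _ _).trans hL)
      ((foldl_minimizeAt_trace_prefix _ _ _).trans hL')
    have := ih (nd := nd.minimizeAt t (.sub d j)) (nd' := nd'.minimizeAt t (.sub d j)) h₁ h₁'
      hS₁ hS₁' (fun q hq => hps q (List.mem_cons_of_mem _ hq)) ?_ hL hL'
    · refine this.mono ?_
      rintro q (hq | hq)
      · exact Or.inl (Or.inr hq)
      · rcases List.mem_cons.1 hq with rfl | hq
        · exact Or.inl (Or.inl rfl)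
        · exact Or.inr hq
    · refine { hs with entry_eq := ?_ }
      rintro q (rfl | hq)
      · exact he
      · exact hs.entry_eq q hq

end Node

namespace Node

/-! #### The inner minimization -/

section Def

variable [LinearOrder F]

open Classical in
/-- Minimization of the newly fixed normal vectors. -/
def minimizeNormals (old : Set (Pos Sh)) (nd : Node F k Sh Y) : Node F k Sh Y :=
  (Sh.hypPos.filter (fun p => p ∈ fixed nd.P ∧ p ∉ old)).foldl (minimizeAt k) nd

open Classical in
/-- Reduction to echelon form if the rank of the fixed normal vectors has increased. -/
def reduceEchelon (old : Set (Pos Sh)) (nd : Node F k Sh Y) : Node F k Sh Y :=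
  let t := rankOf (fixed nd.P) nd.x
  if rankOf old nd.x < t then echelonize t (refineByLabel t nd) else nd

open Classical in
/-- Minimization of the fixed generator matrices. -/
def minimizeSubspaces (t : ℕ) (nd : Node F k Sh Y) : Node F k Sh Y :=
  (Sh.subPos.filter (fun p => p ∈ fixed nd.P)).foldl (minimizeAt t) nd

open Classical in
/-- The node computed by the inner minimization. -/
def minimized (old : Set (Pos Sh)) (nd : Node F k Sh Y) : Node F k Sh Y :=
  if fixed nd.P = old then nd
  else minimizeSubspaces (rankOf (fixed (minimizeNormals old nd).P) (minimizeNormals old nd).x)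
    (reduceEchelon old (minimizeNormals old nd))

theorem echelonize_eq (t : ℕ) (nd : Node F k Sh Y) : nd.echelonize t =
    { P := nd.P
      perm := nd.perm
      x := echelonizer t nd.inn nd.x • nd.x
      inn := nd.inn ⊓ echelonStab t (echelonizer t nd.inn nd.x • nd.x)
      acc := toGammaL (echelonizer t nd.inn nd.x) * nd.acc
      trace := nd.trace } := rfl

theorem minimizeNormals_P (old : Set (Pos Sh)) (nd : Node F k Sh Y) :
    (minimizeNormals old nd).P = nd.P := foldl_minimizeAt_P _ _ _

theorem minimizeSubspaces_P (t : ℕ) (nd : Node F k Sh Y) :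
    (minimizeSubspaces t nd).P = nd.P := foldl_minimizeAt_P _ _ _

theorem reduceEchelon_trace_prefix (old : Set (Pos Sh)) (nd : Node F k Sh Y) :
    nd.trace <+: (reduceEchelon old nd).trace := by
  rw [reduceEchelon]
  split_ifs
  · rw [echelonize_eq, refineByLabel_eq]
    exact List.prefix_append _ _
  · exact List.prefix_rfl

theorem minimized_trace_prefix (old : Set (Pos Sh)) (nd : Node F k Sh Y) :
    nd.trace <+: (minimized old nd).trace := by
  rw [minimized]
  split_ifs
  · exact List.prefix_rfl
  · exact (foldl_minimizeAt_trace_prefix _ _ _).trans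
      ((reduceEchelon_trace_prefix _ _).trans (foldl_minimizeAt_trace_prefix _ _ _))

theorem compare_nil [LinearOrder Y] (st : Global F k Sh Y) (pos : ℕ) :
    st.compare pos [] = (true, st) := by
  rw [Global.compare]
  split <;> simp

/-- The global variables affect the flag and the candidate, never the computed node. This separation
makes an unpruned tree available for comparison. -/
theorem innerMinimization_eq [LinearOrder Y] (old : Set (Pos Sh)) (nd : Node F k Sh Y)
    (st : Global F k Sh Y) : nd.innerMinimization old st =
      ((st.compare nd.trace.length ((minimized old nd).trace.drop nd.trace.length)).1,
        minimized old nd,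
        (st.compare nd.trace.length ((minimized old nd).trace.drop nd.trace.length)).2) := by
  rw [innerMinimization, minimized]
  split_ifs
  · rw [List.drop_length, compare_nil]
  · rfl

end Def

variable [LinearOrder F]

/-- All hyperplanes have the same label, so the splitting creates no new fixed normal vectors and
the rank `t` remains valid. -/
theorem fixed_splitBy_label {P : Setoid (Pos Sh)} (hP : P ≤ Sh.initialPartition) (t : ℕ)
    (x : Obj F k Sh) (d : Fin Sh.nH) (j : Fin (Sh.h d)) :
    Pos.hyp d j ∈ fixed P ↔ Pos.hyp d j ∈ fixed (splitBy P (label t x)) := by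
  refine ⟨fun h => fixed_anti (splitBy_le P _) h, fun h q hq => h q ⟨hq, ?_⟩⟩
  have := hP hq
  cases q with
  | sub c i => exact this.elim
  | hyp d' j' => rfl

theorem mem_filter_new {P : Setoid (Pos Sh)} {old : Set (Pos Sh)}
    [DecidablePred fun p => p ∈ fixed P ∧ p ∉ old] (p : Pos Sh)
    (hp : p ∈ Sh.hypPos.filter (fun p => p ∈ fixed P ∧ p ∉ old)) :
    p ∈ fixed P ∧ p ∈ Sh.hypPos := by
  rw [List.mem_filter, decide_eq_true_eq] at hp
  exact ⟨hp.2.1, hp.1⟩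

theorem mem_filter_fixed {P : Setoid (Pos Sh)} [DecidablePred fun p => p ∈ fixed P] (p : Pos Sh)
    (hp : p ∈ Sh.subPos.filter (fun p => p ∈ fixed P)) :
    p ∈ fixed P ∧ p ∈ Sh.subPos := by
  rw [List.mem_filter, decide_eq_true_eq] at hp
  exact ⟨hp.2, hp.1⟩

theorem hyp_mem_union_iff {P : Setoid (Pos Sh)} {old : Set (Pos Sh)} (hold : old ⊆ fixed P)
    [DecidablePred fun p => p ∈ fixed P ∧ p ∉ old] (d : Fin Sh.nH) (j : Fin (Sh.h d)) :
    Pos.hyp d j ∈ old ∪ {p | p ∈ Sh.hypPos.filter (fun p => p ∈ fixed P ∧ p ∉ old)} ↔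
      Pos.hyp d j ∈ fixed P := by
  rw [Set.mem_union, Set.mem_ofPred_eq, List.mem_filter, decide_eq_true_eq]
  constructor
  · rintro (h | h)
    · exact hold h
    · exact h.2.1
  · intro h
    by_cases ho : Pos.hyp d j ∈ old
    · exact Or.inl ho
    · exact Or.inr ⟨mem_hypPos.2 ⟨d, j, rfl⟩, h, ho⟩

variable [Finite F] {nd nd' : Node F k Sh Y} {α σ : Sh.Sym} {old : Set (Pos Sh)}

theorem inv_minimizeNormals (hF : ∀ μ : F, μ ≠ 0 → 0 < μ ∧ 1 ≤ μ) {t u : ℕ}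
    (h : Inv nd.P old t u nd.inn nd.x) :
    (∃ t', Inv (minimizeNormals old nd).P (fixed (minimizeNormals old nd).P) t' u
      (minimizeNormals old nd).inn (minimizeNormals old nd).x) ∧
    rankOf old (minimizeNormals old nd).x = t := by
  classical
  obtain ⟨⟨t', h'⟩, hV⟩ := inv_foldl_hyp hF h
    (ps := Sh.hypPos.filter (fun p => p ∈ fixed nd.P ∧ p ∉ old)) mem_filter_new k
  rw [minimizeNormals_P]
  refine ⟨⟨t', ?_⟩, ?_⟩
  · exact h'.congr subset_rfl (hyp_mem_union_iff h.fixed_sub)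
  · rw [← h.rankOf]
    exact rankOf_congr hV

theorem inv_refineByLabel {A : Set (Pos Sh)} {t u : ℕ} (h : Inv nd.P A t u nd.inn nd.x) :
    Inv (refineByLabel t nd).P A t u (refineByLabel t nd).inn (refineByLabel t nd).x := by
  rw [refineByLabel_eq]
  exact (h.perm (sortPerm_spec h.le_initial _ fun _ _ => rfl).1).mono_partition (splitBy_le _ _)

theorem label_refineByLabel {t : ℕ} (p q : Pos Sh) (h : (refineByLabel t nd).P p q) :
    label t (refineByLabel t nd).x p = label t (refineByLabel t nd).x q := by
  rw [refineByLabel_eq] at h ⊢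
  exact h.2

theorem inv_reduceEchelon {t u : ℕ} (h : Inv nd.P (fixed nd.P) t u nd.inn nd.x)
    (hu : rankOf old nd.x = u) :
    Inv (reduceEchelon old nd).P (fixed (reduceEchelon old nd).P) t t (reduceEchelon old nd).inn
      (reduceEchelon old nd).x := by
  rw [reduceEchelon]
  rw [h.rankOf, hu]
  split_ifs with htu
  · have h1 := (inv_refineByLabel h).echelonize label_refineByLabel rfl
    refine h1.congr subset_rfl fun d j => ?_
    rw [echelonize_eq, refineByLabel_eq]
    exact fixed_splitBy_label h.le_initial _ _ d j
  -- If the rank has not increased, all `t` rows are already in echelon form.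
  · obtain rfl : u = t := le_antisymm h.u_le (not_lt.1 htu)
    exact h

theorem wellFormed_minimizeSubspaces {t : ℕ}
    (h : Inv nd.P (fixed nd.P) t t nd.inn nd.x) :
    WellFormed (fixed (minimizeSubspaces t nd).P) (minimizeSubspaces t nd) := by
  classical
  obtain ⟨h1, h2⟩ := inv_foldl_sub h (h.fixEntries_hyp t)
    (ps := Sh.subPos.filter (fun p => p ∈ fixed nd.P)) mem_filter_fixed
  rw [minimizeSubspaces_P]
  refine ⟨t, ?_, ?_⟩
  · rw [minimizeSubspaces_P]; exact h1
  · intro g hg p hp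
    refine h2 g hg p ?_
    cases p with
    | hyp d j => exact Or.inl ⟨hp, mem_hypPos.2 ⟨d, j, rfl⟩⟩
    | sub c i =>
      refine Or.inr ?_
      rw [Set.mem_ofPred_eq, List.mem_filter, decide_eq_true_eq]
      exact ⟨mem_subPos.2 ⟨c, i, rfl⟩, hp⟩

theorem wellFormed_minimized (hF : ∀ μ : F, μ ≠ 0 → 0 < μ ∧ 1 ≤ μ) (h : WellFormed old nd) :
    WellFormed (fixed (minimized old nd).P) (minimized old nd) := by
  rw [minimized]
  split_ifs with heq
  · rw [heq]; exact h
  · obtain ⟨t, hI, -⟩ := h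
    obtain ⟨⟨t', h'⟩, hr⟩ := inv_minimizeNormals hF hI
    rw [h'.rankOf]
    exact wellFormed_minimizeSubspaces (inv_reduceEchelon h' hr)

/-! #### Corresponding nodes -/

theorem _root_.SubspaceCanon.Equivalent.V_eq {A : Set (Pos Sh)} {t u : ℕ}
    (h : Equivalent α σ nd nd') (hI : Inv nd.P A t u nd.inn nd.x) {d j} (hA : Pos.hyp d j ∈ A) :
    nd'.x.V d j = nd.x.V d j := by
  obtain ⟨g, hg, hx⟩ := h.x_eq
  rw [hx, (hI.perm h.mem).fixV g hg d j hA, hI.fixed_hyp h.mem hA]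

theorem _root_.SubspaceCanon.Equivalent.inv {A : Set (Pos Sh)} {t u : ℕ}
    (h : Equivalent α σ nd nd') (hI : Inv nd.P A t u nd.inn nd.x) :
    Inv nd'.P A t u nd'.inn nd'.x := by
  obtain ⟨g, hg, hx⟩ := h.x_eq
  rw [h.P_eq, h.inn_eq, hx]
  exact (hI.perm h.mem).smul hg

/-- The connecting permutation becomes `s' σ s⁻¹` with the two sorting permutations. It carries one
sorted label function to the other; as these are equal by `eq_of_sorted`, it preserves the split
partition. -/
theorem _root_.SubspaceCanon.Equivalent.refineByLabel {A : Set (Pos Sh)} {t u : ℕ}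
    (h : Equivalent α σ nd nd') (hI : Inv nd.P A t u nd.inn nd.x) :
    ∃ ρ, Equivalent α ρ (nd.refineByLabel t) (nd'.refineByLabel t) ∧
      label t (nd'.refineByLabel t).x = label t (nd.refineByLabel t).x := by
  obtain ⟨h1, h2, h3, hσ, ⟨g, hg, hx⟩, hπ⟩ := h
  obtain ⟨hs, -, hsort⟩ := sortPerm_spec hI.le_initial (label t nd.x) fun _ _ => rfl
  obtain ⟨hs', -, hsort'⟩ := sortPerm_spec hI.le_initial (label t nd'.x) fun _ _ => rfl
  rw [refineByLabel_eq, refineByLabel_eq, h1]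
  set s := sortPerm nd.P (label t nd.x)
  set s' := sortPerm nd.P (label t nd'.x)
  have hρ : s' * σ * s⁻¹ ∈ young nd.P := mul_mem (mul_mem hs' hσ) (inv_mem hs)
  have hx₁ : s' • nd'.x = conj s' g • (s' * σ * s⁻¹) • s • nd.x := by
    rw [hx, perm_inner, mul_smul, inv_smul_smul, mul_smul]
  have hlab : ∀ p, label t (s' • nd'.x) ((s' * σ * s⁻¹) • p) = label t (s • nd.x) p := by
    intro p
    rw [hx₁, label_inner hI.lowerTo (hI.normal s' hs' g hg), label_perm, inv_smul_smul]
  have heq : label t (s • nd.x) = label t (s' • nd'.x) := by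
    refine eq_of_sorted (P := nd.P) ?_ ?_ hρ hlab
    · intro p q hpq hle
      rw [label_perm, label_perm]
      exact hsort p q hpq hle
    · intro p q hpq hle
      rw [label_perm, label_perm]
      exact hsort' p q hpq hle
  refine ⟨s' * σ * s⁻¹, ⟨by rw [heq], h2, by rw [h3, heq], ?_,
    ⟨conj s' g, hI.normal s' hs' g hg, hx₁⟩, ?_⟩, heq.symm⟩
  · rw [mem_young_splitBy]
    refine ⟨hρ, fun p => ?_⟩
    have := hlab p
    rwa [← heq] at this
  · dsimp only
    rw [mul_assoc s', hπ]
    group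

/-- The arbitrary choice in `echelonizer` is harmless: the element connecting two reduced sequences
maps echelon forms to echelon forms, so it lies in the restricted stabilizer. -/
theorem _root_.SubspaceCanon.Equivalent.echelonize {A : Set (Pos Sh)} {t u : ℕ}
    (h : Equivalent α σ nd nd') (hI : Inv nd.P A t u nd.inn nd.x)
    (hl : label t nd'.x = label t nd.x) (hP : ∀ p q, nd.P p q → label t nd.x p = label t nd.x q) :
    Equivalent α σ (nd.echelonize t) (nd'.echelonize t) := by
  have hI' := h.inv hI
  obtain ⟨h1, h2, h3, hσ, ⟨g, hg, hx⟩, hπ⟩ := h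
  obtain ⟨he, hR⟩ := hI.echelonizer_spec
  obtain ⟨he', hR'⟩ := hI'.echelonizer_spec
  rw [echelonize_eq, echelonize_eq]
  obtain ⟨y, hy⟩ : ∃ y, y = echelonizer t nd.inn nd.x • nd.x := ⟨_, rfl⟩
  obtain ⟨y', hy'⟩ : ∃ y, y = echelonizer t nd'.inn nd'.x • nd'.x := ⟨_, rfl⟩
  rw [← hy] at hR ⊢
  rw [← hy'] at hR' ⊢
  set e := echelonizer t nd.inn nd.x
  set e' := echelonizer t nd'.inn nd'.x
  have hIy := hI.smul he
  have hIy' := hI'.smul he'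
  rw [← hy] at hIy
  rw [← hy'] at hIy'
  have hly : label t y = label t nd.x := by
    ext1 p
    rw [hy, label_inner hI.lowerTo he]
  have hly' : label t y' = label t y := by
    ext1 p
    rw [hy', label_inner hI'.lowerTo he', hl, hly]
  have hst : echelonStab t y' = echelonStab t y :=
    echelonStab_congr hIy'.indep hIy.indep hR' hR hly'
  rw [h2] at he'
  have hmem : e' * g * conj σ e⁻¹ ∈ nd.inn := mul_mem (mul_mem he' hg) (hI.normal σ hσ _ (inv_mem he))
  have hx₁ : y' = (e' * g * conj σ e⁻¹) • σ • y := by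
    rw [hy, mul_smul, ← perm_inner, inv_smul_smul, mul_smul, ← hx, hy']
  refine ⟨h1, by dsimp only; rw [h2, hst], h3, hσ, ⟨_, ⟨hmem, fun c i => ?_⟩, hx₁⟩, hπ⟩
  have hRσ : ∀ c i, IsRCEF (topRows t ((σ • y).U c i)) := fun c i => hR c _
  have := ((hIy.perm hσ).lowerTo _ hmem).mem_diagGL (hRσ c i) (by rw [← hx₁]; exact hR' c i)
  rwa [rank_eq_of_label_eq (hIy.perm hσ).indep hIy.indep (hRσ c i) (hR c i)] at this
  rw [label_perm, hly]
  exact hP _ _ ((young nd.P).inv_mem hσ _)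

theorem _root_.SubspaceCanon.Equivalent.rankOf_eq {A : Set (Pos Sh)} {t u : ℕ}
    (h : Equivalent α σ nd nd') (hI : Inv nd.P A t u nd.inn nd.x) {B : Set (Pos Sh)} (hB : B ⊆ A) :
    rankOf B nd'.x = rankOf B nd.x :=
  rankOf_congr fun _ _ hd => h.V_eq hI (hB hd)

theorem _root_.SubspaceCanon.Equivalent.reduceEchelon {t u : ℕ} (h : Equivalent α σ nd nd')
    (hI : Inv nd.P (fixed nd.P) t u nd.inn nd.x) (hold : old ⊆ fixed nd.P) :
    ∃ ρ, Equivalent α ρ (nd.reduceEchelon old) (nd'.reduceEchelon old) := by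
  have h1 := h.rankOf_eq hI hold
  have h2 := h.rankOf_eq hI subset_rfl
  rw [Node.reduceEchelon, Node.reduceEchelon, h1, h.P_eq, h2, hI.rankOf]
  split_ifs
  · obtain ⟨ρ, hρ, hl⟩ := h.refineByLabel hI
    exact ⟨ρ, hρ.echelonize (inv_refineByLabel hI) hl label_refineByLabel⟩
  · exact ⟨σ, h⟩

theorem _root_.SubspaceCanon.Equivalent.minimizeNormals (hF : ∀ μ : F, μ ≠ 0 → 0 < μ ∧ 1 ≤ μ)
    {t u : ℕ} (h : Equivalent α σ nd nd') (hI : Inv nd.P old t u nd.inn nd.x) :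
    Equivalent α σ (nd.minimizeNormals old) (nd'.minimizeNormals old) := by
  rw [Node.minimizeNormals, Node.minimizeNormals, h.P_eq]
  classical
  exact h.foldl_hyp hF hI mem_filter_new k

theorem _root_.SubspaceCanon.Equivalent.minimizeSubspaces
    {t : ℕ} {A : Set (Pos Sh)} (h : Equivalent α σ nd nd') (hI : Inv nd.P A t t nd.inn nd.x) :
    Equivalent α σ (nd.minimizeSubspaces t) (nd'.minimizeSubspaces t) := by
  rw [Node.minimizeSubspaces, Node.minimizeSubspaces, h.P_eq]
  classical
  exact h.foldl_sub hI mem_filter_fixed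

theorem _root_.SubspaceCanon.Equivalent.minimized (hF : ∀ μ : F, μ ≠ 0 → 0 < μ ∧ 1 ≤ μ)
    (h : Equivalent α σ nd nd') (hw : WellFormed old nd) :
    ∃ ρ, Equivalent α ρ (nd.minimized old) (nd'.minimized old) := by
  rw [Node.minimized, Node.minimized, h.P_eq]
  split_ifs
  · exact ⟨σ, h⟩
  · obtain ⟨t, hI, -⟩ := hw
    obtain ⟨⟨t', h'⟩, hr⟩ := inv_minimizeNormals hF hI
    have h1 := h.minimizeNormals hF hI
    have h2 := h1.rankOf_eq h' subset_rfl
    obtain ⟨ρ, hρ⟩ := h1.reduceEchelon (old := old) h' (by rw [minimizeNormals_P]; exact hI.fixed_sub)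
    refine ⟨ρ, ?_⟩
    rw [h1.P_eq, h2, h'.rankOf]
    exact hρ.minimizeSubspaces (inv_reduceEchelon h' hr)

/-! #### Nodes with the same data -/

/-- Normal vectors are never truncated, so the number of rows is irrelevant for them. -/
theorem entry_hyp_level {t t' : ℕ} {A : Set (Pos Sh)}
    (h : SameData t {p | p ∈ A ∧ p ∈ Sh.hypPos} nd nd') :
    SameData t' {p | p ∈ A ∧ p ∈ Sh.hypPos} nd nd' :=
  { h with
    entry_eq := by
      rintro p ⟨hp, hp'⟩
      have := h.entry_eq p ⟨hp, hp'⟩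
      obtain ⟨d, j, rfl⟩ := mem_hypPos.1 hp'
      exact this }

theorem _root_.SubspaceCanon.SameData.V_eq {t : ℕ} {A : Set (Pos Sh)}
    (h : SameData t {p | p ∈ A ∧ p ∈ Sh.hypPos} nd nd') {d j} (hd : Pos.hyp d j ∈ A) :
    nd'.x.V d j = nd.x.V d j :=
  vecList_injective (h.entry_eq _ ⟨hd, mem_hypPos.2 ⟨d, j, rfl⟩⟩)

theorem _root_.SubspaceCanon.SameData.rankOf_eq {t : ℕ} {A B : Set (Pos Sh)}
    (h : SameData t {p | p ∈ A ∧ p ∈ Sh.hypPos} nd nd') (hB : B ⊆ A) :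
    rankOf B nd'.x = rankOf B nd.x :=
  rankOf_congr fun _ _ hd => h.V_eq (hB hd)

/-- The recorded labels determine both the splitting and the ranks that define the new stabilizer.
Agreement is claimed only for normal vectors: a column reduction with more rows alters the fixed
generator matrices, which are minimized again afterwards. -/
theorem _root_.SubspaceCanon.SameData.reduceEchelon {t t' u u' : ℕ}
    (h : SameData k {p | p ∈ fixed nd.P ∧ p ∈ Sh.hypPos} nd nd')
    (hI : Inv nd.P (fixed nd.P) t u nd.inn nd.x)
    (hI' : Inv nd'.P (fixed nd'.P) t' u' nd'.inn nd'.x) (hold : old ⊆ fixed nd.P)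
    {L : List (Value F Y)} (hL : (nd.reduceEchelon old).trace <+: L)
    (hL' : (nd'.reduceEchelon old).trace <+: L) :
    SameData t {p | p ∈ fixed (nd.reduceEchelon old).P ∧ p ∈ Sh.hypPos}
      (nd.reduceEchelon old) (nd'.reduceEchelon old) := by
  have h1 := h.rankOf_eq hold
  have h2 := h.rankOf_eq subset_rfl
  have ht : t' = t := by rw [← hI.rankOf, ← hI'.rankOf, h.P_eq, h2]
  subst ht
  rw [Node.reduceEchelon] at hL hL' ⊢
  rw [Node.reduceEchelon]
  rw [h1, h.P_eq, h2] at hL'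
  rw [h1, h.P_eq, h2]
  rw [hI.rankOf] at hL hL' ⊢
  split_ifs at hL hL' ⊢
  · have hJ := inv_refineByLabel (t := t') hI
    have hJ' := inv_refineByLabel (t := t') hI'
    have hE := hJ.echelonize label_refineByLabel rfl
    have hE' := hJ'.echelonize label_refineByLabel rfl
    have hR := hJ.echelonizer_spec
    have hR' := hJ'.echelonizer_spec
    have hl : label t' (nd'.refineByLabel t').x = label t' (nd.refineByLabel t').x := by
      rw [echelonize_eq, refineByLabel_eq] at hL hL'
      rw [refineByLabel_eq, refineByLabel_eq]
      dsimp only at hL hL' ⊢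
      rw [h.trace_eq] at hL'
      have := append_prefix_inj hL' hL (by simp)
      rw [List.map_inj_left] at this
      ext1 p
      cases p with
      | hyp d j => rfl
      | sub c i => exact Sum.inl.inj (toLex.injective (this _ (mem_subPos.2 ⟨c, i, rfl⟩)))
    have hst := echelonStab_congr hE'.indep hE.indep hR'.2 hR.2 (by
      ext1 p
      rw [label_inner hJ.lowerTo hR.1, label_inner hJ'.lowerTo hR'.1, hl])
    have hinn : (nd'.refineByLabel t').inn = (nd.refineByLabel t').inn := by
      rw [refineByLabel_eq, refineByLabel_eq]; exact h.inn_eq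
    have htr : (nd'.refineByLabel t').trace = (nd.refineByLabel t').trace := by
      have hl₁ := hl
      rw [refineByLabel_eq, refineByLabel_eq] at hl₁ ⊢
      dsimp only at hl₁ ⊢
      rw [hl₁, h.trace_eq]
    have hP : (nd'.refineByLabel t').P = (nd.refineByLabel t').P := by
      have hl₁ := hl
      rw [refineByLabel_eq, refineByLabel_eq] at hl₁ ⊢
      dsimp only at hl₁ ⊢
      rw [hl₁, h.P_eq]
    refine ⟨hP, ?_, htr, ?_⟩
    · rw [echelonize_eq, echelonize_eq]
      dsimp only
      rw [hinn]
      rw [hinn] at hst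
      rw [hst]
    · rintro p ⟨hp, hp'⟩
      obtain ⟨d, j, rfl⟩ := mem_hypPos.1 hp'
      have hp₀ : Pos.hyp d j ∈ fixed nd.P := by
        rw [echelonize_eq, refineByLabel_eq] at hp
        exact (fixed_splitBy_label hI.le_initial _ _ d j).2 hp
      have hp₀' : Pos.hyp d j ∈ fixed nd'.P := by rwa [h.P_eq]
      refine congrArg vecList ?_
      have e1 : (nd.refineByLabel t').x.V d j = nd.x.V d j := by
        rw [refineByLabel_eq]
        exact hI.fixed_hyp (sortPerm_spec hI.le_initial _ fun _ _ => rfl).1 hp₀ _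
      have e1' : (nd'.refineByLabel t').x.V d j = nd'.x.V d j := by
        rw [refineByLabel_eq]
        exact hI'.fixed_hyp (sortPerm_spec hI'.le_initial _ fun _ _ => rfl).1 hp₀' _
      rw [echelonize_eq, echelonize_eq]
      dsimp only
      rw [hJ.fixV _ hR.1 d j hp₀, hJ'.fixV _ hR'.1 d j hp₀', e1, e1']
      exact h.V_eq hp₀
  · exact entry_hyp_level h

/-- Minimizing all fixed generator matrices, and not only the new ones, is what restores agreement
for the increased number of rows. -/
theorem _root_.SubspaceCanon.SameData.minimized (hF : ∀ μ : F, μ ≠ 0 → 0 < μ ∧ 1 ≤ μ) {t t' : ℕ}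
    (h : SameData t old nd nd')
    (hI : Inv nd.P old t t nd.inn nd.x) (hI' : Inv nd'.P old t' t' nd'.inn nd'.x)
    {L : List (Value F Y)} (hL : (nd.minimized old).trace <+: L)
    (hL' : (nd'.minimized old).trace <+: L) :
    SameData (rankOf (fixed (nd.minimized old).P) (nd.minimized old).x)
      (fixed (nd.minimized old).P) (nd.minimized old) (nd'.minimized old) := by
  classical
  rw [Node.minimized] at hL hL' ⊢
  rw [Node.minimized]
  rw [h.P_eq] at hL' ⊢
  split_ifs at hL hL' ⊢ with heq
  · rw [heq, hI.rankOf]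
    exact h
  obtain ⟨⟨t₁, h₁⟩, hr₁⟩ := inv_minimizeNormals hF hI
  obtain ⟨⟨t₁', h₁'⟩, hr₁'⟩ := inv_minimizeNormals hF hI'
  have hps : ∀ p ∈ Sh.hypPos.filter (fun p => p ∈ fixed nd.P ∧ p ∉ old),
      p ∈ fixed nd.P ∧ p ∈ Sh.hypPos := mem_filter_new
  have hLR := (foldl_minimizeAt_trace_prefix _ _ _).trans hL
  have hLR' := (foldl_minimizeAt_trace_prefix _ _ _).trans hL'
  have hLN := (reduceEchelon_trace_prefix old _).trans hLR
  have hLN' := (reduceEchelon_trace_prefix old _).trans hLR'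
  have hs₁ : SameData k {p | p ∈ fixed (nd.minimizeNormals old).P ∧ p ∈ Sh.hypPos}
      (nd.minimizeNormals old) (nd'.minimizeNormals old) := by
    rw [minimizeNormals_P]
    rw [Node.minimizeNormals] at hLN hLN' ⊢
    rw [Node.minimizeNormals]
    rw [h.P_eq] at hLN' ⊢
    refine (SameData.foldl_hyp hF hI hI' hps k
      (entry_hyp_level (t := t) (h.mono fun p hp => hp.1)) hLN hLN').mono ?_
    rintro p ⟨hp, hp'⟩
    refine ⟨?_, hp'⟩
    obtain ⟨d, j, rfl⟩ := mem_hypPos.1 hp'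
    exact (hyp_mem_union_iff hI.fixed_sub d j).2 hp
  have htt : rankOf (fixed (nd'.minimizeNormals old).P) (nd'.minimizeNormals old).x = t₁ := by
    rw [hs₁.P_eq, hs₁.rankOf_eq subset_rfl, h₁.rankOf]
  rw [htt] at hL' ⊢
  rw [h₁.rankOf] at hL ⊢
  have hs₂ := hs₁.reduceEchelon h₁ h₁' (old := old)
    (by rw [minimizeNormals_P]; exact hI.fixed_sub) hLR hLR'
  have h₂ := inv_reduceEchelon h₁ hr₁
  have h₂' := inv_reduceEchelon h₁' hr₁'
  obtain rfl : t₁' = t₁ := by rw [← htt, h₁'.rankOf]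
  have hps₂ : ∀ p ∈ Sh.subPos.filter (fun p => p ∈ fixed ((nd.minimizeNormals old).reduceEchelon old).P),
      p ∈ fixed ((nd.minimizeNormals old).reduceEchelon old).P ∧ p ∈ Sh.subPos := mem_filter_fixed
  obtain ⟨h₃, -⟩ := inv_foldl_sub h₂ (h₂.fixEntries_hyp _) hps₂
  rw [Node.minimizeSubspaces] at hL hL' ⊢
  rw [Node.minimizeSubspaces]
  rw [hs₂.P_eq] at hL' ⊢
  rw [foldl_minimizeAt_P, h₃.rankOf]
  have hf' : FixEntries t₁' ((nd'.minimizeNormals old).reduceEchelon old).inn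
      ((nd'.minimizeNormals old).reduceEchelon old).x
      {p | p ∈ fixed ((nd.minimizeNormals old).reduceEchelon old).P ∧ p ∈ Sh.hypPos} := by
    rw [← hs₂.P_eq]
    exact h₂'.fixEntries_hyp _
  refine (SameData.foldl_sub h₂ (h₂'.congr (by rw [hs₂.P_eq]) fun d j => by rw [hs₂.P_eq]) (h₂.fixEntries_hyp _) hf' hps₂ hs₂ hL hL').mono ?_
  intro p hp
  cases p with
  | hyp d j => exact Or.inl ⟨hp, mem_hypPos.2 ⟨d, j, rfl⟩⟩
  | sub c i =>
    refine Or.inr ?_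
    rw [Set.mem_ofPred_eq, List.mem_filter, decide_eq_true_eq]
    exact ⟨mem_subPos.2 ⟨c, i, rfl⟩, hp⟩

end Node

/-! ### The search tree without pruning -/

/-- `x` is obtained from `y` by the permutation and the transporter of the node. -/
def Reaches (y : Obj F k Sh) (nd : Node F k Sh Y) : Prop :=
  ∃ g : Gsl F k Sh, nd.x = g • nd.perm • y ∧ toGammaL g = nd.acc

/-- Properties of a node `out` which was computed from `nd`. -/
structure Descends (nd out : Node F k Sh Y) : Prop where
  P_le : out.P ≤ nd.P
  perm_eq : ∃ σ ∈ young nd.P, out.perm = σ * nd.perm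
  trace_prefix : nd.trace <+: out.trace
  reaches : ∀ y, Reaches y nd → Reaches y out

theorem Descends.refl (nd : Node F k Sh Y) : Descends nd nd :=
  ⟨le_rfl, ⟨1, one_mem _, (one_mul _).symm⟩, List.prefix_rfl, fun _ h => h⟩

theorem Descends.trans {nd nd₁ nd₂ : Node F k Sh Y} (h : Descends nd nd₁) (h' : Descends nd₁ nd₂) :
    Descends nd nd₂ := by
  refine ⟨h'.P_le.trans h.P_le, ?_, h.trace_prefix.trans h'.trace_prefix,
    fun y hy => h'.reaches y (h.reaches y hy)⟩
  obtain ⟨σ, hσ, e⟩ := h.perm_eq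
  obtain ⟨τ, hτ, e'⟩ := h'.perm_eq
  exact ⟨τ * σ, mul_mem (young_mono h.P_le hτ) hσ, by rw [e', e, mul_assoc]⟩

theorem reaches_of {y : Obj F k Sh} {nd out : Node F k Sh Y} (h : Reaches y nd) (g : Gsl F k Sh)
    (σ : Sh.Sym) (hx : out.x = g • σ • nd.x) (hp : out.perm = σ * nd.perm)
    (ha : out.acc = toGammaL g * nd.acc) : Reaches y out := by
  obtain ⟨g', h1, h2⟩ := h
  refine ⟨g * conj σ g', ?_, ?_⟩
  · rw [hx, hp, h1, mul_smul, mul_smul, perm_inner]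
  · rw [ha, toGammaL_mul, toGammaL_conj, h2]

theorem descends_of {nd out : Node F k Sh Y} (hP : out.P ≤ nd.P) (ht : nd.trace <+: out.trace)
    (g : Gsl F k Sh) (σ : Sh.Sym) (hσ : σ ∈ young nd.P) (hx : out.x = g • σ • nd.x)
    (hp : out.perm = σ * nd.perm) (ha : out.acc = toGammaL g * nd.acc) : Descends nd out :=
  ⟨hP, ⟨σ, hσ, hp⟩, ht, fun _ h => reaches_of h g σ hx hp ha⟩

theorem WellFormed.of_perm {A : Set (Pos Sh)} {nd out : Node F k Sh Y} (h : WellFormed A nd)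
    {σ : Sh.Sym} (hσ : σ ∈ young nd.P) (hP : out.P ≤ nd.P) (hK : out.inn = nd.inn)
    (hx : out.x = σ • nd.x) : WellFormed A out := by
  obtain ⟨t, hI, hf⟩ := h
  refine ⟨t, ?_, ?_⟩
  · rw [hK, hx]
    exact (hI.perm hσ).mono_partition hP
  · rw [hK, hx]
    exact hf.perm hI.normal hI.fixed_sub hσ

theorem WellFormed.le_initial {A : Set (Pos Sh)} {nd : Node F k Sh Y} (h : WellFormed A nd) :
    nd.P ≤ Sh.initialPartition :=
  let ⟨_, hI, _⟩ := h
  hI.le_initial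

/-- Refiners promise invariance and equivariance on semicanonical sequences only; this supplies the
hypothesis at every node. -/
theorem WellFormed.isSemicanonical {nd : Node F k Sh Y} (h : WellFormed (fixed nd.P) nd) :
    IsSemicanonical nd.P nd.inn nd.x := by
  obtain ⟨t, hI, hf⟩ := h
  refine ⟨hI.indep, hI.ne_zero, fun g hg => ?_⟩
  rw [hI.rankOf]
  exact ⟨hf g hg, hI.rcef g hg⟩

theorem young_initialPartition : young Sh.initialPartition = ⊤ := by
  rw [eq_top_iff]
  rintro σ -
  rintro (⟨c, i⟩ | ⟨d, j⟩)
  · exact (rfl : c = c)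
  · exact (rfl : d = d)

namespace Node

section Trace

variable [LinearOrder F]

theorem descends_minimizeAt (t : ℕ) (nd : Node F k Sh Y) (p : Pos Sh) :
    Descends nd (nd.minimizeAt t p) := by
  rw [minimizeAt_eq t nd p rfl rfl rfl]
  exact descends_of le_rfl (List.prefix_append _ _) _ 1 (one_mem _) (by rw [one_smul])
    (one_mul _).symm rfl

theorem descends_foldl_minimizeAt (t : ℕ) (ps : List (Pos Sh)) (nd : Node F k Sh Y) :
    Descends nd (ps.foldl (minimizeAt t) nd) := by
  induction ps generalizing nd with
  | nil => exact .refl _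
  | cons p ps ih => exact (descends_minimizeAt t nd p).trans (ih _)

theorem sortPerm_mem (P : Setoid (Pos Sh)) (l : Pos Sh → List F) : sortPerm P l ∈ young P := by
  rw [sortPerm]
  split_ifs with h
  · exact h.choose_spec.1
  · exact one_mem _

theorem descends_minimized (old : Set (Pos Sh)) (nd : Node F k Sh Y) :
    Descends nd (nd.minimized old) := by
  rw [minimized]
  split_ifs
  · exact .refl _
  · refine Descends.trans (nd₁ := minimizeNormals old nd) (descends_foldl_minimizeAt _ _ _)
      (.trans ?_ (descends_foldl_minimizeAt _ _ _))
    rw [reduceEchelon]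
    split_ifs
    · refine Descends.trans (nd₁ := refineByLabel (rankOf (fixed (minimizeNormals old nd).P)
        (minimizeNormals old nd).x) (minimizeNormals old nd)) ?_ ?_
      · rw [refineByLabel_eq]
        exact descends_of (splitBy_le _ _) (List.prefix_append _ _) 1 _ (sortPerm_mem _ _)
          (by rw [one_smul]) rfl (by rw [toGammaL_one, one_mul])
      · rw [echelonize_eq]
        exact descends_of le_rfl List.prefix_rfl _ 1 (one_mem _) (by rw [one_smul])
          (one_mul _).symm rfl
    · exact .refl _

end Trace

/-! #### Refinements -/

/-- Application of the Homomorphism Principle. -/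
def refineStep (nd : Node F k Sh Y) (f : Refiner F k Sh Y nd.P nd.inn) : Node F k Sh Y :=
  ({ nd.permute (f.tr (f.f nd.x) : Sh.Sym) with P := f.part (f.f nd.x) } : Node F k Sh Y).record
    (toLex (.inr (f.cf (f.f nd.x))))

theorem descends_refineStep (nd : Node F k Sh Y) (f : Refiner F k Sh Y nd.P nd.inn) :
    Descends nd (nd.refineStep f) :=
  descends_of (f.part_le _) (List.prefix_append _ _) 1 _ (f.tr (f.f nd.x)).2
    (one_smul _ _).symm rfl (by rw [toGammaL_one, one_mul]; rfl)

theorem wellFormed_refineStep {A : Set (Pos Sh)} {nd : Node F k Sh Y} (h : WellFormed A nd)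
    (f : Refiner F k Sh Y nd.P nd.inn) : WellFormed A (nd.refineStep f) :=
  h.of_perm (f.tr (f.f nd.x)).2 (f.part_le _) rfl rfl

/-- The Young subgroup of the part is the stabilizer of the canonical form, and a Young subgroup
determines its partition. -/
theorem _root_.SubspaceCanon.Refiner.part_eq {P : Setoid (Pos Sh)} {K : Subgroup (Gsl F k Sh)}
    (f : Refiner F k Sh Y P K) (hP : P ≤ Sh.initialPartition) {y y' : Y} (h : f.cf y = f.cf y') :
    f.part y = f.part y' := by
  apply young_injective ((f.part_le y).trans hP) ((f.part_le y').trans hP)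
  have key : ∀ {y y' : Y}, f.cf y = f.cf y' → young (f.part y) ≤ young (f.part y') := by
    intro y y' h σ hσ
    have h1 := (f.stab y ⟨σ, young_mono (f.part_le y) hσ⟩).2 hσ
    rw [h] at h1
    exact (f.stab y' ⟨σ, young_mono (f.part_le y) hσ⟩).1 h1
  exact le_antisymm (key h) (key h.symm)

section

variable {P : Setoid (Pos Sh)} {K : Subgroup (Gsl F k Sh)} {π π' : Sh.Sym} {x x' : Obj F k Sh}
  {a a' : GammaL F k} {tr : List (Value F Y)} {α σ : Sh.Sym}

/-- The two values of `f` lie in one orbit of `S_P`, hence have the same canonical form. Both nodes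
are written with common `P`, `K` and `tr` because the type of `f` depends on the partition and the
stabilizer. -/
theorem equivalent_refineStep
    (h : Equivalent α σ (⟨P, π, x, K, a, tr⟩ : Node F k Sh Y) ⟨P, π', x', K, a', tr⟩)
    (hw : WellFormed (fixed P) (⟨P, π, x, K, a, tr⟩ : Node F k Sh Y)) (f : Refiner F k Sh Y P K) :
    ∃ ρ, Equivalent α ρ (refineStep ⟨P, π, x, K, a, tr⟩ f) (refineStep ⟨P, π', x', K, a', tr⟩ f) := by
  obtain ⟨-, -, -, hσ, ⟨g, hg, hx⟩, hπ⟩ := h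
  dsimp only at hσ hg hx hπ
  have hwσ : WellFormed (fixed P) (⟨P, π, σ • x, K, a, tr⟩ : Node F k Sh Y) :=
    hw.of_perm hσ le_rfl rfl rfl
  have hf : f.f x' = f.act ⟨σ, hσ⟩ (f.f x) := by
    rw [hx, f.f_inner _ hwσ.isSemicanonical g hg]
    exact f.f_perm x hw.isSemicanonical ⟨σ, hσ⟩
  have hcf : f.cf (f.f x') = f.cf (f.f x) := by rw [hf, f.cf_act]
  have hpart := f.part_eq hw.le_initial hcf
  obtain ⟨t, hI, -⟩ := hw
  set s := f.tr (f.f x)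
  set s' := f.tr (f.f x')
  -- Undoing one transporter, applying `σ` and then the other transporter returns the canonical form
  -- to itself, so this permutation lies in the new Young subgroup.
  have hρ : ((s' * ⟨σ, hσ⟩ * s⁻¹ : young P) : Sh.Sym) ∈ young (f.part (f.f x)) := by
    refine (f.stab (f.f x) _).1 ?_
    have h1 : f.cf (f.f x) = f.act s' (f.act ⟨σ, hσ⟩ (f.f x)) := by
      rw [← hf, ← hcf]
      exact f.act_tr _
    rw [map_mul, map_mul, map_inv]
    conv_lhs => rw [f.act_tr (f.f x)]
    rw [h1]
    exact congrArg (fun z => f.act s' (f.act ⟨σ, hσ⟩ z)) (Equiv.symm_apply_apply _ _)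
  refine ⟨(s' : Sh.Sym) * σ * (s : Sh.Sym)⁻¹, hpart, rfl, ?_, hρ,
    ⟨conj (s' : Sh.Sym) g, hI.normal _ s'.2 g hg, ?_⟩, ?_⟩
  · change tr ++ _ = tr ++ _
    rw [hcf]
  · change (s' : Sh.Sym) • x' = _ • _ • (s : Sh.Sym) • x
    rw [hx, perm_inner, mul_smul, inv_smul_smul, mul_smul]
  · change (s' : Sh.Sym) * π' * α = _ * ((s : Sh.Sym) * π)
    rw [mul_assoc, hπ]
    group

theorem sameData_refineStep {t : ℕ}
    (h : SameData t (fixed P) (⟨P, π, x, K, a, tr⟩ : Node F k Sh Y) ⟨P, π', x', K, a', tr⟩)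
    (hP : P ≤ Sh.initialPartition) (f : Refiner F k Sh Y P K) {L : List (Value F Y)}
    (hL : (refineStep ⟨P, π, x, K, a, tr⟩ f).trace <+: L)
    (hL' : (refineStep ⟨P, π', x', K, a', tr⟩ f).trace <+: L) :
    SameData t (fixed P) (refineStep ⟨P, π, x, K, a, tr⟩ f)
      (refineStep ⟨P, π', x', K, a', tr⟩ f) := by
  have hcf : f.cf (f.f x') = f.cf (f.f x) :=
    Sum.inr.inj (toLex.injective (append_singleton_prefix_inj hL' hL))
  refine ⟨f.part_eq hP hcf, rfl, ?_, fun p hp => ?_⟩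
  · change tr ++ _ = tr ++ _
    rw [hcf]
  · change entry t ((f.tr (f.f x') : Sh.Sym) • x') p = entry t ((f.tr (f.f x) : Sh.Sym) • x) p
    rw [entry_smul_of_fixed hp (f.tr (f.f x')).2, entry_smul_of_fixed hp (f.tr (f.f x)).2]
    exact h.entry_eq p hp

end

/-! ### Refinement, children and leaves without pruning -/

/-- The result of the refinement process if the node is not pruned. -/
def loopNode [LinearOrder F] (strat : Strategy F k Sh) : ℕ → Node F k Sh strat.Y → Node F k Sh strat.Y
  | 0, nd => nd
  | r + 1, nd =>
    match strat.refinementFunc nd.P nd.inn nd.trace with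
    | none => nd
    | some f => loopNode strat r ((nd.refineStep f).minimized (fixed nd.P))

open Classical in
/-- The first position of the cell which contains `j`. -/
def cellMin (cell : Set (Pos Sh)) (j : Pos Sh) : Pos Sh :=
  ((Sh.subPos ++ Sh.hypPos).find? (fun p => p ∈ cell)).getD j

theorem cellMin_mem {cell : Set (Pos Sh)} {j : Pos Sh} (hj : j ∈ cell) : cellMin cell j ∈ cell := by
  classical
  rw [cellMin]
  cases h : (Sh.subPos ++ Sh.hypPos).find? (fun p => p ∈ cell) with
  | none => exact hj
  | some p => simpa using List.find?_some h

/-- The default value is never used once the cell has a member, since the list contains all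
positions. -/
theorem cellMin_congr {cell : Set (Pos Sh)} {j j' : Pos Sh} (hj : j ∈ cell) :
    cellMin cell j = cellMin cell j' := by
  classical
  rw [cellMin, cellMin]
  cases h : (Sh.subPos ++ Sh.hypPos).find? (fun p => p ∈ cell) with
  | none =>
    rw [List.find?_eq_none] at h
    exact absurd (decide_eq_true hj) (h j (mem_allPos j))
  | some p => rfl

/-- The child of a node which corresponds to the choice of `j`, before its inner minimization. -/
def child (nd : Node F k Sh Y) (p j : Pos Sh) : Node F k Sh Y :=
  { nd.permute (Sh.swap p j) with P := separate nd.P p }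

/-- The child of a node after the refinement process. -/
def descend [LinearOrder F] (strat : Strategy F k Sh) (nd : Node F k Sh strat.Y) (j : Pos Sh) :
    Node F k Sh strat.Y :=
  loopNode strat strat.rounds
    ((nd.child (cellMin (strat.targetCell nd.P nd.inn nd.trace) j) j).minimized (fixed nd.P))

/-- The leaves of the tree below a node, where the depth is bounded. -/
def IsLeafBelow [LinearOrder F] (strat : Strategy F k Sh) :
    ℕ → Node F k Sh strat.Y → Node F k Sh strat.Y → Prop
  | 0, _, _ => False
  | d + 1, nd, l => (nd.P = ⊥ ∧ l = nd) ∨ (nd.P ≠ ⊥ ∧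
      ∃ j ∈ strat.targetCell nd.P nd.inn nd.trace, IsLeafBelow strat d (nd.descend strat j) l)

section Tree

variable [LinearOrder F] {strat : Strategy F k Sh} {nd nd' : Node F k Sh strat.Y}

theorem descends_loopNode (r : ℕ) (nd : Node F k Sh strat.Y) : Descends nd (loopNode strat r nd) := by
  induction r generalizing nd with
  | zero => exact .refl _
  | succ r ih =>
    rw [loopNode]
    split
    · exact .refl _
    · exact (descends_refineStep _ _).trans ((descends_minimized _ _).trans (ih _))

theorem rel_of_mem_targetCell (hP : nd.P ≠ ⊥) {p q : Pos Sh}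
    (hp : p ∈ strat.targetCell nd.P nd.inn nd.trace) (hq : q ∈ strat.targetCell nd.P nd.inn nd.trace) :
    nd.P p q := by
  obtain ⟨y, hy⟩ := strat.targetCell_mem nd.P nd.inn nd.trace hP
  rw [hy] at hp hq
  exact nd.P.trans hp (nd.P.symm hq)

theorem mem_targetCell_of_rel (hP : nd.P ≠ ⊥) {p q : Pos Sh}
    (hp : p ∈ strat.targetCell nd.P nd.inn nd.trace) (hq : nd.P q p) :
    q ∈ strat.targetCell nd.P nd.inn nd.trace := by
  obtain ⟨y, hy⟩ := strat.targetCell_mem nd.P nd.inn nd.trace hP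
  rw [hy] at hp ⊢
  exact nd.P.trans hq hp

theorem descends_child {p j : Pos Sh} (hP : nd.P ≤ Sh.initialPartition) (h : nd.P p j) :
    Descends nd (nd.child p j) :=
  descends_of (separate_le _ _) List.prefix_rfl 1 _ (swap_mem_young hP h) (one_smul _ _).symm rfl
    (by rw [toGammaL_one, one_mul]; rfl)

theorem wellFormed_child {A : Set (Pos Sh)} (h : WellFormed A nd) {p j : Pos Sh} (hpj : nd.P p j) :
    WellFormed A (nd.child p j) :=
  h.of_perm (swap_mem_young h.le_initial hpj) (separate_le _ _) rfl rfl

theorem descends_descend {A : Set (Pos Sh)} (h : WellFormed A nd) (hP : nd.P ≠ ⊥) {j : Pos Sh}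
    (hj : j ∈ strat.targetCell nd.P nd.inn nd.trace) : Descends nd (nd.descend strat j) :=
  (descends_child h.le_initial (rel_of_mem_targetCell hP (cellMin_mem hj) hj)).trans
    ((descends_minimized _ _).trans (descends_loopNode _ _))

variable [Finite F]

theorem wellFormed_loopNode (hF : ∀ μ : F, μ ≠ 0 → 0 < μ ∧ 1 ≤ μ) (r : ℕ)
    (h : WellFormed (fixed nd.P) nd) :
    WellFormed (fixed (loopNode strat r nd).P) (loopNode strat r nd) := by
  induction r generalizing nd with
  | zero => exact h
  | succ r ih =>
    rw [loopNode]
    split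
    · exact h
    · exact ih (wellFormed_minimized hF (wellFormed_refineStep h _))

theorem wellFormed_descend (hF : ∀ μ : F, μ ≠ 0 → 0 < μ ∧ 1 ≤ μ) (h : WellFormed (fixed nd.P) nd)
    (hP : nd.P ≠ ⊥) {j : Pos Sh} (hj : j ∈ strat.targetCell nd.P nd.inn nd.trace) :
    WellFormed (fixed (nd.descend strat j).P) (nd.descend strat j) :=
  wellFormed_loopNode hF _ (wellFormed_minimized hF
    (wellFormed_child h (rel_of_mem_targetCell hP (cellMin_mem hj) hj)))

theorem IsLeafBelow.spec (hF : ∀ μ : F, μ ≠ 0 → 0 < μ ∧ 1 ≤ μ) {d : ℕ} {l : Node F k Sh strat.Y}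
    (hw : WellFormed (fixed nd.P) nd) (h : IsLeafBelow strat d nd l) :
    Descends nd l ∧ l.P = ⊥ ∧ WellFormed (fixed l.P) l := by
  induction d generalizing nd with
  | zero => exact h.elim
  | succ d ih =>
    rcases h with ⟨h1, rfl⟩ | ⟨h1, j, hj, h⟩
    · exact ⟨.refl _, h1, hw⟩
    · obtain ⟨h2, h3⟩ := ih (wellFormed_descend hF hw h1 hj) h
      exact ⟨(descends_descend hw h1 hj).trans h2, h3⟩

/-! #### Corresponding leaves -/

theorem _root_.SubspaceCanon.Equivalent.loopNode (hF : ∀ μ : F, μ ≠ 0 → 0 < μ ∧ 1 ≤ μ) (r : ℕ)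
    {α σ : Sh.Sym} (h : Equivalent α σ nd nd') (hw : WellFormed (fixed nd.P) nd) :
    ∃ ρ, Equivalent α ρ (loopNode strat r nd) (loopNode strat r nd') := by
  induction r generalizing nd nd' σ with
  | zero => exact ⟨σ, h⟩
  | succ r ih =>
    obtain ⟨P, π, x, K, a, tr⟩ := nd
    obtain ⟨P', π', x', K', a', tr'⟩ := nd'
    obtain ⟨rfl, rfl, rfl⟩ : P' = P ∧ K' = K ∧ tr' = tr := ⟨h.P_eq, h.inn_eq, h.trace_eq⟩
    rw [Node.loopNode, Node.loopNode]
    dsimp only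
    cases strat.refinementFunc P' K' tr' with
    | none => exact ⟨σ, h⟩
    | some f =>
      obtain ⟨ρ, hρ⟩ := equivalent_refineStep h hw f
      obtain ⟨ρ', hρ'⟩ := hρ.minimized hF (wellFormed_refineStep hw f)
      exact ih hρ' (wellFormed_minimized hF (wellFormed_refineStep hw f))

/-- The choice `j` is matched with `σ • j`. The new connecting permutation sends `p` to `j`, then to
`σ • j`, then back to `p`, so it respects the separation of `p`. -/
theorem _root_.SubspaceCanon.Equivalent.child {α σ : Sh.Sym} (h : Equivalent α σ nd nd')
    (hw : WellFormed (fixed nd.P) nd) {p j : Pos Sh} (hj : nd.P p j) :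
    Equivalent α (Sh.swap p (σ • j) * σ * Sh.swap p j) (nd.child p j) (nd'.child p (σ • j)) := by
  obtain ⟨t, hI, -⟩ := hw
  obtain ⟨h1, h2, h3, hσ, ⟨g, hg, hx⟩, hπ⟩ := h
  have hσj : nd.P p (σ • j) := nd.P.trans hj (nd.P.symm (hσ j))
  have hs := swap_mem_young hI.le_initial hj
  have hs' := swap_mem_young hI.le_initial hσj
  have hsw : ∀ y : Obj F k Sh, Sh.swap p j • Sh.swap p j • y = y := fun y => by
    rw [← mul_smul, swap_mul_self (hI.le_initial hj), one_smul]
  refine ⟨by simp only [Node.child]; rw [h1], h2, h3, ?_,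
    ⟨conj (Sh.swap p (σ • j)) g, hI.normal _ hs' g hg, ?_⟩, ?_⟩
  · refine mem_young_separate (mul_mem (mul_mem hs' hσ) hs) ?_
    classical
    rw [mul_smul, swap_smul (hI.le_initial hj), if_pos rfl, mul_smul,
      swap_smul (hI.le_initial hσj)]
    split_ifs with h h'
    · exact h
    · rfl
    · exact absurd rfl h'
  · change Sh.swap p (σ • j) • nd'.x = _ • _ • Sh.swap p j • nd.x
    rw [hx, perm_inner, mul_smul, mul_smul, hsw]
  · change Sh.swap p (σ • j) * nd'.perm * α = _ * (Sh.swap p j * nd.perm)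
    rw [mul_assoc, hπ, mul_assoc _ (Sh.swap p j), ← mul_assoc (Sh.swap p j) (Sh.swap p j),
      swap_mul_self (hI.le_initial hj), one_mul, mul_assoc]

theorem _root_.SubspaceCanon.Equivalent.exists_leaf (hF : ∀ μ : F, μ ≠ 0 → 0 < μ ∧ 1 ≤ μ) {d : ℕ}
    {α σ : Sh.Sym} (h : Equivalent α σ nd nd') (hw : WellFormed (fixed nd.P) nd)
    {l : Node F k Sh strat.Y} (hl : IsLeafBelow strat d nd l) :
    ∃ l' ρ, IsLeafBelow strat d nd' l' ∧ Equivalent α ρ l l' := by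
  induction d generalizing nd nd' σ with
  | zero => exact hl.elim
  | succ d ih =>
    rcases hl with ⟨h1, rfl⟩ | ⟨h1, j, hj, hl⟩
    · exact ⟨nd', σ, Or.inl ⟨h.P_eq.trans h1, rfl⟩, h⟩
    · have hcell : strat.targetCell nd'.P nd'.inn nd'.trace =
          strat.targetCell nd.P nd.inn nd.trace := by rw [h.P_eq, h.inn_eq, h.trace_eq]
      have hσj : σ • j ∈ strat.targetCell nd.P nd.inn nd.trace :=
        mem_targetCell_of_rel h1 hj (h.mem j)
      have hrel := rel_of_mem_targetCell h1 (cellMin_mem hj) hj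
      obtain ⟨ρ, hρ⟩ := (h.child hw hrel).minimized hF (wellFormed_child hw hrel)
      obtain ⟨ρ', hρ'⟩ := hρ.loopNode hF strat.rounds
        (wellFormed_minimized hF (wellFormed_child hw hrel))
      have hd : Equivalent α ρ' (nd.descend strat j) (nd'.descend strat (σ • j)) := by
        rw [descend, descend, hcell, h.P_eq, cellMin_congr (j' := j) hσj]
        exact hρ'
      obtain ⟨l', ρ₂, hl', hρ₂⟩ := ih hd (wellFormed_descend hF hw h1 hj) hl
      exact ⟨l', ρ₂, Or.inr ⟨by rw [h.P_eq]; exact h1, σ • j, by rw [hcell]; exact hσj, hl'⟩, hρ₂⟩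

/-! #### Leaves with the same trace -/

theorem wellFormed_iff_rank {A : Set (Pos Sh)} (h : WellFormed A nd) :
    Inv nd.P A (rankOf A nd.x) (rankOf A nd.x) nd.inn nd.x := by
  obtain ⟨t, hI, -⟩ := h
  rw [hI.rankOf]
  exact hI

theorem _root_.SubspaceCanon.SameData.minimized_wellFormed (hF : ∀ μ : F, μ ≠ 0 → 0 < μ ∧ 1 ≤ μ)
    {t : ℕ} {old : Set (Pos Sh)} (h : SameData t old nd nd') (hw : WellFormed old nd)
    (hw' : WellFormed old nd') (ht : rankOf old nd.x = t) {L : List (Value F strat.Y)}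
    (hL : (nd.minimized old).trace <+: L) (hL' : (nd'.minimized old).trace <+: L) :
    SameData (rankOf (fixed (nd.minimized old).P) (nd.minimized old).x)
      (fixed (nd.minimized old).P) (nd.minimized old) (nd'.minimized old) :=
  h.minimized hF (ht ▸ wellFormed_iff_rank hw) (wellFormed_iff_rank hw') hL hL'

theorem rankOf_perm_of_fixed {P : Setoid (Pos Sh)} {A : Set (Pos Sh)} (hA : A ⊆ fixed P)
    {σ : Sh.Sym} (hσ : σ ∈ young P) (x : Obj F k Sh) : rankOf A (σ • x) = rankOf A x :=
  rankOf_congr fun _ _ h => perm_smul_V_of_fixed (smul_fixed hσ (hA h))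

theorem _root_.SubspaceCanon.SameData.loopNode (hF : ∀ μ : F, μ ≠ 0 → 0 < μ ∧ 1 ≤ μ) (r : ℕ)
    (h : SameData (rankOf (fixed nd.P) nd.x) (fixed nd.P) nd nd')
    (hw : WellFormed (fixed nd.P) nd) (hw' : WellFormed (fixed nd'.P) nd')
    {L : List (Value F strat.Y)} (hL : (loopNode strat r nd).trace <+: L)
    (hL' : (loopNode strat r nd').trace <+: L) :
    SameData (rankOf (fixed (loopNode strat r nd).P) (loopNode strat r nd).x)
      (fixed (loopNode strat r nd).P) (loopNode strat r nd) (loopNode strat r nd') := by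
  induction r generalizing nd nd' with
  | zero => exact h
  | succ r ih =>
    obtain ⟨P, π, x, K, a, tr⟩ := nd
    obtain ⟨P', π', x', K', a', tr'⟩ := nd'
    obtain ⟨rfl, rfl, rfl⟩ : P' = P ∧ K' = K ∧ tr' = tr := ⟨h.P_eq, h.inn_eq, h.trace_eq⟩
    rw [Node.loopNode] at hL hL' ⊢
    rw [Node.loopNode]
    dsimp only at hL hL' h hw hw' ⊢
    cases hf : strat.refinementFunc P' K' tr' with
    | none => exact h
    | some f =>
      rw [hf] at hL hL'
      dsimp only at hL hL' ⊢
      have hm := (descends_loopNode r _).trace_prefix.trans hL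
      have hm' := (descends_loopNode r _).trace_prefix.trans hL'
      have h1 := sameData_refineStep h hw.le_initial f
        ((descends_minimized _ _).trace_prefix.trans hm)
        ((descends_minimized _ _).trace_prefix.trans hm')
      have hw₁ := wellFormed_refineStep hw f
      have hw₁' := wellFormed_refineStep hw' f
      have h2 := h1.minimized_wellFormed hF hw₁ hw₁'
        (rankOf_perm_of_fixed subset_rfl (f.tr (f.f x)).2 x) hm hm'
      exact ih h2 (wellFormed_minimized hF hw₁) (wellFormed_minimized hF hw₁') hL hL'

theorem _root_.SubspaceCanon.SameData.child {t : ℕ} {A : Set (Pos Sh)} (hA : A ⊆ fixed nd.P)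
    (h : SameData t A nd nd') (hP : nd.P ≤ Sh.initialPartition) {p j j' : Pos Sh} (hj : nd.P p j)
    (hj' : nd.P p j') : SameData t A (nd.child p j) (nd'.child p j') := by
  refine ⟨by simp only [Node.child]; rw [h.P_eq], h.inn_eq, h.trace_eq, fun q hq => ?_⟩
  change entry t (Sh.swap p j' • nd'.x) q = entry t (Sh.swap p j • nd.x) q
  rw [entry_smul_of_fixed (hA hq) (swap_mem_young hP hj'),
    entry_smul_of_fixed (hA hq) (swap_mem_young hP hj), h.entry_eq q hq]

/-- The nodes share all data on which target cell and refiner depend, so both paths perform the same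
operations. The chosen children may be unrelated: old fixed entries agree anyway, and the common
trace forces agreement at the new ones. -/
theorem _root_.SubspaceCanon.SameData.leaf (hF : ∀ μ : F, μ ≠ 0 → 0 < μ ∧ 1 ≤ μ) {d : ℕ}
    (h : SameData (rankOf (fixed nd.P) nd.x) (fixed nd.P) nd nd')
    (hw : WellFormed (fixed nd.P) nd) (hw' : WellFormed (fixed nd'.P) nd')
    {l l' : Node F k Sh strat.Y} (hl : IsLeafBelow strat d nd l) (hl' : IsLeafBelow strat d nd' l')
    {L : List (Value F strat.Y)} (hL : l.trace <+: L) (hL' : l'.trace <+: L) :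
    SameData (rankOf (fixed l.P) l.x) (fixed l.P) l l' := by
  induction d generalizing nd nd' with
  | zero => exact hl.elim
  | succ d ih =>
    rcases hl with ⟨h1, rfl⟩ | ⟨h1, j, hj, hl⟩ <;> rcases hl' with ⟨h1', rfl⟩ | ⟨h1', j', hj', hl'⟩
    · exact h
    · exact absurd (h.P_eq.trans h1) h1'
    · exact absurd (h.P_eq.symm.trans h1') h1
    · have hrel := rel_of_mem_targetCell h1 (cellMin_mem hj) hj
      have hrel' := rel_of_mem_targetCell h1' (cellMin_mem hj') hj'
      have hdw := wellFormed_descend hF hw h1 hj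
      have hdw' := wellFormed_descend hF hw' h1' hj'
      have hLd := (IsLeafBelow.spec hF hdw hl).1.trace_prefix.trans hL
      have hLd' := (IsLeafBelow.spec hF hdw' hl').1.trace_prefix.trans hL'
      refine ih ?_ hdw hdw' hl hl'
      have hc : SameData (rankOf (fixed nd.P) nd.x) (fixed nd.P)
          (nd.child (cellMin (strat.targetCell nd.P nd.inn nd.trace) j) j)
          (nd'.child (cellMin (strat.targetCell nd'.P nd'.inn nd'.trace) j') j') := by
        rw [h.P_eq, h.inn_eq, h.trace_eq] at hj' hrel' ⊢
        rw [cellMin_congr (j' := j) hj'] at hrel' ⊢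
        exact h.child subset_rfl hw.le_initial hrel hrel'
      rw [descend] at hLd hLd' ⊢
      rw [descend]
      have hw₁ := wellFormed_child hw hrel
      have hw₁' := wellFormed_child hw' hrel'
      have hm := (descends_loopNode strat.rounds _).trace_prefix.trans hLd
      have hm' := (descends_loopNode strat.rounds _).trace_prefix.trans hLd'
      have hfix : fixed nd'.P = fixed nd.P := by rw [h.P_eq]
      -- The child is made opaque so that `fixed nd'.P` is rewritten only where it is the set of old
      -- singletons.
      generalize nd'.child _ j' = c' at hc hLd' hw₁' hm' ⊢
      rw [hfix] at hLd' hw₁' hm' ⊢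
      have h2 := hc.minimized_wellFormed hF hw₁ hw₁'
        (rankOf_perm_of_fixed subset_rfl (swap_mem_young hw.le_initial hrel) nd.x) hm hm'
      exact h2.loopNode hF strat.rounds (wellFormed_minimized hF hw₁)
        (wellFormed_minimized hF hw₁') hLd hLd'

end Tree

end Node

/-! ### Roots and leaves -/

/-- The normal vectors span the whole space. -/
def Spans (x : Obj F k Sh) : Prop := ∀ w : Fin k → F, (∀ d j, w ⬝ᵥ x.V d j = 0) → w = 0

theorem Spans.perm {x : Obj F k Sh} (h : Spans x) (σ : Sh.Sym) : Spans (σ • x) := by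
  intro w hw
  refine h w fun d j => ?_
  have := hw d (σ.2 d j)
  rwa [perm_smul_V, Equiv.Perm.inv_def, Equiv.symm_apply_apply] at this

theorem Spans.smul {x : Obj F k Sh} (h : Spans x) (g : Gsl F k Sh) : Spans (g • x) := by
  intro w hw
  set A := ((g.left.1⁻¹ : GL (Fin k) F) : Matrix (Fin k) (Fin k) F) with hA
  have h1 : (fun a => g.right.symm ((A *ᵥ w) a)) = 0 := by
    refine h _ fun d j => ?_
    have := hw d j
    rw [inner_smul_V, dotProduct_smul, smul_eq_mul, mul_eq_zero] at this
    replace this := this.resolve_left (Units.ne_zero _)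
    rw [Matrix.dotProduct_mulVec, Matrix.vecMul_transpose] at this
    apply g.right.injective
    rw [map_zero, ← this]
    simp [dotProduct, map_sum, hA]
  have h2 : A *ᵥ w = 0 := by
    ext a
    have := congrFun h1 a
    simpa using this
  have h3 : (g.left.1 : Matrix (Fin k) (Fin k) F) *ᵥ (A *ᵥ w) = w := by
    rw [Matrix.mulVec_mulVec, hA, ← Units.val_mul, mul_inv_cancel, Units.val_one, Matrix.one_mulVec]
  rw [← h3, h2, Matrix.mulVec_zero]

/-- The properties of generator matrices and normal vectors on which the algorithm depends. -/
structure Proper (x : Obj F k Sh) : Prop where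
  indep : ∀ c i, LinearIndependent F (x.U c i).col
  ne_zero : ∀ d j, x.V d j ≠ 0
  spans : Spans x

theorem rankOf_empty (x : Obj F k Sh) : rankOf ∅ x = 0 := by
  have : {v : Fin k → F | ∃ d j, Pos.hyp d j ∈ (∅ : Set (Pos Sh)) ∧ v = x.V d j} = ∅ := by
    ext v
    simp
  rw [rankOf, this, Submodule.span_empty, finrank_bot]

namespace Node

/-- With no treated positions and zero rows every clause about normalized data is vacuous, and the
whole group is admissible. -/
theorem wellFormed_root {x : Obj F k Sh} (h : Proper x) :
    WellFormed ∅ (Node.root x : Node F k Sh Y) := by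
  refine ⟨0, ?_, fun _ _ _ hp => hp.elim⟩
  exact
    { le_initial := le_rfl
      fixed_sub := Set.empty_subset _
      u_le := le_rfl
      t_le := Nat.zero_le _
      indep := h.indep
      ne_zero := h.ne_zero
      supported := fun _ _ hp => hp.elim
      unit_mem := fun _ ha => absurd ha (Nat.not_lt_zero _)
      fixV := fun _ _ _ _ hp => hp.elim
      rcef := fun g _ c i => isRCEF_topRows_zero _ (isIndep_inner h.indep g c i)
      mem_of_fix := fun _ _ _ => Subgroup.mem_top _
      normal := fun _ _ _ _ => Subgroup.mem_top _ }

theorem reaches_root (x : Obj F k Sh) : Reaches x (Node.root x : Node F k Sh Y) :=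
  ⟨1, by rw [one_smul]; exact (one_smul _ _).symm, rfl⟩

theorem equivalent_root {x x' : Obj F k Sh} {g : Gsl F k Sh} {α : Sh.Sym} (h : x' = g • α • x) :
    Equivalent α α (Node.root x : Node F k Sh Y) (Node.root x') :=
  ⟨rfl, rfl, rfl, by change α ∈ young Sh.initialPartition; rw [young_initialPartition]; trivial,
    ⟨g, Subgroup.mem_top _, h⟩, by change 1 * α = α * 1; rw [one_mul, mul_one]⟩

theorem sameData_root (t : ℕ) (x x' : Obj F k Sh) :
    SameData t ∅ (Node.root x : Node F k Sh Y) (Node.root x') :=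
  ⟨rfl, rfl, rfl, fun _ hp => hp.elim⟩

section Start

variable [LinearOrder F]

/-- The root after its refinement. -/
def start (strat : Strategy F k Sh) (x : Obj F k Sh) : Node F k Sh strat.Y :=
  loopNode strat strat.rounds ((Node.root x).minimized ∅)

/-- The bound of the depth of the tree. -/
def depthBound (Sh : Shape m) : ℕ := (Sh.subPos ++ Sh.hypPos).length + 1

/-- The leaves of the tree for `x`. -/
def IsLeaf (strat : Strategy F k Sh) (x : Obj F k Sh) (l : Node F k Sh strat.Y) : Prop :=
  IsLeafBelow strat (depthBound Sh) (start strat x) l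

variable [Finite F] {strat : Strategy F k Sh} {x x' : Obj F k Sh} {l l' : Node F k Sh strat.Y}

theorem reaches_start (strat : Strategy F k Sh) (x : Obj F k Sh) : Reaches x (start strat x) :=
  ((descends_minimized _ _).trans (descends_loopNode _ _)).reaches x (reaches_root x)

theorem wellFormed_start (hF : ∀ μ : F, μ ≠ 0 → 0 < μ ∧ 1 ≤ μ) (strat : Strategy F k Sh)
    (h : Proper x) : WellFormed (fixed (start strat x).P) (start strat x) :=
  wellFormed_loopNode hF _ (wellFormed_minimized hF (wellFormed_root h))

/-- Being spanning is preserved by permutations and inner elements. At a leaf all normal vectors are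
fixed, so their rank is the full `k`, and truncation to the first rows no longer loses anything. -/
theorem IsLeaf.spec (hF : ∀ μ : F, μ ≠ 0 → 0 < μ ∧ 1 ≤ μ) (h : Proper x) (hl : IsLeaf strat x l) :
    Reaches x l ∧ l.P = ⊥ ∧ WellFormed Set.univ l ∧ rankOf Set.univ l.x = k := by
  obtain ⟨h1, h2, h3⟩ := IsLeafBelow.spec hF (wellFormed_start hF strat h) hl
  have h4 := h1.reaches x (reaches_start strat x)
  rw [h2, fixed_bot] at h3
  refine ⟨h4, h2, h3, ?_⟩
  obtain ⟨t, hI, -⟩ := h3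
  rw [hI.rankOf]
  obtain ⟨g, hg, -⟩ := h4
  have hs : Spans l.x := hg ▸ (h.spans.perm _).smul g
  by_contra hne
  have hlt : t < k := lt_of_le_of_ne hI.t_le hne
  -- If `t < k`, every normal vector would have coordinate `t` zero, against the spanning property.
  have := hs (Pi.single ⟨t, hlt⟩ 1) fun d j => by
    rw [single_one_dotProduct]
    exact hI.supported d j trivial _ le_rfl
  simpa using congrFun this ⟨t, hlt⟩

theorem obj_ext_entry {x y : Obj F k Sh} (h : ∀ p, entry k x p = entry k y p) : x = y := by
  ext1
  · funext c i
    have := matList_injective (h (.sub c i))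
    rwa [topRows_eq_self, topRows_eq_self] at this
  · funext d j
    exact vecList_injective (h (.hyp d j))

/-- Agreement at all positions with `k` rows is equality. Assuming only a common extension `L` is
deliberate: a path whose values form a prefix of those of the candidate turns out to have the same
values. -/
theorem IsLeaf.x_eq (hF : ∀ μ : F, μ ≠ 0 → 0 < μ ∧ 1 ≤ μ) (h : Proper x) (h' : Proper x')
    (hl : IsLeaf strat x l) (hl' : IsLeaf strat x' l') {L : List (Value F strat.Y)}
    (hL : l.trace <+: L) (hL' : l'.trace <+: L) : l'.x = l.x ∧ l'.trace = l.trace := by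
  have hr := hl.spec hF h
  have hLs := (IsLeafBelow.spec hF (wellFormed_start hF strat h) hl).1.trace_prefix.trans hL
  have hLs' := (IsLeafBelow.spec hF (wellFormed_start hF strat h') hl').1.trace_prefix.trans hL'
  have h1 := (sameData_root (Y := strat.Y) 0 x x').minimized_wellFormed hF (wellFormed_root h)
    (wellFormed_root h') (rankOf_empty x) ((descends_loopNode strat.rounds _).trace_prefix.trans hLs)
    ((descends_loopNode strat.rounds _).trace_prefix.trans hLs')
  have h2 := h1.loopNode hF strat.rounds (wellFormed_minimized hF (wellFormed_root h))
    (wellFormed_minimized hF (wellFormed_root h')) hLs hLs'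
  have h3 := h2.leaf hF (wellFormed_start hF strat h) (wellFormed_start hF strat h') hl hl' hL hL'
  rw [hr.2.1, fixed_bot, hr.2.2.2] at h3
  exact ⟨obj_ext_entry fun p => h3.entry_eq p trivial, h3.trace_eq⟩

/-- At a discrete partition the connecting permutation is trivial, so the two leaf permutations
differ exactly by `α`. -/
theorem IsLeaf.exists_of_smul (hF : ∀ μ : F, μ ≠ 0 → 0 < μ ∧ 1 ≤ μ) (h : Proper x)
    {g : Gsl F k Sh} {α : Sh.Sym} (hx : x' = g • α • x) (hl : IsLeaf strat x l) :
    ∃ l', IsLeaf strat x' l' ∧ l'.trace = l.trace ∧ l'.perm * α = l.perm := by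
  obtain ⟨ρ, hρ⟩ := (equivalent_root (Y := strat.Y) hx).minimized hF (wellFormed_root h)
  obtain ⟨ρ₁, hρ₁⟩ := hρ.loopNode hF strat.rounds (wellFormed_minimized hF (wellFormed_root h))
  obtain ⟨l', ρ₂, hl', he⟩ := hρ₁.exists_leaf hF (wellFormed_start hF strat h) hl
  refine ⟨l', hl', he.trace_eq, ?_⟩
  have h1 := he.mem
  rw [(hl.spec hF h).2.1, young_bot, Subgroup.mem_bot] at h1
  rw [he.perm_eq, h1, one_mul]

/-- The two halves of the invariant meet here: elements of the inner stabilizer fix all entries, and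
everything that fixes the normalized data, now the whole sequence, belongs to it. -/
theorem IsLeaf.mem_inn_iff (hF : ∀ μ : F, μ ≠ 0 → 0 < μ ∧ 1 ≤ μ) (h : Proper x)
    (hl : IsLeaf strat x l) (g : Gsl F k Sh) : g ∈ l.inn ↔ g • l.x = l.x := by
  obtain ⟨-, -, ⟨t, hI, hf⟩, hr⟩ := hl.spec hF h
  obtain rfl : t = k := hI.rankOf.symm.trans hr
  refine ⟨fun hg => obj_ext_entry fun p => hf g hg p trivial, fun hg => ?_⟩
  exact hI.mem_of_fix g (fun d j _ => by rw [hg]) (fun c i => by rw [hg])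

/-! #### Existence of leaves -/

theorem card_cells_lt_separate {P : Setoid (Pos Sh)} {p q : Pos Sh} (hpq : P p q) (hne : q ≠ p) :
    Nat.card (Quotient P) < Nat.card (Quotient (separate P p)) := by
  let φ : Quotient (separate P p) → Quotient P := Quotient.map id fun _ _ h => h.1
  have hs : Function.Surjective φ := by
    rintro ⟨a⟩
    exact ⟨Quotient.mk _ a, rfl⟩
  refine lt_of_le_of_ne (Nat.card_le_card_of_surjective φ hs) fun he => ?_
  have hi := (hs.bijective_of_nat_card_le he.ge).injective
  have : (Quotient.mk (separate P p) p) = Quotient.mk _ q := hi (Quotient.sound hpq)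
  have := Quotient.exact this
  exact hne (this.2.1 rfl)

theorem card_cells_mono {P Q : Setoid (Pos Sh)} (h : P ≤ Q) :
    Nat.card (Quotient Q) ≤ Nat.card (Quotient P) := by
  refine Nat.card_le_card_of_surjective (Quotient.map id fun _ _ e => h e) ?_
  rintro ⟨a⟩
  exact ⟨Quotient.mk _ a, rfl⟩

theorem card_cells_lt_descend {nd : Node F k Sh strat.Y}
    (hP : nd.P ≠ ⊥) {j : Pos Sh} (hj : j ∈ strat.targetCell nd.P nd.inn nd.trace) :
    Nat.card (Quotient nd.P) < Nat.card (Quotient (nd.descend strat j).P) := by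
  set p := cellMin (strat.targetCell nd.P nd.inn nd.trace) j with hp
  have hmem : p ∈ strat.targetCell nd.P nd.inn nd.trace := cellMin_mem hj
  obtain ⟨q, hq, hne⟩ := (strat.targetCell_nontrivial nd.P nd.inn nd.trace hP).exists_ne p
  refine (card_cells_lt_separate (rel_of_mem_targetCell hP hmem hq) hne).trans_le
    (card_cells_mono ?_)
  exact ((descends_minimized (fixed nd.P) (nd.child p j)).trans (descends_loopNode _ _)).P_le

/-- Each level increases the number of cells, which cannot exceed the number of positions. The extra
unit of depth is the one consumed by the leaf itself. -/
theorem exists_leafBelow {d : ℕ} {nd : Node F k Sh strat.Y}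
    (hd : Nat.card (Pos Sh) ≤ Nat.card (Quotient nd.P) + d) : ∃ l, IsLeafBelow strat (d + 1) nd l := by
  induction d generalizing nd with
  | zero =>
    refine ⟨nd, Or.inl ⟨?_, rfl⟩⟩
    have hs : Function.Surjective (Quotient.mk nd.P) := Quotient.mk_surjective
    have hi := (hs.bijective_of_nat_card_le hd).injective
    rw [eq_bot_iff]
    exact fun a b hab => hi (Quotient.sound hab)
  | succ d ih =>
    by_cases hP : nd.P = ⊥
    · exact ⟨nd, Or.inl ⟨hP, rfl⟩⟩
    · obtain ⟨j, hj⟩ := (strat.targetCell_nontrivial nd.P nd.inn nd.trace hP).nonempty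
      obtain ⟨l, hl⟩ := ih (nd := nd.descend strat j) (by
        have := card_cells_lt_descend hP hj
        omega)
      exact ⟨l, Or.inr ⟨hP, j, hj, hl⟩⟩

theorem exists_leaf (strat : Strategy F k Sh) (x : Obj F k Sh) : ∃ l, IsLeaf strat x l :=
  exists_leafBelow (card_pos_le.trans (Nat.le_add_left _ _))

end Start

end Node

/-! ### Comparison with the candidate -/

section Lex

variable {β : Type*} [LinearOrder β]

/-- The length condition excludes that `a` is smaller merely as a proper prefix of `b`; so the
strict inequality is decided at a common index and survives arbitrary continuations. -/
theorem append_lt_append_of_lt {a b : List β} (h : a < b) (hl : b.length ≤ a.length)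
    (r r' : List β) : a ++ r < b ++ r' := by
  induction a generalizing b with
  | nil =>
    cases b with
    | nil => exact absurd h (lt_irrefl _)
    | cons => simp at hl
  | cons u a ih =>
    cases b with
    | nil => exact absurd h (by simp)
    | cons v b =>
      rw [List.cons_append, List.cons_append]
      rw [List.cons_lt_cons_iff] at h ⊢
      exact h.imp_right fun h' => ⟨h'.1, ih h'.2 (by simpa using hl)⟩

theorem append_left_lt_append {a b : List β} (l : List β) (h : a < b) : l ++ a < l ++ b := by
  induction l with
  | nil => exact h
  | cons u l ih =>
    rw [List.cons_append, List.cons_append, List.cons_lt_cons_iff]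
    exact Or.inr ⟨rfl, ih⟩

theorem lt_append_of_lt {a b : List β} (h : a < b) (r : List β) : a < b ++ r := by
  induction a generalizing b with
  | nil =>
    cases b with
    | nil => exact absurd h (lt_irrefl _)
    | cons => simp
  | cons u a ih =>
    cases b with
    | nil => exact absurd h (by simp)
    | cons v b =>
      rw [List.cons_append]
      rw [List.cons_lt_cons_iff] at h ⊢
      exact h.imp_right fun h' => ⟨h'.1, ih h'.2⟩

/-- This justifies discarding the candidate: one smaller block makes every completion of the current
path smaller. In `lt_of_lt_new` below, the opposite inequality justifies cutting off the path. -/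
theorem lt_of_new_lt {l new c L : List β} (hc : l <+: c) (hL : l ++ new <+: L)
    (h : new < (c.drop l.length).take new.length) : L < c := by
  obtain ⟨s, rfl⟩ := hc
  obtain ⟨r, rfl⟩ := hL
  rw [List.drop_left] at h
  rw [List.append_assoc]
  refine append_left_lt_append _ ?_
  rw [← List.take_append_drop new.length s]
  exact append_lt_append_of_lt h (List.length_take_le _ _) _ _

theorem lt_of_lt_new {l new c L : List β} (hc : l <+: c) (hL : l ++ new <+: L)
    (h : (c.drop l.length).take new.length < new) : c < L := by
  obtain ⟨s, rfl⟩ := hc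
  obtain ⟨r, rfl⟩ := hL
  rw [List.drop_left] at h
  rw [List.append_assoc]
  refine append_left_lt_append _ ?_
  rcases le_total new.length s.length with hl | hl
  · rw [← List.take_append_drop new.length s]
    exact append_lt_append_of_lt h (by simp [hl]) _ _
  -- The values of the candidate may end inside the compared block; then its whole remainder is
  -- compared, and only the other list is continued.
  · rw [List.take_of_length_le hl] at h
    exact lt_append_of_lt h _

theorem append_prefix_of_new_eq {l new c : List β} (hc : l <+: c)
    (h : new = (c.drop l.length).take new.length) : l ++ new <+: c := by
  obtain ⟨s, rfl⟩ := hc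
  rw [List.drop_left] at h
  rw [List.prefix_append_right_inj, h]
  exact List.take_prefix _ _

end Lex

/-! ### Steps of the pruned search against the unpruned node -/

/-- The values of the candidate begin with the values on the path to the actual node. -/
def Global.Compat (st : Global F k Sh Y) (l : List (Value F Y)) : Prop :=
  ∀ c, st.cand = some c → l <+: c.trace

theorem Global.Compat.mono {st : Global F k Sh Y} {l l' : List (Value F Y)} (h : st.Compat l)
    (hl : l' <+: l) : st.Compat l' := fun c hc => hl.trans (h c hc)

theorem Global.Compat.of_cand {st st' : Global F k Sh Y} {l : List (Value F Y)} (h : st.Compat l)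
    (hc : st'.cand = st.cand ∨ st'.cand = none) : st'.Compat l := by
  intro c hc'
  rcases hc with e | e
  · exact h c (e ▸ hc')
  · rw [e] at hc'
    exact absurd hc' (by simp)

section Step

variable [LinearOrder F] [LinearOrder Y]

/-- The result `r` of a step from one node to the node `out` with comparison of the computed values
and pruning. -/
structure Step (out : Node F k Sh Y) (st : Global F k Sh Y)
    (r : Bool × Node F k Sh Y × Global F k Sh Y) : Prop where
  T_eq : r.2.2.T = st.T
  gens_eq : r.2.2.gens = st.gens
  cand : r.2.2.cand = st.cand ∨ r.2.2.cand = none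
  node_eq : r.1 = true → r.2.1 = out
  compat : r.1 = true → r.2.2.Compat out.trace
  keep : ∀ c, st.cand = some c → ∀ L, out.trace <+: L → c.trace ≤ L → r.2.2.cand = some c
  pass : ∀ L, out.trace <+: L → (∀ c, st.cand = some c → L ≤ c.trace) →
    (∃ σ ∈ young out.P, σ * out.perm ∈ st.T) → r.1 = true

/-- Permutations that can still be reached from the second node can also be reached from the first,
and traces only get longer. So the guarantees of the first step apply to whatever survives the
second. -/
theorem Step.trans {nd₁ nd₂ : Node F k Sh Y} {st : Global F k Sh Y}
    {r r₁ r₂ : Bool × Node F k Sh Y × Global F k Sh Y} (h₁ : Step nd₁ st r₁)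
    (hd : Descends nd₁ nd₂) (h₂ : r₁.1 = true → Step nd₂ r₁.2.2 r₂)
    (ht : r₁.1 = true → r = r₂) (hf : r₁.1 = false → r.1 = false ∧ r.2.2 = r₁.2.2) :
    Step nd₂ st r := by
  have hpass : ∀ L, nd₂.trace <+: L → (∀ c, st.cand = some c → L ≤ c.trace) →
      (∃ σ ∈ young nd₂.P, σ * nd₂.perm ∈ st.T) → r₁.1 = true := by
    rintro L hL hc ⟨σ, hσ, hT⟩
    obtain ⟨τ, hτ, e⟩ := hd.perm_eq
    refine h₁.pass L (hd.trace_prefix.trans hL) hc ⟨σ * τ, mul_mem (young_mono hd.P_le hσ) hτ, ?_⟩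
    rw [mul_assoc, ← e]
    exact hT
  cases hr : r₁.1 with
  | false =>
    obtain ⟨e₁, e₂⟩ := hf hr
    rw [hr] at hpass
    constructor
    · rw [e₂, h₁.T_eq]
    · rw [e₂, h₁.gens_eq]
    · rw [e₂]; exact h₁.cand
    · rw [e₁]; exact fun h => absurd h (by simp)
    · rw [e₁]; exact fun h => absurd h (by simp)
    · rw [e₂]; exact fun c hc L hL => h₁.keep c hc L (hd.trace_prefix.trans hL)
    · exact fun L hL hc hT => absurd (hpass L hL hc hT) (by simp)
  | true =>
    obtain rfl := ht hr
    have h₂ := h₂ hr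
    constructor
    · rw [h₂.T_eq, h₁.T_eq]
    · rw [h₂.gens_eq, h₁.gens_eq]
    · rcases h₂.cand with e | e
      · rw [e]; exact h₁.cand
      · exact Or.inr e
    · exact h₂.node_eq
    · exact h₂.compat
    · exact fun c hc L hL hle => h₂.keep c (h₁.keep c hc L (hd.trace_prefix.trans hL) hle) L hL hle
    · intro L hL hc hT
      refine h₂.pass L hL (fun c hc' => hc c ?_) (by rwa [h₁.T_eq])
      rcases h₁.cand with e | e
      · exact e ▸ hc'
      · rw [e] at hc'; exact absurd hc' (by simp)

theorem Step.refl {nd : Node F k Sh Y} {st : Global F k Sh Y} (h : st.Compat nd.trace) :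
    Step nd st (true, nd, st) where
  T_eq := rfl
  gens_eq := rfl
  cand := Or.inl rfl
  node_eq _ := rfl
  compat _ := h
  keep _ hc _ _ _ := hc
  pass _ _ _ _ := rfl

/-- The new values are final for every completion `L` of the path. A smaller block thus contradicts
`c.trace ≤ L`, which keeps the candidate, and a larger one contradicts `L ≤ c.trace`, which keeps
the path. -/
theorem step_compare {st : Global F k Sh Y} {l new : List (Value F Y)} (h : st.Compat l)
    {out nd : Node F k Sh Y} (hout : out.trace = l ++ new)
    (hnd : (st.compare l.length new).1 = true → nd = out) :
    Step out st ((st.compare l.length new).1, nd, (st.compare l.length new).2) := by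
  rw [Global.compare] at hnd ⊢
  cases hc : st.cand with
  | none =>
    rw [hc] at hnd
    exact ⟨rfl, rfl, Or.inl rfl, hnd, fun _ c hc' => by simp [hc] at hc',
      fun c hc' => by simp [hc] at hc', fun _ _ _ _ => rfl⟩
  | some c =>
    rw [hc] at hnd
    dsimp only at hnd ⊢
    have hlc := h c hc
    split_ifs at hnd ⊢ with hlt
    · refine ⟨rfl, rfl, Or.inr rfl, hnd, fun _ c hc' => by simp at hc', ?_, fun _ _ _ _ => rfl⟩
      intro c' hc' L hL hle
      rw [hc, Option.some_inj] at hc'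
      subst hc'
      rw [hout] at hL
      exact absurd (lt_of_new_lt hlc hL hlt) (not_lt.2 hle)
    · refine ⟨rfl, rfl, Or.inl rfl, hnd, ?_, fun c' hc' _ _ _ => hc', ?_⟩
      · intro he c' hc'
        rw [hc, Option.some_inj] at hc'
        subst hc'
        rw [hout]
        exact append_prefix_of_new_eq hlc (of_decide_eq_true he)
      · intro L hL hle _
        refine decide_eq_true ?_
        by_contra hne
        rw [hout] at hL
        exact absurd (lt_of_lt_new hlc hL (lt_of_le_of_ne (not_lt.1 hlt) (Ne.symm hne)))
          (not_lt.2 (hle c hc))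

namespace Node

theorem step_innerMinimization {nd : Node F k Sh Y} {st : Global F k Sh Y}
    (h : st.Compat nd.trace) (old : Set (Pos Sh)) :
    Step (nd.minimized old) st (nd.innerMinimization old st) := by
  rw [innerMinimization_eq]
  refine step_compare h ?_ fun _ => rfl
  obtain ⟨s, hs⟩ := minimized_trace_prefix old nd
  rw [← hs, List.drop_left]

theorem step_refinement {nd : Node F k Sh Y} {st : Global F k Sh Y} (h : st.Compat nd.trace)
    (f : Refiner F k Sh Y nd.P nd.inn) :
    Step ((nd.refineStep f).minimized (fixed nd.P)) st (nd.refinement f st) := by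
  have h₁ : Step (nd.refineStep f) st
      ((st.compare nd.trace.length [toLex (.inr (f.cf (f.f nd.x)))]).1, nd.refineStep f,
        (st.compare nd.trace.length [toLex (.inr (f.cf (f.f nd.x)))]).2) :=
    step_compare h rfl fun _ => rfl
  refine h₁.trans (descends_minimized _ _)
    (fun ht => step_innerMinimization (h₁.compat ht) (fixed nd.P)) (fun ht => ?_) (fun hf => ?_)
  · rw [refinement]
    exact if_pos ht
  · have : nd.refinement f st = (false, nd.refineStep f,
        (st.compare nd.trace.length [toLex (.inr (f.cf (f.f nd.x)))]).2) := by
      rw [refinement]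
      exact if_neg (by rw [hf]; simp)
    rw [this]
    exact ⟨rfl, rfl⟩

end Node

end Step

/-- The search installs the order of the strategy locally; as an instance it is the same order in
statements about traces. -/
instance instLinearOrderStrategyY (strat : Strategy F k Sh) : LinearOrder strat.Y := strat.ord

namespace Node

variable [LinearOrder F] {strat : Strategy F k Sh}

theorem step_refinementLoop (r : ℕ) {nd : Node F k Sh strat.Y} {st : Global F k Sh strat.Y}
    (h : st.Compat nd.trace) : Step (loopNode strat r nd) st (refinementLoop strat r nd st) := by
  induction r generalizing nd st with
  | zero => exact .refl h
  | succ r ih =>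
    rw [loopNode, refinementLoop]
    cases hf : strat.refinementFunc nd.P nd.inn nd.trace with
    | none => exact .refl h
    | some f =>
      dsimp only
      split_ifs with hT ht
      · have hd := (descends_refineStep nd f).trans ((descends_minimized (fixed nd.P) _).trans
          (descends_loopNode r _))
        refine ⟨rfl, rfl, Or.inl rfl, fun h => absurd h (by simp), fun h => absurd h (by simp),
          fun c hc _ _ _ => hc, ?_⟩
        -- The permutations below the refined node lie in `S_P π`, so an empty intersection with `T`
        -- leaves none of them in `T`.
        rintro - - - ⟨σ, hσ, hm⟩
        exfalso
        obtain ⟨τ, hτ, e⟩ := hd.perm_eq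
        have : σ * (τ * nd.perm) ∈ st.T ∩ {σ | ∃ ρ ∈ young nd.P, σ = ρ * nd.perm} :=
          ⟨e ▸ hm, σ * τ, mul_mem (young_mono hd.P_le hσ) hτ, (mul_assoc _ _ _).symm⟩
        rw [hT] at this
        exact this
      · have h₁ := step_refinement h f
        refine h₁.trans (descends_loopNode r _) (fun _ => ?_) (fun _ => rfl)
          (fun hf => absurd (hf.symm.trans ht) (by simp))
        have := ih (h₁.node_eq ht ▸ h₁.compat ht)
        rw [h₁.node_eq ht] at this ⊢
        exact this
      · have h₁ := step_refinement h f
        exact h₁.trans (r₂ := nd.refinement f st) (descends_loopNode r _)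
          (fun hf => absurd hf ht) (fun _ => rfl)
          fun hf => ⟨hf, rfl⟩

end Node

/-! ### Correctness of the search -/

/-- The permutations which map `x` into its own orbit under the inner group. -/
def outerAut (x : Obj F k Sh) : Subgroup Sh.Sym where
  carrier := {σ | ∃ g : Gsl F k Sh, g • σ • x = x}
  one_mem' := ⟨1, by rw [one_smul, one_smul]⟩
  mul_mem' := by
    rintro σ τ ⟨g, hg⟩ ⟨h, hh⟩
    refine ⟨g * conj σ h, ?_⟩
    rw [mul_smul, mul_smul, ← perm_inner, hh, hg]
  inv_mem' := by
    rintro σ ⟨g, hg⟩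
    refine ⟨conj σ⁻¹ g⁻¹, ?_⟩
    rw [← perm_inner, inv_smul_eq_iff, inv_smul_eq_iff, hg]

namespace Node

section

variable [LinearOrder F] {strat : Strategy F k Sh} {x : Obj F k Sh}
  {M : List (Value F strat.Y)}

/-- Equal leaf sequences place both permuted copies of `x` in one inner orbit; this is why
coinciding leaves yield automorphisms. -/
theorem IsLeaf.inv_mul_mem [Finite F] (hF : ∀ μ : F, μ ≠ 0 → 0 < μ ∧ 1 ≤ μ) (h : Proper x)
    {l l' : Node F k Sh strat.Y} (hl : IsLeaf strat x l) (hl' : IsLeaf strat x l')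
    (he : l'.x = l.x) : l.perm⁻¹ * l'.perm ∈ outerAut x := by
  obtain ⟨⟨g, hg, -⟩, -⟩ := hl.spec hF h
  obtain ⟨⟨g', hg', -⟩, -⟩ := hl'.spec hF h
  refine ⟨conj l.perm⁻¹ (g⁻¹ * g'), ?_⟩
  rw [mul_smul, ← perm_inner, mul_smul, ← hg', he, hg, inv_smul_smul, inv_smul_smul]

/-- The invariant of the global variables. -/
structure _root_.SubspaceCanon.Global.Good (strat : Strategy F k Sh) (x : Obj F k Sh)
    (st : Global F k Sh strat.Y) : Prop where
  cand : ∀ c, st.cand = some c → IsLeaf strat x c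
  complement : Subgroup.IsComplement st.T (st.aut : Set Sh.Sym)
  gens : ∀ σ ∈ st.gens, σ ∈ outerAut x

theorem _root_.SubspaceCanon.Global.Good.aut_le {st : Global F k Sh strat.Y}
    (h : st.Good strat x) : st.aut ≤ outerAut x :=
  (Subgroup.closure_le _).2 h.gens

/-- The relation between the global variables before and after the traversal of a part of the
tree; `S` are the leaves of this part and `M` are the minimal values at a leaf. -/
structure Explored (strat : Strategy F k Sh) (x : Obj F k Sh) (M : List (Value F strat.Y))
    (S : Node F k Sh strat.Y → Prop) (st st' : Global F k Sh strat.Y) : Prop where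
  good : st'.Good strat x
  T_subset : st'.T ⊆ st.T
  aut_le : st.aut ≤ st'.aut
  persist : ∀ c, st.cand = some c → c.trace = M → st'.cand = some c
  done : ∀ l, S l → l.trace = M → l.perm ∈ st'.T →
    ∃ c, st'.cand = some c ∧ c.trace = M ∧ l.perm⁻¹ * c.perm ∈ st'.aut

/-- What was accounted for in the first part stays so: transversals shrink, known automorphisms
grow, and a candidate with the least trace is never replaced. -/
theorem Explored.trans {S₁ S₂ S : Node F k Sh strat.Y → Prop} {st st₁ st₂ : Global F k Sh strat.Y}
    (h₁ : Explored strat x M S₁ st st₁) (h₂ : Explored strat x M S₂ st₁ st₂)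
    (hS : ∀ l, S l → S₁ l ∨ S₂ l) : Explored strat x M S st st₂ where
  good := h₂.good
  T_subset := h₂.T_subset.trans h₁.T_subset
  aut_le := h₁.aut_le.trans h₂.aut_le
  persist c hc hM := h₂.persist c (h₁.persist c hc hM) hM
  done l hl hM hT := by
    rcases hS l hl with h | h
    · obtain ⟨c, hc, hcM, ha⟩ := h₁.done l h hM (h₂.T_subset hT)
      exact ⟨c, h₂.persist c hc hcM, hcM, h₂.aut_le ha⟩
    · exact h₂.done l h hM hT

theorem Explored.refl {S : Node F k Sh strat.Y → Prop} {st : Global F k Sh strat.Y}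
    (h : st.Good strat x) (hS : ∀ l, ¬ S l) : Explored strat x M S st st :=
  ⟨h, subset_rfl, le_rfl, fun _ hc _ => hc, fun l hl => absurd hl (hS l)⟩

theorem explored_foldl {ι : Type*} (js : List ι) (S : ι → Node F k Sh strat.Y → Prop)
    (f : Global F k Sh strat.Y → ι → Global F k Sh strat.Y) {tr : List (Value F strat.Y)}
    (hf : ∀ j ∈ js, ∀ st : Global F k Sh strat.Y, st.Good strat x → st.Compat tr →
      Explored strat x M (S j) st (f st j) ∧ (f st j).Compat tr)
    {st : Global F k Sh strat.Y} (hg : st.Good strat x) (hc : st.Compat tr) :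
    Explored strat x M (fun l => ∃ j ∈ js, S j l) st (js.foldl f st) ∧
      (js.foldl f st).Compat tr := by
  induction js generalizing st with
  | nil => exact ⟨.refl hg (by simp), hc⟩
  | cons j js ih =>
    obtain ⟨h₁, hc₁⟩ := hf j (by simp) st hg hc
    obtain ⟨h₂, hc₂⟩ := ih (fun j hj => hf j (List.mem_cons_of_mem _ hj)) h₁.good hc₁
    refine ⟨h₁.trans h₂ ?_, hc₂⟩
    rintro l ⟨i, hi, hl⟩
    rcases List.mem_cons.1 hi with rfl | hi
    · exact Or.inl hl
    · exact Or.inr ⟨i, hi, hl⟩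

/-- The computation of a child of a node, with pruning. -/
def childStep (strat : Strategy F k Sh) (nd : Node F k Sh strat.Y) (j : Pos Sh)
    (st : Global F k Sh strat.Y) : Bool × Node F k Sh strat.Y × Global F k Sh strat.Y :=
  let res := (nd.child (cellMin (strat.targetCell nd.P nd.inn nd.trace) j) j).innerMinimization
    (fixed nd.P) st
  if res.1 then refinementLoop strat strat.rounds res.2.1 res.2.2 else res

theorem step_childStep {nd : Node F k Sh strat.Y} {st : Global F k Sh strat.Y}
    (h : st.Compat nd.trace) (j : Pos Sh) : Step (nd.descend strat j) st (childStep strat nd j st) := by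
  set c := nd.child (cellMin (strat.targetCell nd.P nd.inn nd.trace) j) j with hc
  have h₁ : Step (c.minimized (fixed nd.P)) st (c.innerMinimization (fixed nd.P) st) :=
    step_innerMinimization (nd := c) h _
  refine h₁.trans (r₂ := refinementLoop strat strat.rounds (c.minimized (fixed nd.P))
    (c.innerMinimization (fixed nd.P) st).2.2) (descends_loopNode _ _)
    (fun ht => step_refinementLoop _ (h₁.compat ht)) (fun ht => ?_) (fun hf => ?_)
  · rw [childStep, ← hc, ← h₁.node_eq ht]
    exact if_pos ht
  · have : childStep strat nd j st = c.innerMinimization (fixed nd.P) st := by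
      rw [childStep, ← hc]
      exact if_neg (by rw [hf]; simp)
    rw [this]
    exact ⟨hf, rfl⟩

open Classical in
theorem backtrack_succ (d : ℕ) (nd : Node F k Sh strat.Y) (st : Global F k Sh strat.Y)
    (hP : nd.P ≠ ⊥) : backtrack strat (d + 1) nd st =
      ((Sh.subPos ++ Sh.hypPos).filter
        (fun p => p ∈ strat.targetCell nd.P nd.inn nd.trace)).foldl (init := st) fun st j =>
          if (childStep strat nd j st).1 then
            backtrack strat d (childStep strat nd j st).2.1 (childStep strat nd j st).2.2
          else (childStep strat nd j st).2.2 := by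
  rw [backtrack]
  dsimp only
  rw [if_neg hP]
  congr 1
  funext st j
  rw [childStep]
  set res := (nd.child (cellMin (strat.targetCell nd.P nd.inn nd.trace) j) j).innerMinimization
    (fixed nd.P) st with hres
  change (if res.1 = true then
      (if (refinementLoop strat strat.rounds res.2.1 res.2.2).1 = true then
        backtrack strat d (refinementLoop strat strat.rounds res.2.1 res.2.2).2.1
          (refinementLoop strat strat.rounds res.2.1 res.2.2).2.2
      else (refinementLoop strat strat.rounds res.2.1 res.2.2).2.2)
    else res.2.2) = _
  by_cases hr : res.1 = true
  · simp only [if_pos hr]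
  · simp only [if_neg hr]

variable [Finite F]

/-- If a candidate exists, the values on the path are a prefix of its values, and `IsLeaf.x_eq`
upgrades this to equality of the sequences. So every leaf that is reached beside a candidate gives a
genuine automorphism. -/
theorem explored_leaf (hF : ∀ μ : F, μ ≠ 0 → 0 < μ ∧ 1 ≤ μ) (h : Proper x)
    {nd : Node F k Sh strat.Y} {st : Global F k Sh strat.Y} (hg : st.Good strat x)
    (hc : st.Compat nd.trace) (hl : IsLeaf strat x nd) :
    Explored strat x M (fun l => l = nd) st (nd.leaf strat st) ∧
      (nd.leaf strat st).Compat nd.trace := by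
  rw [leaf]
  cases hcand : st.cand with
  | none =>
    refine ⟨⟨⟨fun c e => ?_, hg.complement, hg.gens⟩, subset_rfl, le_rfl,
      fun c e => absurd (hcand.symm.trans e) (by simp), ?_⟩, fun c e => ?_⟩
    · obtain rfl := Option.some_inj.1 e
      exact hl
    · rintro l rfl hM -
      exact ⟨l, rfl, hM, by rw [inv_mul_cancel]; exact one_mem _⟩
    · obtain rfl := Option.some_inj.1 e
      exact List.prefix_rfl
  | some c =>
    have hcl := hg.cand c hcand
    obtain ⟨hx, ht⟩ := hl.x_eq hF h h hcl (hc c hcand) List.prefix_rfl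
    have hle : st.aut ≤ Subgroup.closure {σ | σ ∈ nd.perm⁻¹ * c.perm :: st.gens} :=
      Subgroup.closure_mono fun σ hσ => List.mem_cons_of_mem _ hσ
    refine ⟨⟨⟨fun c' e => hg.cand c' (hcand.trans e), strat.shrink_transversal _ _ _ hle hg.complement, ?_⟩,
      strat.shrink_subset _ _ _ hle hg.complement, hle,
      fun c' e _ => hcand.symm.trans e, ?_⟩, fun c' e => hc c' (hcand.trans e)⟩
    · intro σ hσ
      rcases List.mem_cons.1 hσ with rfl | hσ
      · exact hl.inv_mul_mem hF h hcl hx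
      · exact hg.gens σ hσ
    · rintro l rfl hM -
      exact ⟨c, rfl, ht.trans hM, Subgroup.subset_closure (List.mem_cons_self ..)⟩

/-- By induction on the depth. The claim concerns only leaves with the least trace `M` whose
permutation is in the final transversal: these are not cut off by comparison since nothing is
smaller, and not by the transversal test since earlier transversals were larger. -/
theorem explored_backtrack (hF : ∀ μ : F, μ ≠ 0 → 0 < μ ∧ 1 ≤ μ) (h : Proper x)
    (hM : ∀ l, IsLeaf strat x l → M ≤ l.trace) {d : ℕ} {nd : Node F k Sh strat.Y}
    {st : Global F k Sh strat.Y} (hw : WellFormed (fixed nd.P) nd)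
    (hd : Nat.card (Pos Sh) < Nat.card (Quotient nd.P) + d)
    (hS : ∀ l, IsLeafBelow strat d nd l → IsLeaf strat x l)
    (hg : st.Good strat x) (hc : st.Compat nd.trace) :
    Explored strat x M (IsLeafBelow strat d nd) st (backtrack strat d nd st) ∧
      (backtrack strat d nd st).Compat nd.trace := by
  classical
  induction d generalizing nd st with
  | zero => exact ⟨.refl hg fun _ h => h, hc⟩
  | succ d ih =>
    by_cases hP : nd.P = ⊥
    · have hl : IsLeaf strat x nd := hS nd (Or.inl ⟨hP, rfl⟩)
      have : backtrack strat (d + 1) nd st = nd.leaf strat st := by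
        rw [backtrack]
        exact if_pos hP
      rw [this]
      obtain ⟨h₁, h₂⟩ := explored_leaf (M := M) hF h hg hc hl
      refine ⟨{ h₁ with done := fun l hl => h₁.done l ?_ }, h₂⟩
      rcases hl with ⟨-, e⟩ | ⟨e, -⟩
      · exact e
      · exact absurd hP e
    · rw [backtrack_succ _ _ _ hP]
      have key := explored_foldl (M := M) ((Sh.subPos ++ Sh.hypPos).filter
          (fun p => p ∈ strat.targetCell nd.P nd.inn nd.trace))
        (fun j => IsLeafBelow strat d (nd.descend strat j))
        (fun st j => if (childStep strat nd j st).1 then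
            backtrack strat d (childStep strat nd j st).2.1 (childStep strat nd j st).2.2
          else (childStep strat nd j st).2.2) (tr := nd.trace) ?_ hg hc
      · obtain ⟨h₁, h₂⟩ := key
        refine ⟨{ h₁ with done := fun l hl => h₁.done l ?_ }, h₂⟩
        rcases hl with ⟨e, -⟩ | ⟨-, j, hj, hl⟩
        · exact absurd e hP
        · exact ⟨j, List.mem_filter.2 ⟨mem_allPos j, decide_eq_true hj⟩, hl⟩
      · intro j hj st hg hc
        replace hj : j ∈ strat.targetCell nd.P nd.inn nd.trace :=
          of_decide_eq_true (List.mem_filter.1 hj).2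
        have hstep := step_childStep hc j
        have hwd := wellFormed_descend hF hw hP hj
        have hpre := (descends_descend hw hP hj).trace_prefix
        have hcard : Nat.card (Pos Sh) < Nat.card (Quotient (nd.descend strat j).P) + d := by
          have := card_cells_lt_descend hP hj
          omega
        have hSd : ∀ l, IsLeafBelow strat d (nd.descend strat j) l → IsLeaf strat x l :=
          fun l hl => hS l (Or.inr ⟨hP, j, hj, hl⟩)
        have haut : (childStep strat nd j st).2.2.aut = st.aut := by
          rw [Global.aut, hstep.gens_eq, Global.aut]
        have hgr : (childStep strat nd j st).2.2.Good strat x := by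
          refine ⟨fun c e => ?_, ?_, ?_⟩
          · rcases hstep.cand with e' | e'
            · exact hg.cand c (e' ▸ e)
            · exact absurd (e'.symm.trans e) (by simp)
          · rw [haut, hstep.T_eq]
            exact hg.complement
          · rw [hstep.gens_eq]
            exact hg.gens
        have hpersist : ∀ c, st.cand = some c → c.trace = M →
            (childStep strat nd j st).2.2.cand = some c := by
          intro c hcand hcM
          -- The subtree has a leaf, whose trace is at least `M`. Its path can therefore not begin
          -- with values smaller than those of a candidate with trace `M`, which thus survives.
          obtain ⟨l, hl⟩ : ∃ l, IsLeafBelow strat d (nd.descend strat j) l := by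
            cases d with
            | zero =>
              have := Nat.card_le_card_of_surjective _
                (Quotient.mk_surjective (s := (nd.descend strat j).P))
              omega
            | succ d => exact exists_leafBelow (by omega)
          exact hstep.keep c hcand l.trace (IsLeafBelow.spec hF hwd hl).1.trace_prefix
            (hcM ▸ hM l (hSd l hl))
        split_ifs with hflag
        · have hnode := hstep.node_eq hflag
          have hcr := hstep.compat hflag
          obtain ⟨h₁, h₂⟩ := ih hwd hcard hSd hgr hcr
          rw [hnode]
          refine ⟨⟨h₁.good, h₁.T_subset.trans hstep.T_eq.subset, haut.ge.trans h₁.aut_le,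
            fun c e e' => h₁.persist c (hpersist c e e') e', h₁.done⟩, h₂.mono hpre⟩
        · refine ⟨⟨hgr, hstep.T_eq.subset, haut.ge, hpersist, fun l hl hlM hT => ?_⟩,
            hc.of_cand hstep.cand⟩
          -- A leaf with trace `M` and permutation in `T` would have kept the child alive.
          refine absurd (hstep.pass M ?_ (fun c e => hM c (hg.cand c e)) ?_) hflag
          · rw [← hlM]
            exact (IsLeafBelow.spec hF hwd hl).1.trace_prefix
          · obtain ⟨σ, hσ, e⟩ := (IsLeafBelow.spec hF hwd hl).1.perm_eq
            refine ⟨σ, hσ, ?_⟩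
            rw [← e, ← hstep.T_eq]
            exact hT

theorem finite_leafBelow (d : ℕ) (nd : Node F k Sh strat.Y) :
    {l | IsLeafBelow strat d nd l}.Finite := by
  induction d generalizing nd with
  | zero => exact Set.finite_empty.subset fun _ h => h
  | succ d ih =>
    refine ((Set.finite_singleton nd).union
      (Set.finite_iUnion fun j => ih (nd.descend strat j))).subset ?_
    rintro l (⟨-, rfl⟩ | ⟨-, j, -, hl⟩)
    · exact Or.inl rfl
    · exact Or.inr (Set.mem_iUnion.2 ⟨j, hl⟩)

theorem exists_min_leaf (strat : Strategy F k Sh) (x : Obj F k Sh) :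
    ∃ l, IsLeaf strat x l ∧ ∀ l', IsLeaf strat x l' → l.trace ≤ l'.trace :=
  Set.exists_min_image {l | IsLeaf strat x l} trace (finite_leafBelow _ _) (exists_leaf strat x)

/-- The traversal only accounts for leaves with permutation in `T`. The known automorphisms act on
the leaves with least trace, and `T` meets every coset, so all these leaves are covered indirectly.
-/
theorem run_spec (hF : ∀ μ : F, μ ≠ 0 → 0 < μ ∧ 1 ≤ μ) (strat : Strategy F k Sh) (h : Proper x) :
    ∃ c, (run strat x).cand = some c ∧ IsLeaf strat x c ∧
      (∀ l, IsLeaf strat x l → c.trace ≤ l.trace) ∧ (run strat x).aut = outerAut x ∧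
      ∀ σ ∈ (run strat x).gens, σ ∈ outerAut x := by
  obtain ⟨l₀, hl₀, hmin⟩ := exists_min_leaf strat x
  set st₀ : Global F k Sh strat.Y := { cand := none, gens := [], T := Set.univ } with hst₀
  have hc₀ : ∀ tr, st₀.Compat tr := fun tr c e => absurd e (by simp [hst₀])
  have haut₀ : st₀.aut = ⊥ := by
    rw [Global.aut, hst₀]
    simp
  have hgood₀ : st₀.Good strat x :=
    ⟨fun c e => absurd e (by simp [hst₀]), by
      rw [haut₀]
      exact Subgroup.isComplement_univ_left.2 ⟨1, rfl⟩, fun σ hσ => absurd hσ (by simp [hst₀])⟩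
  set res := (Node.root x).innerMinimization ∅ st₀ with hres
  have h₁ : Step ((Node.root x).minimized ∅) st₀ res := step_innerMinimization (hc₀ _) ∅
  -- The root is never pruned: there is no candidate yet, and `T` contains all permutations.
  have ht₁ : res.1 = true := h₁.pass _ List.prefix_rfl (fun c e => absurd e (by simp [hst₀]))
    ⟨1, one_mem _, trivial⟩
  have hcand₁ : res.2.2.cand = none := by
    rcases h₁.cand with e | e
    · exact e
    · exact e
  set res' := refinementLoop strat strat.rounds res.2.1 res.2.2 with hres'
  have h₂ : Step (start strat x) res.2.2 res' := by
    rw [hres', h₁.node_eq ht₁]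
    exact step_refinementLoop _ fun c e => absurd (hcand₁.symm.trans e) (by simp)
  have ht₂ : res'.1 = true := h₂.pass _ List.prefix_rfl
    (fun c e => absurd (hcand₁.symm.trans e) (by simp))
    ⟨1, one_mem _, by rw [h₁.T_eq]; trivial⟩
  have hst : res'.2.2 = st₀ := by
    have e₁ : res'.2.2.cand = none := by
      rcases h₂.cand with e | e
      · exact e.trans hcand₁
      · exact e
    have hext : ∀ st : Global F k Sh strat.Y, st.cand = none → st.gens = st₀.gens →
        st.T = st₀.T → st = st₀ := by
      rintro ⟨c, g, T⟩ rfl rfl rfl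
      rfl
    exact hext _ e₁ (h₂.gens_eq.trans h₁.gens_eq) (h₂.T_eq.trans h₁.T_eq)
  have hrun : run strat x = backtrack strat (depthBound Sh) (start strat x) st₀ := by
    rw [← hst, ← h₂.node_eq ht₂]
    rfl
  rw [hrun]
  obtain ⟨hE, -⟩ := explored_backtrack (M := l₀.trace) hF h hmin (wellFormed_start hF strat h)
    (d := depthBound Sh) (by
      have := card_pos_le (Sh := Sh)
      rw [depthBound]
      omega) (fun l hl => hl) hgood₀ (hc₀ _)
  set st := backtrack strat (depthBound Sh) (start strat x) st₀
  have key : ∀ l, IsLeaf strat x l → l.trace = l₀.trace →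
      ∃ c, st.cand = some c ∧ c.trace = l₀.trace ∧ l.perm⁻¹ * c.perm ∈ st.aut := by
    intro l hl hM
    -- Shifting `l` by the known automorphism `a` gives a leaf with the same trace and permutation
    -- `τ ∈ T`, to which the traversal result applies.
    obtain ⟨⟨⟨τ, hτ⟩, ⟨a, ha⟩⟩, e⟩ := hE.good.complement.2 l.perm
    dsimp only at e
    obtain ⟨g, hg⟩ := hE.good.aut_le ha
    obtain ⟨l', hl', hM', hp⟩ := hl.exists_of_smul hF h hg.symm
    have hp' : l'.perm = τ := mul_right_cancel (hp.trans e.symm)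
    obtain ⟨c, hc, hcM, hca⟩ := hE.done l' hl' (hM'.trans hM) (hp' ▸ hτ)
    refine ⟨c, hc, hcM, ?_⟩
    rw [← e, mul_inv_rev, mul_assoc, ← hp']
    exact mul_mem (inv_mem ha) hca
  obtain ⟨c, hc, hcM, -⟩ := key l₀ hl₀ rfl
  have hcl := hE.good.cand c hc
  refine ⟨c, hc, hcl, fun l hl => hcM ▸ hmin l hl, le_antisymm hE.good.aut_le ?_, hE.good.gens⟩
  -- An automorphism `α` produces a leaf with permutation `c.perm * α⁻¹`; comparing it with the
  -- candidate shows that `α` is known.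
  rintro α ⟨g, hg⟩
  obtain ⟨l, hl, hM, hp⟩ := hcl.exists_of_smul hF h hg.symm
  obtain ⟨c', hc', -, hca⟩ := key l hl (hM.trans hcM)
  obtain rfl : c = c' := Option.some_inj.1 (hc.symm.trans hc')
  rwa [← hp, inv_mul_cancel_left] at hca

end

end Node

/-! ### Subspaces and their generator matrices -/

theorem mem_smul_sub {g : GammaL F k} {W : Sub F k} {v : Fin k → F} :
    v ∈ g • W ↔ ∃ w ∈ W, semilin g w = v := Iff.rfl

theorem mem_colSpace {s : ℕ} {U : Matrix (Fin k) (Fin s) F} {v : Fin k → F} :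
    v ∈ colSpace U ↔ ∃ w, U *ᵥ w = v := by
  rw [colSpace, ← Matrix.range_mulVecLin]
  rfl

theorem colSpace_mul_GL {s : ℕ} (U : Matrix (Fin k) (Fin s) F) (B : GL (Fin s) F) :
    colSpace (U * (B : Matrix (Fin s) (Fin s) F)ᵀ) = colSpace U := by
  have hB : (B : Matrix (Fin s) (Fin s) F)ᵀ * ((B⁻¹ : GL (Fin s) F) : Matrix (Fin s) (Fin s) F)ᵀ = 1 := by
    rw [← Matrix.transpose_mul, ← Units.val_mul, inv_mul_cancel, Units.val_one,
      Matrix.transpose_one]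
  ext v
  rw [mem_colSpace, mem_colSpace]
  constructor
  · rintro ⟨w, rfl⟩
    exact ⟨(B : Matrix (Fin s) (Fin s) F)ᵀ *ᵥ w, by rw [Matrix.mulVec_mulVec]⟩
  · rintro ⟨w, rfl⟩
    refine ⟨((B⁻¹ : GL (Fin s) F) : Matrix (Fin s) (Fin s) F)ᵀ *ᵥ w, ?_⟩
    rw [Matrix.mulVec_mulVec, Matrix.mul_assoc, hB, Matrix.mul_one]

theorem colSpace_semilin {s : ℕ} (g : GammaL F k) (U : Matrix (Fin k) (Fin s) F) :
    colSpace ((g.left : Matrix (Fin k) (Fin k) F) * U.map g.right) = g • colSpace U := by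
  have key : ∀ w : Fin s → F, ((g.left : Matrix (Fin k) (Fin k) F) * U.map g.right) *ᵥ
      (fun a => g.right (w a)) = semilin g (U *ᵥ w) := by
    intro w
    rw [← Matrix.mulVec_mulVec, semilin]
    congr 1
    ext a
    simp [Matrix.mulVec, dotProduct, map_sum]
  ext v
  rw [mem_smul_sub, mem_colSpace]
  constructor
  · rintro ⟨w, rfl⟩
    refine ⟨U *ᵥ fun a => g.right.symm (w a), mem_colSpace.2 ⟨_, rfl⟩, ?_⟩
    rw [← key]
    simp
  · rintro ⟨_, hw, rfl⟩
    obtain ⟨w, rfl⟩ := mem_colSpace.1 hw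
    exact ⟨_, key w⟩

theorem colSpace_inner (g : Gsl F k Sh) (x : Obj F k Sh) (c : Fin Sh.nC) (i : Fin (Sh.n c)) :
    colSpace ((g • x).U c i) = toGammaL g • colSpace (x.U c i) := by
  rw [inner_smul_U, colSpace_mul_GL]
  exact colSpace_semilin (toGammaL g) (x.U c i)

/-- Normal vectors transform contragrediently, so the pairing with a transformed vector is the field
automorphism applied to the old pairing; its vanishing is preserved. -/
theorem perp_semilin (g : GammaL F k) (v : Fin k → F) :
    perp ((((g.left⁻¹ : GL (Fin k) F) : Matrix (Fin k) (Fin k) F)ᵀ *ᵥ fun a => g.right (v a))) =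
      g • perp v := by
  have hA : ((g.left⁻¹ : GL (Fin k) F) : Matrix (Fin k) (Fin k) F) *
      (g.left : Matrix (Fin k) (Fin k) F) = 1 := by
    rw [← Units.val_mul, inv_mul_cancel, Units.val_one]
  have key : ∀ u, (((g.left⁻¹ : GL (Fin k) F) : Matrix (Fin k) (Fin k) F)ᵀ *ᵥ
      fun a => g.right (v a)) ⬝ᵥ semilin g u = g.right (v ⬝ᵥ u) := by
    intro u
    rw [semilin, Matrix.mulVec_transpose, Matrix.dotProduct_mulVec, Matrix.vecMul_vecMul, hA,
      Matrix.vecMul_one]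
    simp [dotProduct, map_sum]
  ext u
  rw [mem_smul_sub]
  constructor
  · intro hu
    have e : semilin g (semilin g⁻¹ u) = u := by
      rw [← semilin_mul, mul_inv_cancel, semilin_one]
    refine ⟨semilin g⁻¹ u, ?_, e⟩
    have h1 := key (semilin g⁻¹ u)
    rw [e] at h1
    have h2 : g.right (v ⬝ᵥ semilin g⁻¹ u) = 0 := h1.symm.trans hu
    exact (map_eq_zero_iff _ g.right.injective).1 h2
  · rintro ⟨w, hw, rfl⟩
    have hw' : v ⬝ᵥ w = 0 := hw
    change _ ⬝ᵥ _ = (0 : F)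
    rw [key, hw', map_zero]

theorem perp_smul {b : F} (hb : b ≠ 0) (v : Fin k → F) : perp (b • v) = perp v := by
  ext u
  change (b • v) ⬝ᵥ u = 0 ↔ v ⬝ᵥ u = 0
  rw [smul_dotProduct, smul_eq_mul, mul_eq_zero, or_iff_right hb]

theorem perp_inner (g : Gsl F k Sh) (x : Obj F k Sh) (d : Fin Sh.nH) (j : Fin (Sh.h d)) :
    perp ((g • x).V d j) = toGammaL g • perp (x.V d j) := by
  rw [inner_smul_V, perp_smul (Units.ne_zero _)]
  exact perp_semilin (toGammaL g) (x.V d j)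

/-- For a coordinate with `v a ≠ 0`, the vector `v e • e_a - v a • e_e` is orthogonal to `v`. Its
orthogonality to `w` says that `w e` is `w a / v a` times `v e`. -/
theorem exists_smul_of_perp_eq {v w : Fin k → F} (hv : v ≠ 0) (hw : w ≠ 0) (h : perp v = perp w) :
    ∃ b : Fˣ, w = (b : F) • v := by
  obtain ⟨a, ha⟩ := Function.ne_iff.1 hv
  have key : ∀ e, w e = w a / v a * v e := by
    intro e
    have h1 : (v e • Pi.single a 1 - v a • Pi.single e 1 : Fin k → F) ∈ perp v := by
      change v ⬝ᵥ _ = 0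
      rw [dotProduct_sub, dotProduct_smul, dotProduct_smul, dotProduct_single_one,
        dotProduct_single_one, smul_eq_mul, smul_eq_mul, mul_comm, sub_self]
    rw [h] at h1
    change w ⬝ᵥ _ = 0 at h1
    rw [dotProduct_sub, dotProduct_smul, dotProduct_smul, dotProduct_single_one,
      dotProduct_single_one, smul_eq_mul, smul_eq_mul, sub_eq_zero] at h1
    rw [div_mul_eq_mul_div, eq_div_iff ha, mul_comm _ (v a), ← h1, mul_comm]
  have hb : w a / v a ≠ 0 := by
    intro h0
    refine hw (funext fun e => ?_)
    rw [key, h0, zero_mul]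
    rfl
  exact ⟨Units.mk0 _ hb, funext key⟩

/-- Each matrix is the other one times some square matrix; independence of the columns forces the
two square matrices to be inverse to each other. -/
theorem exists_GL_of_colSpace_eq {s : ℕ} {U U' : Matrix (Fin k) (Fin s) F}
    (hU : LinearIndependent F U.col) (hU' : LinearIndependent F U'.col)
    (h : colSpace U = colSpace U') :
    ∃ B : GL (Fin s) F, U' = U * (B : Matrix (Fin s) (Fin s) F)ᵀ := by
  have key : ∀ {U U' : Matrix (Fin k) (Fin s) F}, colSpace U = colSpace U' →
      ∃ B : Matrix (Fin s) (Fin s) F, U' = U * B := by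
    intro U U' h
    have : ∀ j, ∃ w, U *ᵥ w = U'.col j := fun j => by
      rw [← mem_colSpace, h]
      exact Submodule.subset_span ⟨j, rfl⟩
    choose w hw using this
    refine ⟨(Matrix.of w)ᵀ, ?_⟩
    ext a j
    exact (congrFun (hw j) a).symm
  obtain ⟨B, hB⟩ := key h
  obtain ⟨B', hB'⟩ := key h.symm
  have hinj : ∀ {U : Matrix (Fin k) (Fin s) F}, LinearIndependent F U.col →
      ∀ {M : Matrix (Fin s) (Fin s) F}, U = U * M → M = 1 := by
    intro U hU M hM
    have hi : Function.Injective U.mulVec := Matrix.mulVec_injective_iff.2 hU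
    ext a j
    have : M.col j = (1 : Matrix (Fin s) (Fin s) F).col j := by
      apply hi
      have h1 := congrArg (fun N => N.col j) hM
      have h2 := congrArg (fun N => N.col j) (Matrix.mul_one U)
      exact (h1.symm.trans h2.symm)
    exact congrFun this a
  have h1 : B * B' = 1 := hinj hU (by rw [← Matrix.mul_assoc, ← hB, ← hB'])
  have h2 : B' * B = 1 := hinj hU' (by rw [← Matrix.mul_assoc, ← hB', ← hB])
  refine ⟨⟨Bᵀ, B'ᵀ, by rw [← Matrix.transpose_mul, h2, Matrix.transpose_one],
    by rw [← Matrix.transpose_mul, h1, Matrix.transpose_one]⟩, ?_⟩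
  rw [Matrix.transpose_transpose]
  exact hB

theorem config_smul_apply (g : GammaL F k) (C : Config F k m) (i : Fin m) :
    (g • C) i = (C i).map (g • ·) := rfl

theorem decode_inner (g : Gsl F k Sh) (x : Obj F k Sh) :
    decode (g • x) = toGammaL g • decode x := by
  funext i
  rw [config_smul_apply, decode, decode]
  simp only [← Multiset.coe_mapAddMonoidHom, map_sum]
  simp only [Multiset.coe_mapAddMonoidHom, Multiset.map_replicate, colSpace_inner]

theorem decode_perm (σ : Sh.Sym) (x : Obj F k Sh) : decode (σ • x) = decode x := by
  funext i
  rw [decode, decode]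
  refine Finset.sum_congr rfl fun c _ => ?_
  exact Equiv.sum_comp (σ.1 c)⁻¹
    (fun j => Multiset.replicate (Sh.mult c i) (colSpace (x.U c j)))

/-! ### Correctness of the output -/

/-- The automorphism group, described by generator matrices and normal vectors. -/
def inducedAut (x : Obj F k Sh) : Set (GammaL F k) :=
  {γ | ∃ (h : Gsl F k Sh) (α : Sh.Sym), h • α • x = x ∧ toGammaL h = γ}

section Output

variable [LinearOrder F] [Finite F] {strat : Strategy F k Sh} {x x' : Obj F k Sh}

open Node

/-- Each tree contains a leaf with the least trace of the other, so the least traces coincide, and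
equal traces give the same leaf sequence. -/
theorem output_canonical (hF : ∀ μ : F, μ ≠ 0 → 0 < μ ∧ 1 ≤ μ) (h : Proper x) (h' : Proper x')
    {g : Gsl F k Sh} {α : Sh.Sym} (hx : x' = g • α • x) :
    (output strat x).1 = (output strat x').1 := by
  obtain ⟨c, hc, hl, hmin, -⟩ := run_spec hF strat h
  obtain ⟨c', hc', hl', hmin', -⟩ := run_spec hF strat h'
  have hx' : x = conj α⁻¹ g⁻¹ • α⁻¹ • x' := by
    rw [← perm_inner, hx, inv_smul_smul, inv_smul_smul]
  obtain ⟨l, h1, h2, -⟩ := hl.exists_of_smul hF h hx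
  obtain ⟨l', h1', h2', -⟩ := hl'.exists_of_smul hF h' hx'
  have ht : c'.trace = c.trace := le_antisymm (h2 ▸ hmin' l h1) (h2' ▸ hmin l' h1')
  have hxx := (hl.x_eq hF h h' hl' (List.prefix_refl c.trace) (ht ▸ List.prefix_rfl)).1
  change decode ((run strat x).cand.getD _).x = decode ((run strat x').cand.getD _).x
  rw [hc, hc', Option.getD_some, Option.getD_some, hxx]

theorem output_transporter (hF : ∀ μ : F, μ ≠ 0 → 0 < μ ∧ 1 ≤ μ) (h : Proper x) :
    (output strat x).1 = (output strat x).2.1 • decode x := by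
  obtain ⟨c, hc, hl, -⟩ := run_spec hF strat h
  obtain ⟨⟨g, hg, ha⟩, -⟩ := hl.spec hF h
  change decode ((run strat x).cand.getD _).x = ((run strat x).cand.getD _).acc • decode x
  rw [hc, Option.getD_some, hg, ← ha, decode_inner, decode_perm]

/-- Elements over the trivial permutation come from the inner stabilizer of the candidate,
transported back to `x`. The other automorphisms are reduced to these by the generators, which cover
all outer automorphisms by `run_spec`. -/
theorem output_aut (hF : ∀ μ : F, μ ≠ 0 → 0 < μ ∧ 1 ≤ μ) (h : Proper x) (γ : GammaL F k) :
    γ ∈ (output strat x).2.2 ↔ γ ∈ inducedAut x := by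
  obtain ⟨c, hc, hl, -, haut, hgens⟩ := run_spec hF strat h
  obtain ⟨⟨g₀, hg₀, ha⟩, -⟩ := hl.spec hF h
  have hout : (output strat x).2.2 = Subgroup.closure
      ({γ | ∃ g ∈ c.inn, γ = c.acc⁻¹ * toGammaL g * c.acc} ∪
        {γ | ∃ σ ∈ (run strat x).gens, γ = c.acc⁻¹ * transporter ((c.perm * σ) • x) c.x}) := by
    change Subgroup.closure ({γ | ∃ g ∈ ((run strat x).cand.getD _).inn, _} ∪ _) = _
    rw [hc, Option.getD_some]
  -- The transporter is an arbitrary choice; pulled back to `x` by the path to the candidate, it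
  -- becomes an inner element over `σ` that returns `σ • x` to `x`.
  have hgen : ∀ σ ∈ (run strat x).gens, ∃ u : Gsl F k Sh, u • σ • x = x ∧
      toGammaL u = c.acc⁻¹ * transporter ((c.perm * σ) • x) c.x := by
    intro σ hσ
    obtain ⟨u, hu⟩ := hgens σ hσ
    have hex : ∃ g : Gsl F k Sh, g • (c.perm * σ) • x = c.x := by
      refine ⟨g₀ * conj c.perm u, ?_⟩
      rw [mul_smul, mul_smul, ← perm_inner, hu, ← hg₀]
    refine ⟨conj c.perm⁻¹ (g₀⁻¹ * hex.choose), ?_, ?_⟩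
    · have e := hex.choose_spec
      have e' : hex.choose • c.perm • σ • x = g₀ • c.perm • x := by
        rw [← mul_smul c.perm, e, hg₀]
      have : σ • x = c.perm⁻¹ • c.perm • σ • x := (inv_smul_smul _ _).symm
      rw [this, ← perm_inner, mul_smul, e', inv_smul_smul, inv_smul_smul]
    · rw [toGammaL_conj, toGammaL_mul, toGammaL_inv, ha, transporter, dif_pos hex]
  rw [hout]
  constructor
  · intro hγ
    induction hγ using Subgroup.closure_induction with
    | mem γ hγ =>
      rcases hγ with ⟨g, hg, rfl⟩ | ⟨σ, hσ, rfl⟩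
      · refine ⟨conj c.perm⁻¹ (g₀⁻¹ * g * g₀), 1, ?_, ?_⟩
        · have hfix : g • c.x = c.x := (hl.mem_inn_iff hF h g).1 hg
          have : x = c.perm⁻¹ • c.perm • x := (inv_smul_smul _ _).symm
          rw [one_smul]
          conv_lhs => rw [this]
          rw [← perm_inner, mul_smul, mul_smul, ← hg₀, hfix, hg₀, inv_smul_smul, inv_smul_smul]
        · rw [toGammaL_conj, toGammaL_mul, toGammaL_mul, toGammaL_inv, ha]
      · obtain ⟨u, hu, e⟩ := hgen σ hσ
        exact ⟨u, σ, hu, e⟩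
    | one => exact ⟨1, 1, by rw [one_smul, one_smul], toGammaL_one⟩
    | mul γ δ _ _ hγ hδ =>
      obtain ⟨g, σ, hg, rfl⟩ := hγ
      obtain ⟨u, τ, hu, rfl⟩ := hδ
      refine ⟨g * conj σ u, σ * τ, ?_, by rw [toGammaL_mul, toGammaL_conj]⟩
      rw [mul_smul, mul_smul, ← perm_inner, hu, hg]
    | inv γ _ hγ =>
      obtain ⟨g, σ, hg, rfl⟩ := hγ
      refine ⟨conj σ⁻¹ g⁻¹, σ⁻¹, ?_, by rw [toGammaL_conj, toGammaL_inv]⟩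
      rw [← perm_inner, inv_smul_eq_iff, inv_smul_eq_iff, hg]
  · rintro ⟨g, α, hg, rfl⟩
    set H := Subgroup.closure
      ({γ | ∃ g ∈ c.inn, γ = c.acc⁻¹ * toGammaL g * c.acc} ∪
        {γ | ∃ σ ∈ (run strat x).gens, γ = c.acc⁻¹ * transporter ((c.perm * σ) • x) c.x})
    have hstab : ∀ u : Gsl F k Sh, u • x = x → toGammaL u ∈ H := by
      intro u hu
      refine Subgroup.subset_closure (Or.inl ⟨g₀ * conj c.perm u * g₀⁻¹, ?_, ?_⟩)
      · rw [hl.mem_inn_iff hF h, hg₀, mul_smul, mul_smul, inv_smul_smul, ← perm_inner, hu]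
      · rw [toGammaL_mul, toGammaL_mul, toGammaL_inv, toGammaL_conj, ha]
        group
    -- Two inner elements over the same permutation differ by a stabilizing element, so it suffices
    -- to find one of them.
    have hdiff : ∀ {u v : Gsl F k Sh} {y : Obj F k Sh}, u • y = x → v • y = x →
        toGammaL u ∈ H → toGammaL v ∈ H := by
      intro u v y hu hv huH
      have h1 : toGammaL (v * u⁻¹) ∈ H := by
        refine hstab _ ?_
        rw [mul_smul, ← hu, inv_smul_smul, hv, hu]
      have h2 := mul_mem h1 huH
      rwa [← toGammaL_mul, inv_mul_cancel_right] at h2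
    have key : ∀ α ∈ (run strat x).aut, ∃ u : Gsl F k Sh, u • α • x = x ∧ toGammaL u ∈ H := by
      intro α hα
      induction hα using Subgroup.closure_induction with
      | mem σ hσ =>
        obtain ⟨u, hu, e⟩ := hgen σ hσ
        exact ⟨u, hu, Subgroup.subset_closure (Or.inr ⟨σ, hσ, e⟩)⟩
      | one => exact ⟨1, by rw [one_smul, one_smul], one_mem _⟩
      | mul σ τ _ _ hσ hτ =>
        obtain ⟨u, hu, huH⟩ := hσ
        obtain ⟨v, hv, hvH⟩ := hτ
        refine ⟨u * conj σ v, ?_, ?_⟩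
        · rw [mul_smul, mul_smul, ← perm_inner, hv, hu]
        · rw [toGammaL_mul, toGammaL_conj]
          exact mul_mem huH hvH
      | inv σ _ hσ =>
        obtain ⟨u, hu, huH⟩ := hσ
        refine ⟨conj σ⁻¹ u⁻¹, ?_, ?_⟩
        · rw [← perm_inner, inv_smul_eq_iff, inv_smul_eq_iff, hu]
        · rw [toGammaL_conj, toGammaL_inv]
          exact inv_mem huH
    obtain ⟨u, hu, huH⟩ := key α (by rw [haut]; exact ⟨g, hg⟩)
    exact hdiff hu hg huH

end Output

/-! ### Invariance of the preprocessing -/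

theorem mem_supp {C : Config F k m} {W : Sub F k} : W ∈ supp C ↔ ∃ i, W ∈ C i := by
  classical
  simp [supp]

theorem smul_mem_supp {g : GammaL F k} {C : Config F k m} {W : Sub F k} :
    g • W ∈ supp (g • C) ↔ W ∈ supp C := by
  rw [mem_supp, mem_supp]
  refine exists_congr fun i => ?_
  rw [config_smul_apply]
  exact Multiset.mem_map_of_injective (MulAction.injective g)

theorem smul_le_smul_sub {g : GammaL F k} {W W' : Sub F k} : g • W ≤ g • W' ↔ W ≤ W' := by
  have key : ∀ (g : GammaL F k) {W W' : Sub F k}, W ≤ W' → g • W ≤ g • W' := by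
    rintro g W W' h _ ⟨w, hw, rfl⟩
    exact ⟨w, h hw, rfl⟩
  refine ⟨fun h => ?_, key g⟩
  have := key g⁻¹ h
  rwa [inv_smul_smul, inv_smul_smul] at this

theorem exists_colSpace_eq {s : ℕ} {W : Sub F k} (h : Module.finrank F W = s) :
    ∃ U : Matrix (Fin k) (Fin s) F, LinearIndependent F U.col ∧ colSpace U = W := by
  let b := Module.finBasisOfFinrankEq F W h
  refine ⟨(Matrix.of fun j => (b j : Fin k → F))ᵀ, ?_, ?_⟩
  · exact b.linearIndependent.map' W.subtype W.ker_subtype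
  · have h1 : Set.range (Matrix.of fun j => (b j : Fin k → F))ᵀ.col =
        W.subtype '' Set.range b := by
      rw [← Set.range_comp]
      rfl
    rw [colSpace, h1, Submodule.span_image, b.span_eq, Submodule.map_top, Submodule.range_subtype]

/-- The map is only semilinear, so the dimension is bounded by counting the transformed generators;
the inverse gives the other inequality. -/
theorem finrank_smul (g : GammaL F k) (W : Sub F k) :
    Module.finrank F (g • W : Sub F k) = Module.finrank F W := by
  have key : ∀ (g : GammaL F k) (W : Sub F k),
      Module.finrank F (g • W : Sub F k) ≤ Module.finrank F W := by
    intro g W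
    obtain ⟨U, -, hU⟩ := exists_colSpace_eq (W := W) rfl
    conv_lhs => rw [← hU, ← colSpace_semilin, colSpace]
    exact (finrank_range_le_card _).trans (Fintype.card_fin _).le
  refine le_antisymm (key g W) ?_
  have := key g⁻¹ (g • W)
  rwa [inv_smul_smul] at this

theorem color_smul (g : GammaL F k) (C : Config F k m) (W : Sub F k) :
    color (g • C) (g • W) = color C W := by
  classical
  rw [color, color, finrank_smul]
  congr 3
  funext i
  rw [config_smul_apply]
  exact Multiset.count_map_eq_count' _ _ (MulAction.injective g) _

theorem profile_smul (g : GammaL F k) (C : Config F k m) (W : Sub F k) :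
    profile (g • C) (g • W) = profile C W := by
  classical
  funext c
  rw [profile, profile]
  refine (Finset.card_equiv (MulAction.toPerm g) fun W' => ?_).symm
  rw [Finset.mem_filter, Finset.mem_filter, MulAction.toPerm_apply, smul_mem_supp, color_smul,
    smul_le_smul_sub]

theorem colors_smul (g : GammaL F k) (C : Config F k m) : colors (g • C) = colors C := by
  classical
  rw [colors, colors]
  congr 1
  ext c
  rw [Finset.mem_image, Finset.mem_image]
  constructor
  · rintro ⟨W, hW, rfl⟩
    have e : W = g • g⁻¹ • W := (smul_inv_smul _ _).symm
    rw [e, smul_mem_supp] at hW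
    refine ⟨_, hW, ?_⟩
    conv_rhs => rw [e]
    rw [color_smul]
  · rintro ⟨W, hW, rfl⟩
    exact ⟨_, smul_mem_supp.2 hW, color_smul _ _ _⟩

theorem exists_perp_smul (g : GammaL F k) {v : Fin k → F} (hv : v ≠ 0) :
    ∃ w ≠ 0, g • perp v = perp w := by
  refine ⟨_, fun h0 => ?_, (perp_semilin g v).symm⟩
  have h1 : ((g.left⁻¹ : GL (Fin k) F) : Matrix (Fin k) (Fin k) F).det ≠ 0 :=
    ((Matrix.isUnit_iff_isUnit_det _).1 (Units.isUnit _)).ne_zero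
  rw [← Matrix.det_transpose] at h1
  have h2 := Matrix.eq_zero_of_mulVec_eq_zero h1 h0
  refine hv (funext fun a => ?_)
  have := congrFun h2 a
  simpa using this

theorem hyperplanes_smul (g : GammaL F k) (C : Config F k m) (f : Color m → ℕ) :
    {W : Sub F k | ∃ v ≠ 0, W = perp v ∧ profile (g • C) W = f} =
      (g • ·) '' {W : Sub F k | ∃ v ≠ 0, W = perp v ∧ profile C W = f} := by
  ext W
  constructor
  · rintro ⟨v, hv, rfl, hf⟩
    obtain ⟨w, hw, e⟩ := exists_perp_smul g⁻¹ hv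
    refine ⟨perp w, ⟨w, hw, rfl, ?_⟩, ?_⟩
    · rw [← e, ← profile_smul g, smul_inv_smul, hf]
    · exact e ▸ smul_inv_smul g _
  · rintro ⟨_, ⟨v, hv, rfl, hf⟩, rfl⟩
    obtain ⟨w, hw, e⟩ := exists_perp_smul g hv
    exact ⟨w, hw, e, by rw [← hf]; exact profile_smul g C _⟩

theorem subspaces_smul (g : GammaL F k) (C : Config F k m) (c : Color m) :
    {W | W ∈ supp (g • C) ∧ color (g • C) W = c} = (g • ·) '' {W | W ∈ supp C ∧ color C W = c} := by
  ext W
  constructor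
  · rintro ⟨h1, h2⟩
    refine ⟨g⁻¹ • W, ⟨?_, ?_⟩, smul_inv_smul g W⟩
    · rwa [← smul_mem_supp (g := g), smul_inv_smul]
    · rw [← color_smul g, smul_inv_smul, h2]
  · rintro ⟨W, ⟨h1, h2⟩, rfl⟩
    exact ⟨smul_mem_supp.2 h1, (color_smul _ _ _).trans h2⟩

/-- The shape given by lists of colours and profiles and the cardinalities of their classes. -/
def shapeOfCounts (cols : List (Color m)) (numSub : Color m → ℕ) (profs : List (Color m → ℕ))
    (numHyp : (Color m → ℕ) → ℕ) : Shape m where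
  nC := cols.length
  col := cols.get
  n c := numSub (cols.get c)
  nH := profs.length
  prof := profs.get
  h d := numHyp (profs.get d)

-- Colours and profiles become plain arguments here, with the cardinalities as functions of them.
-- They can then be rewritten although the components of a shape depend on each other.
open Classical in
theorem shapeOf_eq (pre : Preprocessing F k m) (C : Config F k m) :
    shapeOf pre C = shapeOfCounts (colors C)
      (fun c => ((supp C).filter fun W => color C W = c).card) (pre.sel C)
      (fun f => {W : Sub F k | ∃ v ≠ 0, W = perp v ∧ profile C W = f}.ncard) := rfl

theorem shapeOf_smul (pre : Preprocessing F k m) (g : GammaL F k) (C : Config F k m) :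
    shapeOf pre (g • C) = shapeOf pre C := by
  classical
  rw [shapeOf_eq, shapeOf_eq, colors_smul, pre.invariant]
  congr 1
  · funext c
    refine (Finset.card_equiv (MulAction.toPerm g) fun W => ?_).symm
    rw [Finset.mem_filter, Finset.mem_filter, MulAction.toPerm_apply, smul_mem_supp, color_smul]
  · funext f
    rw [hyperplanes_smul, Set.ncard_image_of_injective _ (MulAction.injective g)]

/-! ### Matrix representations -/

/-- The sequence `x` represents `C`, where the shape is a variable. -/
structure Realizes (C : Config F k m) (x : Obj F k Sh) : Prop where
  proper : Proper x
  sub_inj : ∀ c, Function.Injective fun i => colSpace (x.U c i)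
  sub_range : ∀ c, Set.range (fun i => colSpace (x.U c i)) =
    {W | W ∈ supp C ∧ color C W = Sh.col c}
  hyp_inj : ∀ d, Function.Injective fun j => perp (x.V d j)
  hyp_range : ∀ d, Set.range (fun j => perp (x.V d j)) =
    {W | ∃ v ≠ 0, W = perp v ∧ profile C W = Sh.prof d}
  col_inj : Function.Injective Sh.col
  col_surj : ∀ W ∈ supp C, ∃ c, Sh.col c = color C W

/-- The spanning property of the chosen hyperplanes passes to the listed vectors because two normal
vectors of one hyperplane are proportional. -/
theorem Represents.realizes {pre : Preprocessing F k m} {C : Config F k m}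
    {x : Obj F k (shapeOf pre C)} (h : Represents pre C x) : Realizes C x where
  proper :=
    { indep := h.indep
      ne_zero := h.ne_zero
      spans := by
        intro w hw
        have key : ∀ u ∈ Submodule.span F {v : Fin k → F | v ≠ 0 ∧ profile C (perp v) ∈ pre.sel C},
            w ⬝ᵥ u = 0 := by
          intro u hu
          induction hu using Submodule.span_induction with
          | mem v hv =>
            obtain ⟨d, hd⟩ := List.get_of_mem hv.2
            have : perp v ∈ Set.range fun j => perp (x.V d j) := by
              rw [h.hyp_range d]
              exact ⟨v, hv.1, rfl, hd.symm⟩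
            obtain ⟨j, hj⟩ := this
            obtain ⟨b, hb⟩ := exists_smul_of_perp_eq (h.ne_zero d j) hv.1 hj
            have h0 : w ⬝ᵥ x.V d j = 0 := hw d j
            rw [hb, dotProduct_smul]
            exact (congrArg _ h0).trans (smul_zero _)
          | zero => exact dotProduct_zero w
          | add u v _ _ hu hv => rw [dotProduct_add, hu, hv, add_zero]
          | smul c u _ hu => rw [dotProduct_smul, hu, smul_zero]
        rw [pre.spanning C] at key
        ext a
        have := key (Pi.single a 1) trivial
        rwa [dotProduct_single_one] at this }
  sub_inj := h.sub_inj
  sub_range := h.sub_range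
  hyp_inj := h.hyp_inj
  hyp_range := h.hyp_range
  col_inj := List.nodup_iff_injective_get.1 (Finset.sort_nodup _ _)
  col_surj W hW := by
    classical
    have : color C W ∈ colors C :=
      (Finset.mem_sort _).2 (Finset.mem_image_of_mem _ hW)
    exact List.get_of_mem this

theorem exists_represents [Finite F] (pre : Preprocessing F k m) (C : Config F k m) :
    ∃ x : Obj F k (shapeOf pre C), Represents pre C x := by
  classical
  have hfin : Finite (Sub F k) := Finite.of_injective (fun W : Sub F k => (W : Set (Fin k → F)))
    SetLike.coe_injective
  have h1 : ∀ c : Fin (shapeOf pre C).nC, ∃ U : Fin ((shapeOf pre C).n c) →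
      Matrix (Fin k) (Fin ((shapeOf pre C).s c)) F, (∀ i, LinearIndependent F (U i).col) ∧
      (Function.Injective fun i => colSpace (U i)) ∧ Set.range (fun i => colSpace (U i)) =
        {W | W ∈ supp C ∧ color C W = (shapeOf pre C).col c} := by
    intro c
    let e : Fin ((shapeOf pre C).n c) ≃
        ((supp C).filter fun W => color C W = (shapeOf pre C).col c) :=
      (Finset.equivFinOfCardEq rfl).symm
    have hmem : ∀ i, (e i : Sub F k) ∈ supp C ∧ color C (e i) = (shapeOf pre C).col c :=
      fun i => Finset.mem_filter.1 (e i).2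
    have hU : ∀ i, ∃ U : Matrix (Fin k) (Fin ((shapeOf pre C).s c)) F,
        LinearIndependent F U.col ∧ colSpace U = e i := by
      intro i
      refine exists_colSpace_eq ?_
      exact congrArg (fun c => (ofLex c).1) (hmem i).2
    choose U hU hUe using hU
    refine ⟨U, hU, ?_, ?_⟩
    · simp only [hUe]
      exact Subtype.val_injective.comp e.injective
    · simp only [hUe]
      ext W
      constructor
      · rintro ⟨i, rfl⟩
        exact hmem i
      · intro hW
        exact ⟨e.symm ⟨W, Finset.mem_filter.2 hW⟩, by simp⟩
  have h2 : ∀ d : Fin (shapeOf pre C).nH, ∃ V : Fin ((shapeOf pre C).h d) → (Fin k → F),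
      (∀ j, V j ≠ 0) ∧ (Function.Injective fun j => perp (V j)) ∧ Set.range (fun j => perp (V j)) =
        {W | ∃ v ≠ 0, W = perp v ∧ profile C W = (shapeOf pre C).prof d} := by
    intro d
    let e : {W : Sub F k | ∃ v ≠ 0, W = perp v ∧ profile C W = (shapeOf pre C).prof d} ≃
        Fin ((shapeOf pre C).h d) := Finite.equivFinOfCardEq rfl
    have hV : ∀ j, ∃ v : Fin k → F, v ≠ 0 ∧ perp v = e.symm j := by
      intro j
      obtain ⟨v, hv, h, -⟩ := (e.symm j).2
      exact ⟨v, hv, h.symm⟩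
    choose V hV hVe using hV
    refine ⟨V, hV, ?_, ?_⟩
    · simp only [hVe]
      exact Subtype.val_injective.comp e.symm.injective
    · simp only [hVe]
      ext W
      constructor
      · rintro ⟨j, rfl⟩
        exact (e.symm j).2
      · intro hW
        exact ⟨e ⟨W, hW⟩, by simp⟩
  choose U hU using h1
  choose V hV using h2
  exact ⟨⟨U, V⟩, ⟨fun c => (hU c).1, fun c => (hU c).2.1, fun c => (hU c).2.2, fun d => (hV d).1,
    fun d => (hV d).2.1, fun d => (hV d).2.2⟩⟩

/-- Every occurring subspace is listed at exactly one position, since colours are not repeated and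
each cell lists its subspaces once; its colour stores the multiplicities. -/
theorem Realizes.decode_eq {C : Config F k m} {x : Obj F k Sh} (h : Realizes C x) :
    decode x = C := by
  classical
  funext i
  ext W
  have hcount : (decode x i).count W =
      ∑ c, ∑ j, if colSpace (x.U c j) = W then Sh.mult c i else 0 := by
    rw [decode, Multiset.count_sum']
    refine Finset.sum_congr rfl fun c _ => ?_
    rw [Multiset.count_sum']
    exact Finset.sum_congr rfl fun j _ => Multiset.count_replicate _ _ _
  rw [hcount]
  have hmem : ∀ c j, colSpace (x.U c j) ∈ supp C ∧ color C (colSpace (x.U c j)) = Sh.col c := by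
    intro c j
    have : colSpace (x.U c j) ∈ Set.range fun j => colSpace (x.U c j) := ⟨j, rfl⟩
    rwa [h.sub_range] at this
  by_cases hW : W ∈ supp C
  · obtain ⟨c, hc⟩ := h.col_surj W hW
    have : W ∈ Set.range fun j => colSpace (x.U c j) := by
      rw [h.sub_range]
      exact ⟨hW, hc.symm⟩
    obtain ⟨j, hj⟩ := this
    dsimp only at hj
    rw [Finset.sum_eq_single c, Finset.sum_eq_single j, if_pos hj, Shape.mult, hc]
    · rfl
    · intro j' _ hne
      exact if_neg fun e => hne (h.sub_inj c (e.trans hj.symm))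
    · simp
    · intro c' _ hne
      refine Finset.sum_eq_zero fun j' _ => if_neg fun e => hne (h.col_inj ?_)
      rw [← (hmem c' j').2, e, hc]
    · simp
  · rw [Finset.sum_eq_zero, eq_comm, Multiset.count_eq_zero]
    · exact fun h => hW (mem_supp.2 ⟨i, h⟩)
    · intro c _
      refine Finset.sum_eq_zero fun j _ => if_neg fun e => hW ?_
      rw [← e]
      exact (hmem c j).1

/-- The semilinear map matches subspaces and hyperplanes of equal colour and profile, which gives
the permutation. What then remains is the freedom in choosing bases and normal vectors, and this is
covered by the local factors. -/
theorem Realizes.exists_smul_eq {C : Config F k m} {γ : GammaL F k} {x x' : Obj F k Sh}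
    (h : Realizes C x) (h' : Realizes (γ • C) x') :
    ∃ (g : Gsl F k Sh) (α : Sh.Sym), x' = g • α • x ∧ toGammaL g = γ := by
  have hs : ∀ c i, ∃ i', colSpace (x'.U c i') = γ • colSpace (x.U c i) := by
    intro c i
    have h1 : colSpace (x.U c i) ∈ Set.range fun i => colSpace (x.U c i) := ⟨i, rfl⟩
    rw [h.sub_range] at h1
    have h2 : γ • colSpace (x.U c i) ∈ Set.range fun i => colSpace (x'.U c i) := by
      rw [h'.sub_range, subspaces_smul]
      exact ⟨_, h1, rfl⟩
    exact h2
  have hh : ∀ d j, ∃ j', perp (x'.V d j') = γ • perp (x.V d j) := by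
    intro d j
    have h1 : perp (x.V d j) ∈ Set.range fun j => perp (x.V d j) := ⟨j, rfl⟩
    rw [h.hyp_range] at h1
    have h2 : γ • perp (x.V d j) ∈ Set.range fun j => perp (x'.V d j) := by
      rw [h'.hyp_range, hyperplanes_smul]
      exact ⟨_, h1, rfl⟩
    exact h2
  choose σ hσ using hs
  choose τ hτ using hh
  have hσi : ∀ c, Function.Injective (σ c) := fun c i i' e =>
    h.sub_inj c (MulAction.injective γ ((hσ c i).symm.trans ((e ▸ rfl : _ = _).trans (hσ c i'))))
  have hτi : ∀ d, Function.Injective (τ d) := fun d j j' e =>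
    h.hyp_inj d (MulAction.injective γ ((hτ d j).symm.trans ((e ▸ rfl : _ = _).trans (hτ d j'))))
  let α : Sh.Sym := (fun c => Equiv.ofBijective _ (Finite.injective_iff_bijective.1 (hσi c)),
    fun d => Equiv.ofBijective _ (Finite.injective_iff_bijective.1 (hτi d)))
  let g₀ : Gsl F k Sh := ⟨(γ.left, 1, 1), γ.right⟩
  have hU : ∀ c i, ∃ B : GL (Fin (Sh.s c)) F,
      x'.U c i = (g₀ • α • x).U c i * (B : Matrix (Fin (Sh.s c)) (Fin (Sh.s c)) F)ᵀ := by
    intro c i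
    refine exists_GL_of_colSpace_eq (isIndep_inner (x := α • x) (fun c i => h.proper.indep c _) g₀ c i)
      (h'.proper.indep c i) ?_
    obtain ⟨i, rfl⟩ := (α.1 c).surjective i
    rw [colSpace_inner, perm_smul_U, Equiv.Perm.inv_def, Equiv.symm_apply_apply]
    exact (hσ c i).symm
  have hV : ∀ d j, ∃ b : Fˣ, x'.V d j = (b : F) • (g₀ • α • x).V d j := by
    intro d j
    refine exists_smul_of_perp_eq (inner_V_ne_zero (x := α • x) (fun d j => h.proper.ne_zero d _) g₀ d j)
      (h'.proper.ne_zero d j) ?_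
    obtain ⟨j, rfl⟩ := (α.2 d).surjective j
    rw [perp_inner, perm_smul_V, Equiv.Perm.inv_def, Equiv.symm_apply_apply]
    exact (hτ d j).symm
  choose B hB using hU
  choose b hb using hV
  -- The correction has trivial semilinear component, so the product still lies over `γ`.
  let g₁ : Gsl F k Sh := ⟨(1, B, b), 1⟩
  have hx' : x' = g₁ • g₀ • α • x := by
    ext1
    · funext c i
      rw [inner_smul_U, hB]
      change _ = ((1 : Matrix (Fin k) (Fin k) F) * ((g₀ • α • x).U c i).map (1 : RingAut F)) * _
      rw [Matrix.one_mul]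
      rfl
    · funext d j
      rw [inner_smul_V, hb]
      change _ = (b d j : F) • (((((1 : GL (Fin k) F)⁻¹ : GL (Fin k) F) : Matrix (Fin k) (Fin k) F))ᵀ *ᵥ
        (g₀ • α • x).V d j)
      rw [inv_one, Units.val_one, Matrix.transpose_one, Matrix.one_mulVec]
  refine ⟨g₁ * g₀, α, ?_, ?_⟩
  · rw [mul_smul]
    exact hx'
  · have h1 : toGammaL g₁ = 1 := rfl
    have h0 : toGammaL g₀ = γ := rfl
    rw [toGammaL_mul, h1, h0, one_mul]

theorem Realizes.inducedAut_eq {C : Config F k m} {x : Obj F k Sh} (h : Realizes C x)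
    (γ : GammaL F k) : γ ∈ inducedAut x ↔ γ • C = C := by
  constructor
  · rintro ⟨g, α, hx, rfl⟩
    conv_rhs => rw [← h.decode_eq, ← hx, decode_inner, decode_perm, h.decode_eq]
  · intro hγ
    obtain ⟨g, α, hx, e⟩ := h.exists_smul_eq (γ := γ) (x' := x) (hγ.symm ▸ h)
    exact ⟨g, α, hx.symm, e⟩

/-- The shapes of `C` and `γ • C` are equal but not definitionally so. Keeping the shape a variable
allows it to be substituted before the two sequences are compared. -/
theorem Realizes.output_eq [LinearOrder F] [Finite F] (hF : ∀ μ : F, μ ≠ 0 → 0 < μ ∧ 1 ≤ μ)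
    (strat : (Sh : Shape m) → Strategy F k Sh) {Sh' : Shape m} (e : Sh' = Sh) {C : Config F k m}
    {γ : GammaL F k} {x : Obj F k Sh} {x' : Obj F k Sh'} (h : Realizes C x)
    (h' : Realizes (γ • C) x') : (output (strat Sh) x).1 = (output (strat Sh') x').1 := by
  subst e
  obtain ⟨g, α, hx, -⟩ := h.exists_smul_eq h'
  exact output_canonical hF h.proper h'.proper hx

end SubspaceCanon

end

/-! ### The canonization theorem -/

theorem mainTheorem1 {F : Type*} [Field F] [Finite F] [LinearOrder F]
    (hF : ∀ μ : F, μ ≠ 0 → 0 < μ ∧ 1 ≤ μ) (k m : ℕ)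
    (pre : Preprocessing F k m) (strat : (Sh : Shape m) → Strategy F k Sh) :
    (∀ C : Config F k m, ∃ x : Obj F k (shapeOf pre C), Represents pre C x) ∧
    ∀ enc : (C : Config F k m) → Obj F k (shapeOf pre C), (∀ C, Represents pre C (enc C)) →
      IsCanonization (fun C : Config F k m => output (strat (shapeOf pre C)) (enc C)) := by
  refine ⟨exists_represents pre, fun enc henc => ⟨fun C g => ?_, fun C => ?_, fun C => ?_⟩⟩
  · exact (henc C).realizes.output_eq hF strat (shapeOf_smul pre g C) (henc (g • C)).realizes
  · have h := output_transporter hF (strat := strat (shapeOf pre C)) (henc C).realizes.proper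
    rwa [(henc C).realizes.decode_eq] at h
  · ext γ
    exact (output_aut hF (henc C).realizes.proper γ).trans ((henc C).realizes.inducedAut_eq γ)
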